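/- Let $1 \le d < D$ be integers, $\alpha \ge 0$, $\beta > 0$, $\tau, L, R > 0$ and $0 < f_{\min} < f_{\max}$. *Hölder classes.* For a compact smooth submanifold $M \subset \mathbb{R}^D$ (with the induced metric) and $p \in M$, let $\exp_p : T_pM \to M$ be the exponential map and $\mathrm{inj}_M(p)$ its injectivity radius, i.e. the supremum of all $\varepsilon$ such that $\exp_p$ is a diffeomorphism from the open ball $B_{T_pM}(0,\varepsilon)$ onto its image. For $\gamma > 0$ put $k = \lceil \gamma - 1\rceil$. A function $g : M \to \mathbb{R}^m$ is $\gamma$-Hölder if for every $p \in M$ the map $g \circ \exp_p$ is $k$ times differentiable on $B_{T_pM}(0,\mathrm{inj}_M(p))$ with $(\gamma-k)$-Hölder $k$-th derivative there, and $$\|g\|_{\mathcal{H}^\gamma} = \sup_{p \in M}\ \sup_{v \ne w \in B_{T_pM}(0,\mathrm{inj}_M(p))} \frac{\|d^k(g\circ\exp_p)(v) - d^k(g\circ\exp_p)(w)\|_{\mathrm{op}}}{\|v-w\|^{\gamma-k}}.$$ *Model.* For $x \in \mathbb{R}^D$ let $\Sigma^d_{\alpha,\beta}(x)$ be the set of Borel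 probability measures $P$ on $\mathbb{R}^D$ such that (i) the support $M$ of $P$ is a compact smooth $d$-dimensional submanifold of $\mathbb{R}^D$ without boundary, contains $x$, has reach at least $\tau$ (the reach being the supremum of all $r \ge 0$ such that every point at distance at most $r$ from $M$ has a unique nearest point in $M$), and its inclusion map $\iota_M : M \to \mathbb{R}^D$ is $(\alpha+1)$-Hölder with $\|\iota_M\|_{\mathcal{H}^{\alpha+1}} \le L$; (ii) $P$ has a density $f$ with respect to the volume measure of $M$ (the restriction to $M$ of the $d$-dimensional Hausdorff measure) that is $\beta$-Hölder on $M$ and satisfies $f_{\min} \le f \le f_{\max}$ on $M$ and $\|f\|_{\mathcal{H}^\beta} \le R$. *Estimator.* For a sample $X_1,\dots,X_n$ and $\eta > 0$ let $\widehat P_\eta = \frac1n \#\{i : \|X_i - x\| < \eta\}$, let $\widehat\delta_\eta = \log_2 \widehat P_{2\eta} - \log_2 \widehat P_{\eta}$ if $\widehat P_\eta > 0$ and $\widehat\delta_\eta = D$ if $\widehat P_\eta = 0$, and let $\widehat d_\eta = \lfloor \widehat\delta_\eta + \tfrac12\rfloor$. *Claim.* There is an $N$, depending only on $D, d,\alpha,\beta,\tau,L,f_{\min},f_{\max},R$,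 such that for all $n \ge N$ and all $x \in \mathbb{R}^D$, the estimator $\widehat d = \widehat d_\eta$ with $\eta = n^{-1/(2D+2)}$ satisfies $$\sup_{P \in \Sigma^d_{\alpha,\beta}(x)} P^{\otimes n}\big(\widehat d \ne d\big) \le 4\exp\big(-2 n^{1-(d+1)/(D+1)}\big).$$ -/

import Mathlib

open MeasureTheory Set
open scoped ENNReal NNReal ContDiff Topology

noncomputable section

namespace ManifoldModel

/-- The Euclidean space `ℝ^D`. -/
abbrev E (D : ℕ) : Type := EuclideanSpace ℝ (Fin D)

/-- `M` is a smooth embedded `d`-dimensional submanifold (without boundary) of `ℝ^D`: around each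
of its points there is a smooth diffeomorphism between open sets of `ℝ^D` that straightens `M` to
the slice `ℝ^d × {0}`. -/
def IsSmoothSubmanifold {D : ℕ} (d : ℕ) (M : Set (E D)) : Prop :=
  ∀ p ∈ M, ∃ Φ : OpenPartialHomeomorph (E D) (E D),
    p ∈ Φ.source ∧ ContDiffOn ℝ ∞ Φ Φ.source ∧ ContDiffOn ℝ ∞ Φ.symm Φ.target ∧
      ∀ q ∈ Φ.source, (q ∈ M ↔ ∀ i : Fin D, d ≤ (i : ℕ) → Φ q i = 0)

/-- The tangent space `T_p M`: the velocities at `p` of smooth curves running in `M`. For a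
submanifold these velocities already form a linear subspace; the span only serves to make
the object a subspace for every set `M`. -/
def tangentSpace {D : ℕ} (M : Set (E D)) (p : E D) : Submodule ℝ (E D) :=
  Submodule.span ℝ {v | ∃ γ : ℝ → E D, ContDiff ℝ ∞ γ ∧ (∀ᶠ t in 𝓝 (0 : ℝ), γ t ∈ M) ∧
    γ 0 = p ∧ deriv γ 0 = v}

/-- Geodesics of `M` defined on all of `ℝ`, for the metric induced by `ℝ^D`: curves in `M` whose
acceleration is everywhere normal to `M`. -/
def IsGeodesic {D : ℕ} (M : Set (E D)) (γ : ℝ → E D) : Prop :=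
  ContDiff ℝ 2 γ ∧ (∀ t, γ t ∈ M) ∧ ∀ t, deriv (deriv γ) t ∈ (tangentSpace M (γ t))ᗮ

/-- The exponential map `exp_p : T_p M → M ⊆ ℝ^D`: `exp_p v` is the position at time `1` of the
geodesic that starts at `p` with velocity `v`. (On a compact submanifold there is exactly one such
geodesic; the value is arbitrary where there is none.) -/
def expMap {D : ℕ} (M : Set (E D)) (p : E D) (v : tangentSpace M p) : E D :=
  Classical.epsilon fun q => ∃ γ : ℝ → E D,
    IsGeodesic M γ ∧ γ 0 = p ∧ deriv γ 0 = (v : E D) ∧ γ 1 = q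

/-- `exp_p` is a smooth parametrization of a part of `M` on the open ball of radius `ε` of `T_p M`:
a smooth injective immersion. As `T_p M` and `M` have the same dimension, this says that it is a
diffeomorphism onto an open subset of `M`. -/
def IsExpParametrization {D : ℕ} (M : Set (E D)) (p : E D) (ε : ℝ) : Prop :=
  ContDiffOn ℝ ∞ (expMap M p) (Metric.ball 0 ε) ∧ InjOn (expMap M p) (Metric.ball 0 ε) ∧
    ∀ v ∈ Metric.ball (0 : tangentSpace M p) ε,
      Function.Injective (fderiv ℝ (expMap M p) v)

/-- The injectivity radius `inj_M(p)`. -/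
def injRadius {D : ℕ} (M : Set (E D)) (p : E D) : ℝ≥0∞ :=
  ⨆ (ε : ℝ≥0) (_ : IsExpParametrization M p ε), (ε : ℝ≥0∞)

/-- The open ball of `T_p M` with centre `0` and radius `inj_M(p)`. -/
def injBall {D : ℕ} (M : Set (E D)) (p : E D) : Set (tangentSpace M p) :=
  {v | ‖v‖ₑ < injRadius M p}

/-- The order `k = ⌈γ - 1⌉` of the derivative in the Hölder condition of exponent `γ > 0`. -/
def holderOrder (γ : ℝ) : ℕ := ⌈γ - 1⌉₊

/-- The `γ`-Hölder functions on `M` (`γ > 0`), for a function that is given on all of `ℝ^D` but of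
which only the values on `M` matter: at each `p ∈ M`, the map `f ∘ exp_p` is `k` times
differentiable on the ball of radius `inj_M(p)` and its `k`-th derivative is `(γ - k)`-Hölder
there. (The second property makes the `k`-th derivative continuous, hence `ContDiffOn`.) -/
def MemHolder {D : ℕ} {F : Type*} [NormedAddCommGroup F] [NormedSpace ℝ F]
    (M : Set (E D)) (γ : ℝ) (f : E D → F) : Prop :=
  ∀ p ∈ M, ContDiffOn ℝ (holderOrder γ) (f ∘ expMap M p) (injBall M p) ∧
    ∃ C : ℝ, 0 < C ∧ ∀ v ∈ injBall M p, ∀ w ∈ injBall M p,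
      ‖iteratedFDeriv ℝ (holderOrder γ) (f ∘ expMap M p) v -
        iteratedFDeriv ℝ (holderOrder γ) (f ∘ expMap M p) w‖ ≤
          C * ‖v - w‖ ^ (γ - holderOrder γ)

/-- The Hölder coefficient `‖f‖_{H^γ}` of `f` on `M`. -/
def holderCoeff {D : ℕ} {F : Type*} [NormedAddCommGroup F] [NormedSpace ℝ F]
    (M : Set (E D)) (γ : ℝ) (f : E D → F) : ℝ≥0∞ :=
  ⨆ p ∈ M, ⨆ v ∈ injBall M p, ⨆ w ∈ injBall M p,
    ‖iteratedFDeriv ℝ (holderOrder γ) (f ∘ expMap M p) v -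
      iteratedFDeriv ℝ (holderOrder γ) (f ∘ expMap M p) w‖ₑ / ‖v - w‖ₑ ^ (γ - holderOrder γ)

/-- The reach of a nonempty compact set `K`: the supremum of all `r ≥ 0` such that every point at
distance at most `r` from `K` has exactly one nearest point in `K`. -/
def reach {D : ℕ} (K : Set (E D)) : ℝ≥0∞ :=
  ⨆ (r : ℝ≥0) (_ : ∀ z : E D, Metric.infDist z K ≤ r →
    ∃! y, y ∈ K ∧ Metric.infDist z K = ‖z - y‖), (r : ℝ≥0∞)

/-- The class `C_{d,α}(τ, L)` of submanifolds containing the point `x`: smooth of dimension `d`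
without boundary, compact, of reach at least `τ`, and with an inclusion map that is
`(α + 1)`-Hölder with coefficient at most `L`. -/
structure IsAdmissible {D : ℕ} (x : E D) (d : ℕ) (α τ L : ℝ) (M : Set (E D)) : Prop where
  mem : x ∈ M
  smooth : IsSmoothSubmanifold d M
  compact : IsCompact M
  reach_ge : ENNReal.ofReal τ ≤ reach M
  holder : MemHolder M (α + 1) (id : E D → E D)
  holder_le : holderCoeff M (α + 1) (id : E D → E D) ≤ ENNReal.ofReal L

/-- The volume measure `μ_M` of a `d`-dimensional submanifold: the `d`-dimensional Hausdorff
measure (normalized so as to agree with Lebesgue measure on `ℝ^d`) restricted to `M`. -/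
def volumeMeasure {D : ℕ} (d : ℕ) (M : Set (E D)) : Measure (E D) :=
  (Measure.euclideanHausdorffMeasure d).restrict M

/-- The model `Σ^d_{α,β}(τ, L, fmin, fmax, R)` at the point `x`. -/
def model {D : ℕ} (x : E D) (d : ℕ) (α β τ L fmin fmax R : ℝ) :
    Set (ProbabilityMeasure (E D)) :=
  {P | ∃ M : Set (E D), IsAdmissible x d α τ L M ∧ (P : Measure (E D)).support = M ∧
    ∃ f : E D → ℝ, Measurable f ∧
      (P : Measure (E D)) = (volumeMeasure d M).withDensity (fun z => ENNReal.ofReal (f z)) ∧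
      MemHolder M β f ∧ (∀ z ∈ M, fmin ≤ f z ∧ f z ≤ fmax) ∧
      holderCoeff M β f ≤ ENNReal.ofReal R}

/-- The empirical measure `n⁻¹ ∑ δ_{X_i}` of a sample. -/
def empiricalMeasure {D n : ℕ} (X : Fin n → E D) : Measure (E D) :=
  (n : ℝ≥0∞)⁻¹ • ∑ i, Measure.dirac (X i)

/-- The empirical mass of the open ball `B(x, η)`. -/
def empiricalMass {D n : ℕ} (x : E D) (η : ℝ) (X : Fin n → E D) : ℝ :=
  (empiricalMeasure X).real (Metric.ball x η)

open Classical in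
/-- The scaling exponent `δ̂_η`, equal to `D` when no sample point lies in `B(x, η)`. -/
def scalingExponent {D n : ℕ} (x : E D) (η : ℝ) (X : Fin n → E D) : ℝ :=
  if empiricalMass x η X = 0 then (D : ℝ)
  else Real.logb 2 (empiricalMass x (2 * η) X) - Real.logb 2 (empiricalMass x η X)

/-- The dimension estimator `d̂_η = ⌊δ̂_η + 1/2⌋`. -/
def dimEstimator {D n : ℕ} (x : E D) (η : ℝ) (X : Fin n → E D) : ℤ :=
  ⌊scalingExponent x η X + 1 / 2⌋

end ManifoldModel

end

/-! Everything rests on one uniform statement, `exists_mass_scaling`: there is a radius, depending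
only on the parameters of the model, below which P(B(x, η)) agrees with c η ^ d up to a factor 1 ±
1/16, where c = f(x) ω_d ≥ fmin ω_d and ω_d is the volume of the unit ball of ℝ^d. The masses of
B(x, η) and B(x, 2η) then have ratio close to 2 ^ d, so its binary logarithm rounds to d.

The probability is elementary. Hoeffding's inequality keeps each empirical mass within η ^ (d + 1)
of the true one, except with probability 2 exp(-2 n η ^ (2d + 2)). This deviation is smaller than
the mass by a factor of order η, hence harmless, and the choice of η turns n η ^ (2d + 2) into n ^
(1 - (d + 1)/(D + 1)). Two balls give the factor 4.

The geometry has to be uniform in M. A lower bound on the reach forbids points of M inside tangent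
balls of smaller radius (`IsSmoothSubmanifold.inner_normal_le_of_uniqueNearest`). Hence M deviates
quadratically from its tangent spaces, and the projections onto these are Lipschitz along M
(`QuadraticallyFlat.tproj_lipschitz`), with constants depending on τ alone; `IsRegular` records
this. Orthogonal projection to T_xM is therefore almost isometric near x and covers almost a full
ball, which compares the volume of M ∩ B(x, η) with ω_d η ^ d.

It remains to see that f is almost constant near x, with a uniform modulus. The Hölder bound is
expressed through exp_x on the ball of radius inj_M(x), so that radius must be bounded below.
Geodesics are compared using only the Lipschitz projections (`IsGeodesicOn.compare`): exp_x minus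
the inclusion of T_xM is 1/4-Lipschitz on a ball of radius 1/(64K). Smoothness of exp_x comes from
the geodesic equation in a graph chart and smooth dependence of flows on initial data. Finally, the
coefficient controls only the top derivative of f ∘ exp_x; the bound fmax on f itself controls the
lower ones through Taylor's formula (`exists_holder_modulus`). -/

noncomputable section

/-! ### Calculus tools: a mean value inequality, superposition operators and smooth flows. -/

namespace ManifoldModel

universe u

/-- A mean value inequality with one-sided difference quotients in place of derivatives. It will be
applied to curves of tangent projections, which are known to be Lipschitz but not differentiable. -/
theorem norm_sub_le_of_local_bound {F : Type*} [NormedAddCommGroup F] {f : ℝ → F}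
    {a b B : ℝ} (hab : a ≤ b) (hf : ContinuousOn f (Icc a b))
    (h : ∀ t ∈ Ico a b, ∀ B' > B, ∀ᶠ s in 𝓝[>] t, ‖f s - f t‖ ≤ B' * (s - t)) :
    ‖f b - f a‖ ≤ B * (b - a) := by
  have key := image_le_of_liminf_slope_right_le_deriv_boundary
    (f := fun t => ‖f t - f a‖) (a := a) (b := b)
    (B := fun t => B * (t - a)) (B' := fun _ => B)
    ((hf.sub continuousOn_const).norm) (by simp) (by fun_prop)
    (fun x _ => by
      have := ((hasDerivAt_id x).sub_const a).const_mul B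
      simpa using this.hasDerivWithinAt) ?_
  · exact key ⟨hab, le_rfl⟩
  · intro t ht r hr
    obtain ⟨B', hB1, hB2⟩ := exists_between hr
    refine Filter.Eventually.frequently ?_
    filter_upwards [h t ht B' hB1, self_mem_nhdsWithin] with s hs hst
    have hst : t < s := hst
    rw [slope_def_field, div_lt_iff₀ (by linarith)]
    have h1 : ‖f s - f a‖ ≤ ‖f s - f t‖ + ‖f t - f a‖ := norm_sub_le_norm_sub_add_norm_sub _ _ _
    have : B' * (s - t) < r * (s - t) := by
      apply mul_lt_mul_of_pos_right hB2; linarith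
    linarith

section Superposition

variable {K : Type*} [TopologicalSpace K] [CompactSpace K]
  {E : Type*} [NormedAddCommGroup E] [NormedSpace ℝ E]

/-- Pointwise application of a continuous family of operators to a continuous curve. -/
def pointwiseApply (K E F : Type*) [TopologicalSpace K] [CompactSpace K] [NormedAddCommGroup E]
    [NormedSpace ℝ E] [NormedAddCommGroup F] [NormedSpace ℝ F] :
    C(K, E →L[ℝ] F) →L[ℝ] C(K, E) →L[ℝ] C(K, F) :=
  LinearMap.mkContinuous₂
    (LinearMap.mk₂ ℝ (fun (A : C(K, E →L[ℝ] F)) (h : C(K, E)) =>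
        (⟨fun t => A t (h t), by fun_prop⟩ : C(K, F)))
      (fun _ _ _ => by ext; simp) (fun _ _ _ => by ext; simp)
      (fun _ _ _ => by ext; simp) (fun _ _ _ => by ext; simp)) 1
    (fun A h => by
      rw [ContinuousMap.norm_le _ (by positivity)]
      intro t
      simp only [LinearMap.mk₂_apply, ContinuousMap.coe_mk, one_mul]
      exact (A t).le_of_opNorm_le_of_le (A.norm_coe_le_norm t) (h.norm_coe_le_norm t))

@[simp] theorem pointwiseApply_apply {F : Type*} [NormedAddCommGroup F] [NormedSpace ℝ F]
    (A : C(K, E →L[ℝ] F)) (h : C(K, E)) (t : K) :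
    pointwiseApply K E F A h t = A t (h t) := rfl

theorem hasFDerivAt_postcomp {F : Type*} [NormedAddCommGroup F] [NormedSpace ℝ F]
    (f : C(E, F)) (f' : C(E, E →L[ℝ] F)) (hf : ∀ x, HasFDerivAt f (f' x) x) (γ : C(K, E)) :
    HasFDerivAt (fun γ : C(K, E) => f.comp γ) (pointwiseApply K E F (f'.comp γ)) γ := by
  rw [hasFDerivAt_iff_isLittleO, Asymptotics.isLittleO_iff]
  intro ε hε
  have hc : Continuous (fun γ : C(K, E) => f'.comp γ) := ContinuousMap.continuous_postcomp f'
  obtain ⟨δ, hδ, hcδ⟩ := (Metric.continuous_iff (α := C(K, E))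
    (β := C(K, E →L[ℝ] F))).1 hc γ ε hε
  filter_upwards [Metric.ball_mem_nhds γ hδ] with σ hσ
  rw [ContinuousMap.norm_le _ (by positivity)]
  intro t
  have hb : ∀ y ∈ Metric.ball (γ t) δ, ‖f' y - f' (γ t)‖ ≤ ε := by
    intro y hy
    -- Translating the whole curve by the constant y - γ t turns continuity of γ ↦ f' ∘ γ in the sup
    -- norm into a bound on f' near γ t that is uniform in t.
    have h1 : dist (γ + ContinuousMap.const K (y - γ t)) γ < δ := by
      rw [ContinuousMap.dist_lt_iff hδ]
      intro s
      simpa [dist_eq_norm] using hy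
    have h2 := hcδ _ h1
    rw [ContinuousMap.dist_lt_iff hε] at h2
    have h3 := h2 t
    simp only [ContinuousMap.comp_apply, ContinuousMap.add_apply, ContinuousMap.const_apply,
      add_sub_cancel, dist_eq_norm] at h3
    exact h3.le
  have hσt : σ t ∈ Metric.ball (γ t) δ := (ContinuousMap.dist_lt_iff hδ).1 hσ t
  have h4 := (convex_ball (γ t) δ).norm_image_sub_le_of_norm_hasFDerivWithin_le'
    (fun y _ => (hf y).hasFDerivWithinAt) hb (Metric.mem_ball_self hδ) hσt
  refine (le_trans (le_of_eq ?_) h4).trans ?_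
  · simp
  · exact mul_le_mul_of_nonneg_left ((σ - γ).norm_coe_le_norm t) hε.le

/-- The derivative is again a superposition operator, that of f', followed by a bounded linear map;
so one induction on n suffices. The target F varies because E →L[ℝ] F replaces it in the inductive
step, which is also why both spaces share a universe. -/
theorem contDiff_postcomp_nat {E : Type u} [NormedAddCommGroup E] [NormedSpace ℝ E] (n : ℕ) :
    ∀ {F : Type u} [NormedAddCommGroup F] [NormedSpace ℝ F]
    (f : C(E, F)), ContDiff ℝ n f → ContDiff ℝ n (fun γ : C(K, E) => f.comp γ) := by
  induction n with
  | zero =>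
    intro F _ _ f _
    exact contDiff_zero.2 (ContinuousMap.continuous_postcomp f)
  | succ n ih =>
    intro F _ _ f hf
    have hd : ContDiff ℝ n (fderiv ℝ f) := hf.fderiv_right (by norm_cast)
    refine contDiff_succ_iff_hasFDerivAt.2
      ⟨fun γ => pointwiseApply K E F ((⟨fderiv ℝ f, hd.continuous⟩ : C(E, E →L[ℝ] F)).comp γ),
        ?_, ?_⟩
    · exact (pointwiseApply K E F).contDiff.comp
        (ih (⟨fderiv ℝ f, hd.continuous⟩ : C(E, E →L[ℝ] F)) hd)
    · intro γ
      refine hasFDerivAt_postcomp f _ (fun x => ?_) γ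
      exact (hf.differentiable (by norm_cast) x).hasFDerivAt

theorem contDiff_postcomp (f : C(E, E)) (hf : ContDiff ℝ ∞ f) :
    ContDiff ℝ ∞ (fun γ : C(K, E) => f.comp γ) :=
  contDiff_infty.2 fun n => contDiff_postcomp_nat n f (contDiff_infty.1 hf n)

end Superposition

section Flow

variable {E : Type*} [NormedAddCommGroup E] [NormedSpace ℝ E] [CompleteSpace E]

/-- The Volterra operator `γ ↦ ∫₀ᵗ γ` on `C([0, ε], E)`. -/
def volterra (E : Type*) [NormedAddCommGroup E] [NormedSpace ℝ E] [CompleteSpace E]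
    {ε : ℝ} (hε : 0 ≤ ε) : C(Icc 0 ε, E) →L[ℝ] C(Icc 0 ε, E) :=
  LinearMap.mkContinuous
    { toFun := fun γ => ⟨fun t => ∫ s in (0 : ℝ)..t, γ (projIcc 0 ε hε s),
        (intervalIntegral.continuous_primitive (fun a b =>
          (γ.continuous.comp continuous_projIcc).intervalIntegrable a b) 0).comp
            continuous_subtype_val⟩
      map_add' := fun γ σ => by
        ext t
        simp only [ContinuousMap.add_apply, ContinuousMap.coe_mk]
        exact intervalIntegral.integral_add
          ((γ.continuous.comp continuous_projIcc).intervalIntegrable _ _)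
          ((σ.continuous.comp continuous_projIcc).intervalIntegrable _ _)
      map_smul' := fun c γ => by
        ext t
        simp } ε
    (fun γ => by
      rw [ContinuousMap.norm_le _ (by positivity)]
      intro t
      have := intervalIntegral.norm_integral_le_of_norm_le_const (a := (0 : ℝ)) (b := t)
        (f := fun s => γ (projIcc 0 ε hε s)) (C := ‖γ‖) (fun s _ => γ.norm_coe_le_norm _)
      refine this.trans ?_
      rw [sub_zero, abs_of_nonneg t.2.1, mul_comm]
      exact mul_le_mul_of_nonneg_right t.2.2 (norm_nonneg _))

theorem volterra_apply {ε : ℝ} (hε : 0 ≤ ε) (γ : C(Icc 0 ε, E)) (t : Icc 0 ε) :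
    volterra E hε γ t = ∫ s in (0 : ℝ)..t, γ (projIcc 0 ε hε s) := rfl

theorem norm_volterra_le {ε : ℝ} (hε : 0 ≤ ε) : ‖volterra E hε‖ ≤ ε :=
  LinearMap.mkContinuous_norm_le _ hε _

/-- A smooth perturbation of the identity by a contraction has a smooth left inverse. -/
theorem exists_contDiff_leftInverse_of_lipschitz_sub_id {X : Type*} [NormedAddCommGroup X]
    [NormedSpace ℝ X] [CompleteSpace X] {Θ : X → X} (hΘ : ContDiff ℝ ∞ Θ)
    (hlip : ∀ γ σ, ‖Θ γ - Θ σ - (γ - σ)‖ ≤ 1 / 2 * ‖γ - σ‖) :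
    ∃ G : X → X, ContDiff ℝ ∞ G ∧ ∀ γ, G (Θ γ) = γ := by
  have hhalf : ((1 / 2 : ℝ≥0) : ℝ) = 1 / 2 := by norm_num
  have happ : ApproximatesLinearOn Θ
      ((ContinuousLinearEquiv.refl ℝ X : X ≃L[ℝ] X) : X →L[ℝ] X) univ (1 / 2 : ℝ≥0) := by
    intro γ _ σ _
    rw [hhalf]
    exact hlip γ σ
  have hc : Subsingleton X ∨ (1 / 2 : ℝ≥0) <
      ‖((ContinuousLinearEquiv.refl ℝ X).symm : X →L[ℝ] X)‖₊⁻¹ := by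
    rcases subsingleton_or_nontrivial X with h | h
    · exact Or.inl h
    · right
      have : ‖((ContinuousLinearEquiv.refl ℝ X).symm : X →L[ℝ] X)‖₊ = 1 := by
        apply NNReal.eq
        simp
      rw [this, inv_one]
      exact NNReal.half_lt_self one_ne_zero
  let H := happ.toHomeomorph Θ hc
  have hder : ∀ γ, ∃ A : X ≃L[ℝ] X, HasFDerivAt H (A : X →L[ℝ] X) γ := by
    intro γ
    have hd : HasFDerivAt Θ (fderiv ℝ Θ γ) γ :=
      (hΘ.differentiable (by simp) γ).hasFDerivAt
    have hlip : LipschitzWith (1 / 2 : ℝ≥0) (fun γ => Θ γ - γ) := by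
      refine LipschitzWith.of_dist_le_mul fun γ σ => ?_
      rw [dist_eq_norm, dist_eq_norm, hhalf, sub_sub_sub_comm]
      exact hlip γ σ
    -- The derivative of Θ - id has norm at most 1/2, so the derivative of Θ is invertible by the
    -- Neumann series. This is what makes the inverse homeomorphism smooth.
    have hn : ‖ContinuousLinearMap.id ℝ X - fderiv ℝ Θ γ‖ < 1 := by
      have h1 := (hd.sub (hasFDerivAt_id γ)).le_of_lipschitz hlip
      rw [norm_sub_rev]
      refine h1.trans_lt ?_
      rw [hhalf]; norm_num
    let U : (X →L[ℝ] X)ˣ := Units.oneSub (ContinuousLinearMap.id ℝ X - fderiv ℝ Θ γ) hn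
    refine ⟨ContinuousLinearEquiv.ofUnit U, ?_⟩
    have hU : (ContinuousLinearEquiv.ofUnit U : X →L[ℝ] X) = fderiv ℝ Θ γ := ?_
    · rw [hU]; exact hd
    ext1 σ
    change (U : X →L[ℝ] X) σ = _
    simp [U, Units.val_oneSub]
  choose A hA using hder
  exact ⟨H.symm, H.contDiff_symm hA hΘ, fun γ => H.symm_apply_apply γ⟩

/-- The time-`ε` map of a smooth Lipschitz vector field is smooth, for short times `ε`. -/
theorem exists_contDiff_shortTimeMap {f : E → E} (hf : ContDiff ℝ ∞ f) {l : ℝ≥0}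
    (hl : LipschitzWith l f) {ε : ℝ} (hε : 0 ≤ ε) (hεl : ε * l ≤ 1 / 2) :
    ∃ S : E → E, ContDiff ℝ ∞ S ∧ ∀ z : ℝ → E,
      (∀ t ∈ Icc 0 ε, HasDerivAt z (f (z t)) t) → z ε = S (z 0) := by
  let F : C(E, E) := ⟨f, hf.continuous⟩
  -- In integrated form the differential equation says that Θ γ is the constant curve z 0. A smooth
  -- left inverse of Θ, applied to constants and evaluated at time ε, is therefore the time-ε map;
  -- the condition on ε makes Θ - id a 1/2-contraction.
  let Θ : C(Icc 0 ε, E) → C(Icc 0 ε, E) := fun γ => γ - volterra E hε (F.comp γ)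
  have hΘ : ContDiff ℝ ∞ Θ :=
    contDiff_id.sub ((volterra E hε).contDiff.comp (contDiff_postcomp F hf))
  have happ : ∀ γ σ, ‖Θ γ - Θ σ - (γ - σ)‖ ≤ 1 / 2 * ‖γ - σ‖ := by
    intro γ σ
    have h1 : Θ γ - Θ σ - (γ - σ) = - volterra E hε (F.comp γ - F.comp σ) := by
      simp only [Θ, map_sub]; abel
    have h2 : ‖F.comp γ - F.comp σ‖ ≤ l * ‖γ - σ‖ := by
      rw [ContinuousMap.norm_le _ (by positivity)]
      intro t
      have := hl.dist_le_mul (γ t) (σ t)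
      rw [dist_eq_norm, dist_eq_norm] at this
      exact this.trans (mul_le_mul_of_nonneg_left ((γ - σ).norm_coe_le_norm t) l.2)
    have h3 := (volterra E hε).le_of_opNorm_le_of_le (norm_volterra_le hε) h2
    rw [h1, norm_neg]
    refine h3.trans ?_
    rw [← mul_assoc]
    exact mul_le_mul_of_nonneg_right hεl (norm_nonneg _)
  obtain ⟨G, hG, hGΘ⟩ := exists_contDiff_leftInverse_of_lipschitz_sub_id hΘ happ
  let cst : E →L[ℝ] C(Icc 0 ε, E) := ContinuousLinearMap.const ℝ (Icc 0 ε)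
  let e : Icc 0 ε := ⟨ε, hε, le_rfl⟩
  let ev : C(Icc 0 ε, E) →L[ℝ] E := ContinuousMap.evalCLM ℝ e
  refine ⟨fun x => ev (G (cst x)), ev.contDiff.comp (hG.comp cst.contDiff), ?_⟩
  intro z hz
  let γ : C(Icc 0 ε, E) := ⟨fun t => z t, by
    rw [continuous_iff_continuousAt]
    intro t
    exact (hz t t.2).continuousAt.comp continuous_subtype_val.continuousAt⟩
  have hγ : Θ γ = cst (z 0) := by
    ext t
    have h1 : ∫ s in (0 : ℝ)..t, (F.comp γ) (projIcc 0 ε hε s) = ∫ s in (0 : ℝ)..t, f (z s) := by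
      apply intervalIntegral.integral_congr
      intro s hs
      rw [uIcc_of_le t.2.1] at hs
      simp only [ContinuousMap.comp_apply]
      change f (z (projIcc 0 ε hε s)) = _
      rw [projIcc_of_mem hε ⟨hs.1, hs.2.trans t.2.2⟩]
    have hzc : ContinuousOn z (Icc 0 ε) := fun s hs => (hz s hs).continuousAt.continuousWithinAt
    have h2 : ∫ s in (0 : ℝ)..t, f (z s) = z t - z 0 := by
      apply intervalIntegral.integral_eq_sub_of_hasDerivAt
      · intro s hs
        rw [uIcc_of_le t.2.1] at hs
        exact hz s ⟨hs.1, hs.2.trans t.2.2⟩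
      · apply ContinuousOn.intervalIntegrable
        rw [uIcc_of_le t.2.1]
        exact hf.continuous.comp_continuousOn (hzc.mono (Icc_subset_Icc_right t.2.2))
    change γ t - volterra E hε (F.comp γ) t = z 0
    rw [volterra_apply, h1, h2]
    change z t - (z t - z 0) = z 0
    abel
  have : G (cst (z 0)) = γ := by rw [← hγ, hGΘ]
  change z ε = ev (G (cst (z 0)))
  rw [this]
  rfl

/-- The time-one map of a smooth Lipschitz vector field is smooth. -/
theorem exists_contDiff_timeOneMap {f : E → E} (hf : ContDiff ℝ ∞ f) {l : ℝ≥0}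
    (hl : LipschitzWith l f) :
    ∃ S : E → E, ContDiff ℝ ∞ S ∧ ∀ z : ℝ → E,
      (∀ t ∈ Icc (0 : ℝ) 1, HasDerivAt z (f (z t)) t) → z 1 = S (z 0) := by
  -- With N > 2l a step of length 1/N is short enough, and the time-one map is the N-th iterate of
  -- the short one.
  obtain ⟨N, hN⟩ := exists_nat_gt (2 * (l : ℝ))
  have hN0 : (0 : ℝ) < N := lt_of_le_of_lt (by positivity) hN
  obtain ⟨S, hS, hSz⟩ := exists_contDiff_shortTimeMap hf hl (ε := 1 / N) (by positivity)
    (by rw [div_mul_eq_mul_div, div_le_div_iff₀ hN0 (by norm_num)]; linarith)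
  refine ⟨S^[N], ?_, ?_⟩
  · clear hN hN0 hSz
    induction N with
    | zero => exact contDiff_id
    | succ k ih => rw [Function.iterate_succ']; exact hS.comp ih
  · intro z hz
    have key : ∀ k : ℕ, k ≤ N → z (k * (1 / N)) = S^[k] (z 0) := by
      intro k
      induction k with
      | zero => intro _; simp
      | succ k ih =>
        intro hk
        rw [Function.iterate_succ', Function.comp_apply, ← ih (by omega)]
        have := hSz (fun t => z (t + k * (1 / N))) (fun t ht => ?_)
        · simp only [zero_add] at this
          rw [← this]; congr 1; push_cast; ring
        · refine HasDerivAt.comp_add_const (f := z) t _ (hz _ ⟨?_, ?_⟩)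
          · have := ht.1; positivity
          · have h1 : ((k : ℝ) + 1) ≤ N := by exact_mod_cast hk
            have h2 : t + k * (1 / N) ≤ (k + 1) * (1 / N) := by linarith [ht.2]
            refine h2.trans ?_
            rw [mul_one_div, div_le_one hN0]; exact h1
    have := key N le_rfl
    rwa [mul_one_div_cancel hN0.ne'] at this

/-- Solutions of a bounded Lipschitz autonomous equation exist on any bounded interval. -/
theorem exists_solution_of_bounded_lipschitz {f : E → E} {l b : ℝ≥0}
    (hl : LipschitzWith l f) (hb : ∀ x, ‖f x‖ ≤ b) {T : ℝ} (hT : 0 ≤ T) (x : E) :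
    ∃ z : ℝ → E, z 0 = x ∧ ∀ t ∈ Ioo (-T) T, HasDerivAt z (f (z t)) t := by
  have hp : IsPicardLindelof (fun _ => f) (tmin := -T) (tmax := T)
      ⟨0, by constructor <;> linarith⟩ x (b * ⟨T, hT⟩) 0 b l :=
    { lipschitzOnWith := fun _ _ => hl.lipschitzOnWith
      continuousOn := fun _ _ => continuousOn_const
      norm_le := fun _ _ y _ => hb y
      mul_max_le := by simp; rfl }
  obtain ⟨z, hz0, hz⟩ := hp.exists_eq_forall_mem_Icc_hasDerivWithinAt₀
  exact ⟨z, hz0, fun t ht => (hz t ⟨ht.1.le, ht.2.le⟩).hasDerivAt (Icc_mem_nhds ht.1 ht.2)⟩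

end Flow

end ManifoldModel

end

/-! ### Slice charts, tangent spaces and local second-order approximation. -/

noncomputable section

namespace ManifoldModel

variable {D d : ℕ} {M : Set (E D)}

/-- The coordinate subspace `ℝ^d × {0}` of `ℝ^D`. -/
def slice (D d : ℕ) : Submodule ℝ (E D) where
  carrier := {v | ∀ i : Fin D, d ≤ (i : ℕ) → v i = 0}
  add_mem' := fun {a b} ha hb i hi => by simp [ha i hi, hb i hi]
  zero_mem' := fun i _ => by simp
  smul_mem' := fun c v hv i hi => by simp [hv i hi]

theorem finrank_slice (hd : d ≤ D) : Module.finrank ℝ (slice D d) = d := by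
  let e : slice D d ≃ₗ[ℝ] (Fin d → ℝ) :=
    { toFun := fun v j => (v : E D) (Fin.castLE hd j)
      map_add' := fun _ _ => by ext; simp
      map_smul' := fun _ _ => by ext; simp
      invFun := fun y => ⟨WithLp.toLp 2 fun i => if h : (i : ℕ) < d then y ⟨i, h⟩ else 0,
        fun i hi => by simp [not_lt.2 hi]⟩
      left_inv := fun v => by
        ext i
        by_cases h : (i : ℕ) < d
        · simp [h]
        · simp [h, v.2 i (not_lt.1 h)]
      right_inv := fun y => by ext j; simp }
  rw [e.finrank_eq, Module.finrank_fin_fun]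

/-- A chart of the ambient space that straightens `M`. -/
structure IsSliceChart (d : ℕ) (M : Set (E D)) (Φ : OpenPartialHomeomorph (E D) (E D)) : Prop where
  smooth : ContDiffOn ℝ ∞ Φ Φ.source
  smooth_symm : ContDiffOn ℝ ∞ Φ.symm Φ.target
  mem_iff : ∀ q ∈ Φ.source, (q ∈ M ↔ Φ q ∈ slice D d)

theorem IsSmoothSubmanifold.exists_chart (h : IsSmoothSubmanifold d M) {p : E D} (hp : p ∈ M) :
    ∃ Φ, p ∈ Φ.source ∧ IsSliceChart d M Φ := by
  obtain ⟨Φ, h1, h2, h3, h4⟩ := h p hp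
  exact ⟨Φ, h1, h2, h3, h4⟩

namespace IsSliceChart

variable {Φ : OpenPartialHomeomorph (E D) (E D)}

theorem hasFDerivAt (h : IsSliceChart d M Φ) {q : E D} (hq : q ∈ Φ.source) :
    HasFDerivAt Φ (fderiv ℝ Φ q) q :=
  ((h.smooth.contDiffAt (Φ.open_source.mem_nhds hq)).differentiableAt (by simp)).hasFDerivAt

theorem contDiffAt_symm (h : IsSliceChart d M Φ) {y : E D} (hy : y ∈ Φ.target) :
    ContDiffAt ℝ ∞ Φ.symm y :=
  h.smooth_symm.contDiffAt (Φ.open_target.mem_nhds hy)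

theorem hasFDerivAt_symm (h : IsSliceChart d M Φ) {y : E D} (hy : y ∈ Φ.target) :
    HasFDerivAt Φ.symm (fderiv ℝ Φ.symm y) y :=
  ((h.contDiffAt_symm hy).differentiableAt (by simp)).hasFDerivAt

theorem fderiv_symm_fderiv (h : IsSliceChart d M Φ) {q : E D} (hq : q ∈ Φ.source) (v : E D) :
    fderiv ℝ Φ.symm (Φ q) (fderiv ℝ Φ q v) = v := by
  have h1 := (h.hasFDerivAt_symm (Φ.map_source hq)).comp q (h.hasFDerivAt hq)
  have h2 : HasFDerivAt (Φ.symm ∘ Φ) (ContinuousLinearMap.id ℝ (E D)) q :=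
    (hasFDerivAt_id q).congr_of_eventuallyEq (Φ.eventually_left_inverse hq)
  exact DFunLike.congr_fun (h1.unique h2) v

theorem fderiv_fderiv_symm (h : IsSliceChart d M Φ) {q : E D} (hq : q ∈ Φ.source) (v : E D) :
    fderiv ℝ Φ q (fderiv ℝ Φ.symm (Φ q) v) = v := by
  have h0 : HasFDerivAt Φ (fderiv ℝ Φ q) (Φ.symm (Φ q)) := by
    rw [Φ.left_inv hq]; exact h.hasFDerivAt hq
  have h1 := h0.comp (Φ q) (h.hasFDerivAt_symm (Φ.map_source hq))
  have h2 : HasFDerivAt (Φ ∘ Φ.symm) (ContinuousLinearMap.id ℝ (E D)) (Φ q) :=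
    (hasFDerivAt_id _).congr_of_eventuallyEq (Φ.eventually_right_inverse (Φ.map_source hq))
  exact DFunLike.congr_fun (h1.unique h2) v

theorem symm_mem (h : IsSliceChart d M Φ) {y : E D} (hy : y ∈ Φ.target) (hys : y ∈ slice D d) :
    Φ.symm y ∈ M := by
  rw [h.mem_iff _ (Φ.map_target hy), Φ.right_inv hy]
  exact hys

theorem velocity_mem (h : IsSliceChart d M Φ) {γ : ℝ → E D} {v : E D} {t : ℝ}
    (hγ : HasDerivAt γ v t) (hM : ∀ᶠ s in 𝓝 t, γ s ∈ M) (hs : γ t ∈ Φ.source) :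
    v ∈ (slice D d).map (fderiv ℝ Φ.symm (Φ (γ t)) : E D →ₗ[ℝ] E D) := by
  refine ⟨fderiv ℝ Φ (γ t) v, ?_, h.fderiv_symm_fderiv hs v⟩
  intro i hi
  have h1 : HasDerivAt (Φ ∘ γ) (fderiv ℝ Φ (γ t) v) t :=
    (h.hasFDerivAt hs).comp_hasDerivAt t hγ
  have h2 : HasDerivAt (fun s => Φ (γ s) i) (fderiv ℝ Φ (γ t) v i) t :=
    (EuclideanSpace.proj (𝕜 := ℝ) i).hasFDerivAt.comp_hasDerivAt t h1
  have h3 : HasDerivAt (fun _ : ℝ => (0 : ℝ)) 0 t := hasDerivAt_const _ _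
  refine h2.unique (h3.congr_of_eventuallyEq ?_)
  filter_upwards [hM, hγ.continuousAt (Φ.open_source.mem_nhds hs)] with s hs1 hs2
  exact (h.mem_iff _ hs2).1 hs1 i hi

theorem tangentSpace_eq (h : IsSliceChart d M Φ) {q : E D} (hq : q ∈ M) (hs : q ∈ Φ.source) :
    tangentSpace M q = (slice D d).map (fderiv ℝ Φ.symm (Φ q) : E D →ₗ[ℝ] E D) := by
  apply le_antisymm
  · refine Submodule.span_le.2 ?_
    rintro v ⟨γ, hγ, hM, h0, rfl⟩
    have := h.velocity_mem (hγ.differentiable (by simp) 0).hasDerivAt hM (by rwa [h0])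
    rwa [h0] at this
  · rintro _ ⟨a, ha, rfl⟩
    obtain ⟨ρ, hρ, hball⟩ := Metric.isOpen_iff.1 Φ.open_target _ (Φ.map_source hs)
    -- Tangent vectors are velocities of curves smooth on all of ℝ. The displacement ε sin(t/ε) a
    -- has velocity a at 0 and length less than ρ at all times, so the curve never leaves the chart.
    let ε : ℝ := ρ / (‖a‖ + 1)
    have hn : 0 < ‖a‖ + 1 := by positivity
    have hε : 0 < ε := by positivity
    have hmem : ∀ t : ℝ, Φ q + (ε * Real.sin (t / ε)) • a ∈ Φ.target := by
      intro t
      apply hball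
      rw [mem_ball_iff_norm, add_sub_cancel_left, norm_smul, Real.norm_eq_abs, abs_mul,
        abs_of_pos hε]
      calc ε * |Real.sin (t / ε)| * ‖a‖ ≤ ε * 1 * ‖a‖ := by
            gcongr; exact Real.abs_sin_le_one _
        _ < ε * (‖a‖ + 1) := by rw [mul_one]; gcongr; linarith
        _ = ρ := by simp only [ε]; field_simp
    have hcd : ContDiff ℝ ∞ (fun t : ℝ => Φ q + (ε * Real.sin (t / ε)) • a) := by fun_prop
    have hder : HasDerivAt (fun t : ℝ => Φ q + (ε * Real.sin (t / ε)) • a) a 0 := by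
      have h1 : HasDerivAt (fun t : ℝ => t / ε) (1 / ε) 0 := (hasDerivAt_id 0).div_const ε
      have h2 := ((h1.sin.const_mul ε).smul_const a).const_add (Φ q)
      have h3 : (ε * (Real.cos (0 / ε) * (1 / ε))) • a = a := by simp [hε.ne']
      rwa [h3] at h2
    refine Submodule.subset_span ⟨fun t => Φ.symm (Φ q + (ε * Real.sin (t / ε)) • a), ?_, ?_, ?_, ?_⟩
    · rw [← contDiffOn_univ] at hcd ⊢
      exact h.smooth_symm.comp hcd (fun t _ => hmem t)
    · refine Filter.Eventually.of_forall fun t => h.symm_mem (hmem t) ?_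
      exact Submodule.add_mem _ ((h.mem_iff q hs).1 hq) (Submodule.smul_mem _ _ ha)
    · simp [Φ.left_inv hs]
    · have h0 : HasFDerivAt Φ.symm (fderiv ℝ Φ.symm (Φ q))
          (Φ q + (ε * Real.sin (0 / ε)) • a) := by
        simpa using h.hasFDerivAt_symm (Φ.map_source hs)
      exact (h0.comp_hasDerivAt 0 hder).deriv

theorem finrank_tangentSpace (h : IsSliceChart d M Φ) (hd : d ≤ D) {q : E D} (hq : q ∈ M)
    (hs : q ∈ Φ.source) : Module.finrank ℝ (tangentSpace M q) = d := by
  rw [h.tangentSpace_eq hq hs]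
  refine (Submodule.equivMapOfInjective _ ?_ _).symm.finrank_eq.trans (finrank_slice hd)
  exact Function.LeftInverse.injective (g := fderiv ℝ Φ q) (h.fderiv_fderiv_symm hs)

end IsSliceChart

theorem IsSmoothSubmanifold.finrank_tangentSpace (h : IsSmoothSubmanifold d M) (hd : d ≤ D)
    {q : E D} (hq : q ∈ M) : Module.finrank ℝ (tangentSpace M q) = d := by
  obtain ⟨Φ, hs, hΦ⟩ := h.exists_chart hq
  exact hΦ.finrank_tangentSpace hd hq hs

theorem IsSmoothSubmanifold.velocity_mem (h : IsSmoothSubmanifold d M) {γ : ℝ → E D} {v : E D}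
    {t : ℝ} (hγ : HasDerivAt γ v t) (hM : ∀ᶠ s in 𝓝 t, γ s ∈ M) :
    v ∈ tangentSpace M (γ t) := by
  obtain ⟨Φ, hs, hΦ⟩ := h.exists_chart hM.self_of_nhds
  rw [hΦ.tangentSpace_eq hM.self_of_nhds hs]
  exact hΦ.velocity_mem hγ hM hs

theorem norm_image_sub_sub_fderiv_le {V W : Type*} [NormedAddCommGroup V] [NormedSpace ℝ V]
    [NormedAddCommGroup W] [NormedSpace ℝ W] {f : V → W} {f' : V → V →L[ℝ] W} {s : Set V}
    (hs : Convex ℝ s) (hf : ∀ x ∈ s, HasFDerivAt f (f' x) x) {c : ℝ≥0}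
    (hc : LipschitzOnWith c f' s) {x y : V} (hx : x ∈ s) (hy : y ∈ s) :
    ‖f y - f x - f' x (y - x)‖ ≤ c * ‖y - x‖ ^ 2 := by
  have hseg : segment ℝ x y ⊆ s := hs.segment_subset hx hy
  have := (convex_segment x y).norm_image_sub_le_of_norm_hasFDerivWithin_le'
    (f := f) (f' := f') (φ := f' x) (C := c * ‖y - x‖)
    (fun z hz => (hf z (hseg hz)).hasFDerivWithinAt)
    (fun z hz => by
      have h1 := hc.dist_le_mul z (hseg hz) x hx
      rw [dist_eq_norm, dist_eq_norm] at h1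
      refine h1.trans (mul_le_mul_of_nonneg_left ?_ c.2)
      exact norm_sub_le_of_mem_segment hz)
    (left_mem_segment ℝ x y) (right_mem_segment ℝ x y)
  rwa [mul_assoc, ← sq] at this

/-- Near each of its points a submanifold agrees with its tangent spaces to second order, with a
locally uniform constant. -/
theorem IsSmoothSubmanifold.exists_local_quadratic (h : IsSmoothSubmanifold d M) {p : E D}
    (hp : p ∈ M) : ∃ r > 0, ∃ C > 0, ∀ q ∈ M, ‖q - p‖ < r →
      (∀ q' ∈ M, ‖q' - p‖ < r → ∃ v ∈ tangentSpace M q, ‖q' - q - v‖ ≤ C * ‖q' - q‖ ^ 2) ∧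
      (∀ v ∈ tangentSpace M q, ‖v‖ < r → ∃ q' ∈ M, ‖q' - q - v‖ ≤ C * ‖v‖ ^ 2) := by
  obtain ⟨Φ, hps, hΦ⟩ := h.exists_chart hp
  obtain ⟨c₁, s₁, hs₁, hc₁⟩ :=
    ((hΦ.smooth.contDiffAt (Φ.open_source.mem_nhds hps)).of_le (m := 1)
      (by norm_cast)).exists_lipschitzOnWith
  have hd : ContDiffAt ℝ 1 (fderiv ℝ Φ.symm) (Φ p) :=
    (hΦ.contDiffAt_symm (Φ.map_source hps)).fderiv_right (by norm_cast)
  obtain ⟨c₂, s₂, hs₂, hc₂⟩ := hd.exists_lipschitzOnWith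
  obtain ⟨r₁, hr₁, hb₁⟩ := Metric.mem_nhds_iff.1
    (Filter.inter_mem hs₁ (Φ.open_source.mem_nhds hps))
  obtain ⟨r₂, hr₂, hb₂⟩ := Metric.mem_nhds_iff.1
    (Filter.inter_mem hs₂ (Φ.open_target.mem_nhds (Φ.map_source hps)))
  have hn : 0 < (c₁ : ℝ) + 1 := by positivity
  -- The Taylor error of the inverse chart is c₂ times the squared displacement in the chart, which
  -- is at most c₁ times the displacement in M. The radius keeps the base point and the displacement
  -- each below r₂/2 in the chart.
  refine ⟨min r₁ (r₂ / (2 * (c₁ + 1))), by positivity, c₂ * c₁ ^ 2 + 1, by positivity, ?_⟩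
  intro q hq hqr
  have hsrc : ∀ q, ‖q - p‖ < min r₁ (r₂ / (2 * (c₁ + 1))) → q ∈ s₁ ∩ Φ.source := fun q hqr =>
    hb₁ (mem_ball_iff_norm.2 (hqr.trans_le (min_le_left _ _)))
  have hps₁ : p ∈ s₁ ∩ Φ.source := hb₁ (Metric.mem_ball_self hr₁)
  have hlip : ∀ q q', q ∈ s₁ ∩ Φ.source → q' ∈ s₁ ∩ Φ.source → ‖Φ q' - Φ q‖ ≤ c₁ * ‖q' - q‖ := by
    intro q q' hq hq'
    have := hc₁.dist_le_mul q' hq'.1 q hq.1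
    rwa [dist_eq_norm, dist_eq_norm] at this
  have hhalf : ∀ t, t < min r₁ (r₂ / (2 * (c₁ + 1))) → c₁ * t < r₂ / 2 := by
    intro t ht
    have h1 : t < r₂ / (2 * (c₁ + 1)) := ht.trans_le (min_le_right _ _)
    rcases lt_or_ge t 0 with h0 | h0
    · have : c₁ * t ≤ 0 := mul_nonpos_of_nonneg_of_nonpos c₁.2 h0.le
      linarith
    · calc c₁ * t ≤ (c₁ + 1) * t := by nlinarith
        _ < (c₁ + 1) * (r₂ / (2 * (c₁ + 1))) := by gcongr
        _ = r₂ / 2 := by field_simp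
  have htgt : ∀ q, ‖q - p‖ < min r₁ (r₂ / (2 * (c₁ + 1))) → ‖Φ q - Φ p‖ < r₂ / 2 := fun q hqr =>
    (hlip p q hps₁ (hsrc q hqr)).trans_lt (hhalf _ hqr)
  have hquad : ∀ y ∈ Metric.ball (Φ p) r₂, ∀ y' ∈ Metric.ball (Φ p) r₂,
      ‖Φ.symm y' - Φ.symm y - fderiv ℝ Φ.symm y (y' - y)‖ ≤ c₂ * ‖y' - y‖ ^ 2 := by
    intro y hy y' hy'
    exact norm_image_sub_sub_fderiv_le (convex_ball _ _)
      (fun z hz => hΦ.hasFDerivAt_symm (hb₂ hz).2)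
      (hc₂.mono fun z hz => (hb₂ hz).1) hy hy'
  have hqs := hsrc q hqr
  have hqt := htgt q hqr
  have hT := hΦ.tangentSpace_eq hq hqs.2
  have hqS := (hΦ.mem_iff q hqs.2).1 hq
  constructor
  · intro q' hq' hqr'
    have hqs' := hsrc q' hqr'
    refine ⟨fderiv ℝ Φ.symm (Φ q) (Φ q' - Φ q), ?_, ?_⟩
    · rw [hT]
      exact ⟨_, Submodule.sub_mem _ ((hΦ.mem_iff q' hqs'.2).1 hq') hqS, rfl⟩
    · have h1 := hquad (Φ q) (mem_ball_iff_norm.2 (by linarith)) (Φ q')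
        (mem_ball_iff_norm.2 (by linarith [htgt q' hqr']))
      rw [Φ.left_inv hqs.2, Φ.left_inv hqs'.2] at h1
      refine h1.trans ?_
      have h2 := hlip q q' hqs hqs'
      calc (c₂ : ℝ) * ‖Φ q' - Φ q‖ ^ 2 ≤ c₂ * (c₁ * ‖q' - q‖) ^ 2 := by gcongr
        _ ≤ (c₂ * c₁ ^ 2 + 1) * ‖q' - q‖ ^ 2 := by nlinarith [sq_nonneg ‖q' - q‖]
  · intro v hv hvr
    rw [hT] at hv
    obtain ⟨a, ha, rfl⟩ := hv
    simp only [ContinuousLinearMap.coe_coe] at hvr ⊢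
    have haeq : fderiv ℝ Φ q (fderiv ℝ Φ.symm (Φ q) a) = a := hΦ.fderiv_fderiv_symm hqs.2 a
    have hn : ‖fderiv ℝ Φ q‖ ≤ c₁ := by
      refine (hΦ.hasFDerivAt hqs.2).le_of_lipschitzOn ?_ hc₁
      refine Filter.mem_of_superset
        (Metric.isOpen_ball.mem_nhds (mem_ball_iff_norm.2 (hqr.trans_le (min_le_left _ _))))
        (fun z hz => (hb₁ hz).1)
    have hav : ‖a‖ ≤ c₁ * ‖fderiv ℝ Φ.symm (Φ q) a‖ := by
      conv_lhs => rw [← haeq]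
      exact (fderiv ℝ Φ q).le_of_opNorm_le hn _
    have har : ‖a‖ < r₂ / 2 := hav.trans_lt (hhalf _ hvr)
    have hb : Φ q + a ∈ Metric.ball (Φ p) r₂ := by
      rw [mem_ball_iff_norm]
      calc ‖Φ q + a - Φ p‖ = ‖(Φ q - Φ p) + a‖ := by congr 1; abel
        _ ≤ ‖Φ q - Φ p‖ + ‖a‖ := norm_add_le _ _
        _ < r₂ := by linarith
    refine ⟨Φ.symm (Φ q + a), hΦ.symm_mem (hb₂ hb).2 (Submodule.add_mem _ hqS ha), ?_⟩
    have h1 := hquad (Φ q) (mem_ball_iff_norm.2 (by linarith)) (Φ q + a) hb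
    rw [Φ.left_inv hqs.2, add_sub_cancel_left] at h1
    refine h1.trans ?_
    set w := fderiv ℝ Φ.symm (Φ q) a
    calc (c₂ : ℝ) * ‖a‖ ^ 2 ≤ c₂ * (c₁ * ‖w‖) ^ 2 := by gcongr
      _ ≤ (c₂ * c₁ ^ 2 + 1) * ‖w‖ ^ 2 := by nlinarith [sq_nonneg ‖w‖]

end ManifoldModel

end

/-! ### The reach: tangent balls of smaller radius contain no point of the submanifold. -/

noncomputable section

namespace ManifoldModel

variable {D d : ℕ} {M : Set (E D)}

/-- Every point at distance at most `r` from `M` has exactly one nearest point in `M`. -/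
def UniqueNearest (M : Set (E D)) (r : ℝ) : Prop :=
  ∀ z : E D, Metric.infDist z M ≤ r → ∃! y, y ∈ M ∧ Metric.infDist z M = ‖z - y‖

theorem uniqueNearest_of_lt_reach {τ r : ℝ} (h : ENNReal.ofReal τ ≤ reach M) (hr0 : 0 ≤ r)
    (hr : r < τ) : UniqueNearest M r := by
  have h1 : ENNReal.ofReal r < reach M :=
    ((ENNReal.ofReal_lt_ofReal_iff (hr0.trans_lt hr)).2 hr).trans_le h
  simp only [reach, lt_iSup_iff] at h1
  obtain ⟨r', hr', hlt⟩ := h1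
  intro z hz
  apply hr' z
  rw [ENNReal.ofReal_lt_coe_iff] at hlt
  · exact hz.trans hlt.le
  · exact hr0

/-- First variation: along a curve in M through y, the squared distance to z has a local minimum at
y. -/
theorem residual_mem_orthogonal {y z : E D}
    (hz : Metric.infDist z M = ‖z - y‖) : z - y ∈ (tangentSpace M y)ᗮ := by
  rw [Submodule.mem_orthogonal]
  intro v hv
  induction hv using Submodule.span_induction with
  | mem v hv =>
    obtain ⟨γ, hγ, hM, h0, rfl⟩ := hv
    have hd : HasDerivAt γ (deriv γ 0) 0 := (hγ.differentiable (by simp) 0).hasDerivAt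
    have h1 : HasDerivAt (fun t => ‖γ t - z‖ ^ 2) (2 * inner ℝ (γ 0 - z) (deriv γ 0)) 0 :=
      (hd.sub_const z).norm_sq
    have hmin : IsLocalMin (fun t => ‖γ t - z‖ ^ 2) 0 := by
      filter_upwards [hM] with t ht
      have h2 : Metric.infDist z M ≤ dist z (γ t) := Metric.infDist_le_dist_of_mem ht
      rw [hz, dist_eq_norm] at h2
      rw [h0, norm_sub_rev y z, norm_sub_rev (γ t) z]
      gcongr
    have h3 := hmin.hasDerivAt_eq_zero h1
    rw [h0] at h3
    rw [real_inner_comm, ← neg_sub y z, inner_neg_left]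
    linarith
  | zero => simp
  | add a b _ _ ha hb => rw [inner_add_left, ha, hb, add_zero]
  | smul c a _ ha => rw [real_inner_smul_left, ha, mul_zero]

/-- Expanding the square of s n - (q - p) removes the term s². The resulting condition on s is
linear for each q, hence closed, and it passes to smaller nonnegative radii. -/
theorem le_infDist_add_smul_iff {p : E D} (hp : p ∈ M) {n : E D} (hn : ‖n‖ = 1) {s : ℝ} (hs : 0 ≤ s) :
    s ≤ Metric.infDist (p + s • n) M ↔ ∀ q ∈ M, 2 * s * inner ℝ n (q - p) ≤ ‖q - p‖ ^ 2 := by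
  rw [Metric.le_infDist ⟨p, hp⟩]
  refine forall₂_congr fun q _ => ?_
  have h1 : p + s • n - q = s • n - (q - p) := by abel
  have h2 : ‖s • n - (q - p)‖ ^ 2 = s ^ 2 - 2 * s * inner ℝ n (q - p) + ‖q - p‖ ^ 2 := by
    rw [norm_sub_sq_real, norm_smul, hn, real_inner_smul_left, Real.norm_eq_abs, mul_one, sq_abs]
    ring
  rw [dist_eq_norm, h1, ← sq_le_sq₀ hs (norm_nonneg _), h2]
  constructor <;> intro h <;> linarith

theorem IsSmoothSubmanifold.exists_small_normal_ball (h : IsSmoothSubmanifold d M) {p n : E D}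
    (hp : p ∈ M) (hn : ‖n‖ = 1) (hnT : n ∈ (tangentSpace M p)ᗮ) :
    ∃ s > 0, ∀ q ∈ M, 2 * s * inner ℝ n (q - p) ≤ ‖q - p‖ ^ 2 := by
  obtain ⟨r, hr, C, hC, hloc⟩ := h.exists_local_quadratic hp
  -- The bound 1/(2C) serves points near p, where the normal component is at most C‖q - p‖²; the
  -- bound r/2 serves points at distance at least r, by Cauchy–Schwarz.
  refine ⟨min (1 / (2 * C)) (r / 2), by positivity, fun q hq => ?_⟩
  set s := min (1 / (2 * C)) (r / 2)
  have hs0 : 0 < s := by positivity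
  by_cases hqr : ‖q - p‖ < r
  · obtain ⟨v, hv, hvq⟩ := (hloc p hp (by simpa using hr)).1 q hq hqr
    have h1 : inner ℝ n (q - p) = inner ℝ n (q - p - v) := by
      rw [inner_sub_right n (q - p) v, (Submodule.mem_orthogonal' _ _).1 hnT v hv, sub_zero]
    have h2 : inner ℝ n (q - p - v) ≤ C * ‖q - p‖ ^ 2 := by
      refine (real_inner_le_norm _ _).trans ?_
      rw [hn, one_mul]; exact hvq
    have h3 : s ≤ 1 / (2 * C) := min_le_left _ _
    have h4 : 2 * s * C ≤ 1 := by
      rw [le_div_iff₀ (by positivity)] at h3; linarith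
    rw [h1]
    calc 2 * s * inner ℝ n (q - p - v) ≤ 2 * s * (C * ‖q - p‖ ^ 2) := by gcongr
      _ = (2 * s * C) * ‖q - p‖ ^ 2 := by ring
      _ ≤ 1 * ‖q - p‖ ^ 2 := by gcongr
      _ = _ := one_mul _
  · push Not at hqr
    have h2 : inner ℝ n (q - p) ≤ ‖q - p‖ := by
      refine (real_inner_le_norm _ _).trans ?_
      rw [hn, one_mul]
    have h3 : s ≤ r / 2 := min_le_right _ _
    calc 2 * s * inner ℝ n (q - p) ≤ 2 * s * ‖q - p‖ := by gcongr
      _ ≤ ‖q - p‖ ^ 2 := by rw [sq]; gcongr; linarith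

/-- Where the nearest point is unique, the distance to `M` grows at unit rate in the direction away
from it. -/
theorem exists_infDist_growth (hM : IsCompact M) {r : ℝ} (hr : UniqueNearest M r) {z : E D}
    (hne : M.Nonempty) (hz0 : 0 < Metric.infDist z M) (hzr : Metric.infDist z M ≤ r) {ε : ℝ}
    (hε : 0 < ε) (hε1 : ε < 1) {h₀ : ℝ} (hh₀ : 0 < h₀) :
    ∃ h, 0 < h ∧ h ≤ h₀ ∧ ∃ z', ‖z' - z‖ ≤ h ∧
      Metric.infDist z M + (1 - ε) * h ≤ Metric.infDist z' M := by
  obtain ⟨ξ, ⟨hξM, hξ⟩, huniq⟩ := hr z hzr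
  set δ := Metric.infDist z M
  -- Uniqueness of the foot ξ and compactness leave a gap: points of M at distance at least εδ from
  -- ξ have distance at least some m > δ from z. After a short step away from ξ the nearest point
  -- must thus still be εδ-close to ξ, so the step is almost radial for it as well.
  have hK : IsCompact (M ∩ {q | ε * δ ≤ ‖q - ξ‖}) :=
    hM.inter_right (isClosed_le continuous_const (by fun_prop))
  obtain ⟨m, hm, hmK⟩ : ∃ m, δ < m ∧ ∀ q ∈ M ∩ {q | ε * δ ≤ ‖q - ξ‖}, m ≤ ‖z - q‖ := by
    rcases (M ∩ {q | ε * δ ≤ ‖q - ξ‖}).eq_empty_or_nonempty with he | hne'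
    · exact ⟨δ + 1, by linarith, by simp [he]⟩
    · obtain ⟨q, hq, hqmin⟩ := hK.exists_isMinOn hne' (f := fun q => ‖z - q‖) (by fun_prop)
      refine ⟨‖z - q‖, ?_, fun q' hq' => hqmin hq'⟩
      have hle : δ ≤ ‖z - q‖ := by
        have := Metric.infDist_le_dist_of_mem (x := z) hq.1
        rwa [dist_eq_norm] at this
      refine lt_of_le_of_ne hle fun heq => ?_
      have hqξ : q = ξ := huniq q ⟨hq.1, heq⟩
      have h2 : ε * δ ≤ ‖q - ξ‖ := hq.2
      rw [hqξ, sub_self, norm_zero] at h2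
      have : 0 < ε * δ := by positivity
      linarith
  -- A point at distance at most δ + h from the moved centre is at distance at most δ + 2h < m from
  -- z.
  set h := min h₀ ((m - δ) / 4)
  have hh : 0 < h := by
    apply lt_min hh₀; linarith
  have hh2 : h ≤ (m - δ) / 4 := min_le_right _ _
  set ν : E D := δ⁻¹ • (z - ξ)
  have hν : ‖ν‖ = 1 := by
    rw [norm_smul, ← hξ, Real.norm_eq_abs, abs_inv, abs_of_pos hz0, inv_mul_cancel₀ hz0.ne']
  have hνξ : inner ℝ ν (z - ξ) = δ := by
    rw [real_inner_smul_left, real_inner_self_eq_norm_sq, ← hξ]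
    field_simp
  refine ⟨h, hh, min_le_left _ _, z + h • ν, ?_, ?_⟩
  · rw [add_sub_cancel_left, norm_smul, hν, Real.norm_eq_abs, abs_of_pos hh, mul_one]
  obtain ⟨η, hηM, hη⟩ := hM.exists_infDist_eq_dist hne (z + h • ν)
  rw [hη, dist_eq_norm]
  have hclose : ‖η - ξ‖ < ε * δ := by
    by_contra hcon
    push Not at hcon
    have h1 := hmK η ⟨hηM, hcon⟩
    have h2 : ‖z - η‖ ≤ ‖z + h • ν - η‖ + h := by
      calc ‖z - η‖ = ‖(z + h • ν - η) - h • ν‖ := by congr 1; abel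
        _ ≤ ‖z + h • ν - η‖ + ‖h • ν‖ := norm_sub_le _ _
        _ = _ := by rw [norm_smul, hν, Real.norm_eq_abs, abs_of_pos hh, mul_one]
    have h3 : ‖z + h • ν - η‖ ≤ δ + h := by
      rw [← dist_eq_norm, ← hη]
      refine (Metric.infDist_le_infDist_add_dist (y := z)).trans ?_
      rw [dist_eq_norm, add_sub_cancel_left, norm_smul, hν, Real.norm_eq_abs, abs_of_pos hh,
        mul_one]
    linarith
  have hδη : δ ≤ ‖z - η‖ := by
    have := Metric.infDist_le_dist_of_mem (x := z) hηM
    rwa [dist_eq_norm] at this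
  have hin : δ - ε * δ ≤ inner ℝ ν (z - η) := by
    have h1 : inner ℝ ν (z - η) = δ - inner ℝ ν (η - ξ) := by
      rw [← hνξ, ← inner_sub_right]; congr 1; abel
    have h2 : inner ℝ ν (η - ξ) ≤ ‖η - ξ‖ := by
      refine (real_inner_le_norm _ _).trans ?_
      rw [hν, one_mul]
    linarith
  have hsq : (δ + (1 - ε) * h) ^ 2 ≤ ‖z + h • ν - η‖ ^ 2 := by
    have h1 : z + h • ν - η = h • ν + (z - η) := by abel
    rw [h1, norm_add_sq_real, norm_smul, hν, real_inner_smul_left, Real.norm_eq_abs, mul_one,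
      sq_abs]
    have h2 : δ ^ 2 ≤ ‖z - η‖ ^ 2 := by gcongr
    have h3 : h * (δ - ε * δ) ≤ h * inner ℝ ν (z - η) := by gcongr
    have h4 : (1 - ε) ^ 2 * h ^ 2 ≤ 1 * h ^ 2 := by
      gcongr
      nlinarith
    nlinarith
  have hpos : 0 ≤ δ + (1 - ε) * h := by nlinarith
  exact (sq_le_sq₀ hpos (norm_nonneg _)).1 hsq

/-- Continuous induction on the travelled length t: the attainable t form a closed set, since the
pairs of a length and an endpoint range over a compact set, and the growth lemma extends any t < T
to the right. -/
theorem exists_infDist_ge_sub (hM : IsCompact M) {r : ℝ} (hr : UniqueNearest M r) {z : E D}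
    (hne : M.Nonempty) (hz0 : 0 < Metric.infDist z M) {T : ℝ} (hT : 0 ≤ T)
    (hzT : Metric.infDist z M + T ≤ r) {ε : ℝ} (hε : 0 < ε) (hε1 : ε < 1) :
    ∃ z', ‖z' - z‖ ≤ T ∧ Metric.infDist z M + (1 - ε) * T ≤ Metric.infDist z' M := by
  set δ := Metric.infDist z M
  let A : Set ℝ := {t | ∃ z', ‖z' - z‖ ≤ t ∧ δ + (1 - ε) * t ≤ Metric.infDist z' M}
  have hclosed : IsClosed (A ∩ Icc 0 T) := by
    have hcomp : IsCompact ((Icc 0 T ×ˢ Metric.closedBall z T) ∩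
        {x : ℝ × E D | ‖x.2 - z‖ ≤ x.1 ∧ δ + (1 - ε) * x.1 ≤ Metric.infDist x.2 M}) := by
      refine (isCompact_Icc.prod (isCompact_closedBall z T)).inter_right ?_
      have hc := Metric.continuous_infDist_pt M
      have h1 : IsClosed {x : ℝ × E D | ‖x.2 - z‖ ≤ x.1} := isClosed_le (by fun_prop) (by fun_prop)
      have h2 : IsClosed {x : ℝ × E D | δ + (1 - ε) * x.1 ≤ Metric.infDist x.2 M} :=
        isClosed_le (by fun_prop) (hc.comp continuous_snd)
      exact h1.inter h2
    have := (hcomp.image continuous_fst).isClosed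
    convert this using 1
    ext t
    constructor
    · rintro ⟨⟨z', h1, h2⟩, ht⟩
      exact ⟨(t, z'), ⟨⟨ht, mem_closedBall_iff_norm.2 (h1.trans ht.2)⟩, h1, h2⟩, rfl⟩
    · rintro ⟨⟨t', z'⟩, ⟨⟨ht, _⟩, h1, h2⟩, rfl⟩
      exact ⟨⟨z', h1, h2⟩, ht⟩
  have hsub := hclosed.Icc_subset_of_forall_exists_gt (⟨z, by simp, by simp [δ]⟩ : (0 : ℝ) ∈ A) ?_
  · exact hsub (right_mem_Icc.2 hT)
  · rintro t ⟨⟨z', h1, h2⟩, ht⟩ y hy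
    have hle : Metric.infDist z' M ≤ δ + t := by
      refine (Metric.infDist_le_infDist_add_dist (y := z)).trans ?_
      rw [dist_eq_norm]; linarith
    have hpos : 0 < Metric.infDist z' M := by nlinarith [ht.1]
    have hy : t < y := hy
    obtain ⟨h, hh0, hhy, w, hw1, hw2⟩ := exists_infDist_growth hM hr hne hpos
      (by linarith [ht.2]) hε hε1 (h₀ := y - t) (by linarith)
    refine ⟨t + h, ⟨w, ?_, ?_⟩, by linarith, by linarith⟩
    · calc ‖w - z‖ = ‖(w - z') + (z' - z)‖ := by congr 1; abel
        _ ≤ _ := norm_add_le _ _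
        _ ≤ t + h := by linarith
    · nlinarith

/-- A point of the closed ball of radius T about z that maximizes the distance to M serves for every
ε at once, so the loss ε T can be sent to 0. -/
theorem exists_infDist_ge (hM : IsCompact M) {r : ℝ} (hr : UniqueNearest M r) {z : E D}
    (hne : M.Nonempty) (hz0 : 0 < Metric.infDist z M) {T : ℝ} (hT : 0 ≤ T)
    (hzT : Metric.infDist z M + T ≤ r) :
    ∃ z', ‖z' - z‖ ≤ T ∧ Metric.infDist z M + T ≤ Metric.infDist z' M := by
  obtain ⟨w, hw, hmax⟩ := (isCompact_closedBall z T).exists_isMaxOn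
    ⟨z, Metric.mem_closedBall_self hT⟩ (Metric.continuous_infDist_pt M).continuousOn
  refine ⟨w, mem_closedBall_iff_norm.1 hw, ?_⟩
  have key : ∀ ε : ℝ, 0 < ε → ε < 1 →
      Metric.infDist z M + T ≤ Metric.infDist w M + ε * T := by
    intro ε hε hε1
    obtain ⟨z', h1, h2⟩ := exists_infDist_ge_sub hM hr hne hz0 hT hzT hε hε1
    have h3 : Metric.infDist z' M ≤ Metric.infDist w M := hmax (mem_closedBall_iff_norm.2 h1)
    linarith
  refine le_of_forall_pos_le_add fun η hη => ?_
  have hmin : 0 < min (1 / 2) (η / (T + 1)) := by positivity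
  refine (key _ hmin (lt_of_le_of_lt (min_le_left _ _) (by norm_num))).trans ?_
  have h4 : min (1 / 2) (η / (T + 1)) * T ≤ η / (T + 1) * (T + 1) := by
    apply mul_le_mul (min_le_right _ _) (by linarith) hT (by positivity)
  rw [div_mul_cancel₀ _ (by positivity)] at h4
  linarith

/-- Balls of radius less than the reach that touch a submanifold from a normal direction do not
meet it in their interior. -/
theorem IsSmoothSubmanifold.inner_normal_le_of_uniqueNearest (h : IsSmoothSubmanifold d M)
    (hM : IsCompact M) {r : ℝ} (hr0 : 0 ≤ r) (hr : UniqueNearest M r) {p n : E D} (hp : p ∈ M)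
    (hn : ‖n‖ = 1)     (hnT : n ∈ (tangentSpace M p)ᗮ) {q : E D} (hq : q ∈ M) :
    2 * r * inner ℝ n (q - p) ≤ ‖q - p‖ ^ 2 := by
  have hne : M.Nonempty := ⟨p, hp⟩
  let A : Set ℝ := {s | ∀ q ∈ M, 2 * s * inner ℝ n (q - p) ≤ ‖q - p‖ ^ 2}
  have hmono : ∀ s s', s ∈ A → s' ≤ s → 0 ≤ s' → s' ∈ A := by
    intro s s' hs hss hs' q hq
    rcases le_total (inner ℝ n (q - p)) 0 with h0 | h0
    · have : 2 * s' * inner ℝ n (q - p) ≤ 0 := mul_nonpos_of_nonneg_of_nonpos (by linarith) h0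
      nlinarith [sq_nonneg ‖q - p‖]
    · refine le_trans ?_ (hs q hq)
      gcongr
  obtain ⟨s₀, hs₀, hs₀A⟩ := h.exists_small_normal_ball hp hn hnT
  suffices hrA : r ∈ A from hrA q hq
  rcases le_total r s₀ with hle | hle
  · exact hmono s₀ r hs₀A hle hr0
  · have hclosed : IsClosed (A ∩ Icc s₀ r) := by
      refine IsClosed.inter ?_ isClosed_Icc
      have : A = ⋂ q ∈ M, {s | 2 * s * inner ℝ n (q - p) ≤ ‖q - p‖ ^ 2} := by ext; simp [A]
      rw [this]
      exact isClosed_biInter fun q _ => isClosed_le (by fun_prop) continuous_const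
    refine hclosed.Icc_subset_of_forall_exists_gt hs₀A ?_ (right_mem_Icc.2 hle)
    rintro s ⟨hsA, hs1, hs2⟩ y hy
    have hy : s < y := hy
    have hs0 : 0 < s := hs₀.trans_le hs1
    have hdist : Metric.infDist (p + s • n) M = s := by
      apply le_antisymm
      · refine (Metric.infDist_le_dist_of_mem hp).trans (le_of_eq ?_)
        rw [dist_eq_norm, add_sub_cancel_left, norm_smul, hn, Real.norm_eq_abs, abs_of_pos hs0,
          mul_one]
      · exact (le_infDist_add_smul_iff hp hn hs0.le).2 hsA
    set t := min y r - s
    have ht : 0 < t := by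
      have : s < min y r := lt_min hy hs2
      simp only [t]; linarith
    have htr : s + t ≤ r := by
      have := min_le_right y r
      simp only [t]; linarith
    obtain ⟨w, hw1, hw2⟩ := exists_infDist_ge hM hr hne (by rw [hdist]; exact hs0) ht.le
      (by rw [hdist]; exact htr)
    rw [hdist] at hw2
    -- The displacement a has length at most t, yet it takes the point p + s n, which has distance s
    -- from p, to distance at least s + t. This is equality in the triangle inequality, so a = t n:
    -- the growth happens along the normal itself, and the radius s extends to s + t.
    set a := w - (p + s • n)
    have hwp : s + t ≤ ‖a + s • n‖ := by
      have h1 := Metric.infDist_le_dist_of_mem (x := w) hp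
      rw [dist_eq_norm] at h1
      have h2 : w - p = a + s • n := by simp only [a]; abel
      rw [← h2]; linarith
    have hsq : (s + t) ^ 2 ≤ ‖a‖ ^ 2 + 2 * s * inner ℝ a n + s ^ 2 := by
      have h1 : (s + t) ^ 2 ≤ ‖a + s • n‖ ^ 2 := by gcongr
      rw [norm_add_sq_real, norm_smul, hn, real_inner_smul_right, Real.norm_eq_abs, mul_one,
        sq_abs] at h1
      linarith
    have ha2 : ‖a‖ ^ 2 ≤ t ^ 2 := by gcongr
    have hin : t ≤ inner ℝ a n := by
      have : 2 * s * t ≤ 2 * s * inner ℝ a n := by nlinarith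
      exact le_of_mul_le_mul_left this (by positivity)
    have hatn : a = t • n := by
      rw [← sub_eq_zero, ← norm_eq_zero, ← sq_eq_zero_iff]
      apply le_antisymm _ (sq_nonneg _)
      rw [norm_sub_sq_real, norm_smul, hn, real_inner_smul_right, Real.norm_eq_abs, mul_one,
        sq_abs]
      nlinarith
    have hw : w = p + (s + t) • n := by
      have : w = a + (p + s • n) := by simp only [a]; abel
      rw [this, hatn, add_smul]; abel
    refine ⟨s + t, ?_, by linarith, ?_⟩
    · refine (le_infDist_add_smul_iff hp hn (by linarith)).1 ?_
      rw [← hw]; exact hw2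
    · have := min_le_left y r
      simp only [t]; linarith

end ManifoldModel

end

/-! ### Tangent projections: quadratic flatness and the Lipschitz bound. -/

noncomputable section

namespace ManifoldModel

variable {D d : ℕ} {M : Set (E D)}

/-- The orthogonal projection of `ℝ^D` onto the tangent space at `p`. -/
def tproj (M : Set (E D)) (p : E D) : E D →L[ℝ] E D := (tangentSpace M p).starProjection

theorem tproj_mem (p w : E D) : tproj M p w ∈ tangentSpace M p :=
  Submodule.starProjection_apply_mem _ _

theorem tproj_of_mem {p v : E D} (hv : v ∈ tangentSpace M p) : tproj M p v = v :=
  Submodule.starProjection_eq_self_iff.2 hv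

theorem tproj_of_mem_orthogonal {p v : E D} (hv : v ∈ (tangentSpace M p)ᗮ) : tproj M p v = 0 :=
  (Submodule.starProjection_apply_eq_zero_iff _).2 hv

theorem tproj_tproj (p w : E D) : tproj M p (tproj M p w) = tproj M p w :=
  tproj_of_mem (tproj_mem p w)

theorem sub_tproj_mem (p w : E D) : w - tproj M p w ∈ (tangentSpace M p)ᗮ :=
  Submodule.sub_starProjection_mem_orthogonal _

theorem norm_tproj_le (p w : E D) : ‖tproj M p w‖ ≤ ‖w‖ :=
  Submodule.norm_starProjection_apply_le _ _

theorem norm_sq_tproj_add (p w : E D) : ‖tproj M p w‖ ^ 2 + ‖w - tproj M p w‖ ^ 2 = ‖w‖ ^ 2 := by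
  have h1 : inner ℝ (tproj M p w) (w - tproj M p w) = 0 :=
    (Submodule.mem_orthogonal _ _).1 (sub_tproj_mem p w) _ (tproj_mem p w)
  have h2 := norm_add_sq_real (tproj M p w) (w - tproj M p w)
  rw [add_sub_cancel, h1] at h2
  linarith

theorem norm_sub_tproj_le (p w : E D) : ‖w - tproj M p w‖ ≤ ‖w‖ := by
  have := norm_sq_tproj_add (M := M) p w
  exact (sq_le_sq₀ (norm_nonneg _) (norm_nonneg _)).1 (by nlinarith [sq_nonneg ‖tproj M p w‖])

theorem inner_tproj (p v w : E D) : inner ℝ (tproj M p v) w = inner ℝ v (tproj M p w) :=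
  Submodule.inner_starProjection_left_eq_right _ _ _

/-- `M` deviates from each of its tangent spaces at most quadratically, with constant `κ`. -/
def QuadraticallyFlat (M : Set (E D)) (κ : ℝ) : Prop :=
  ∀ p ∈ M, ∀ q ∈ M, ‖(q - p) - tproj M p (q - p)‖ ≤ κ * ‖q - p‖ ^ 2

theorem IsSmoothSubmanifold.quadraticallyFlat (h : IsSmoothSubmanifold d M) (hM : IsCompact M)
    {τ : ℝ} (hτ : 0 < τ) (hr : ENNReal.ofReal τ ≤ reach M) : QuadraticallyFlat M (1 / τ) := by
  intro p hp q hq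
  set w := (q - p) - tproj M p (q - p)
  rcases eq_or_ne w 0 with hw | hw
  · rw [hw, norm_zero]; positivity
  have hw0 : 0 < ‖w‖ := norm_pos_iff.2 hw
  have hwT : w ∈ (tangentSpace M p)ᗮ := sub_tproj_mem p _
  have hn : ‖(‖w‖⁻¹ • w)‖ = 1 := by rw [norm_smul, norm_inv, norm_norm, inv_mul_cancel₀ hw0.ne']
  -- Unique nearest points are available only strictly below the reach; τ/2 costs a factor 2 in the
  -- constant. The normal direction tested is that of the normal component w of q - p itself.
  have h1 := h.inner_normal_le_of_uniqueNearest hM (r := τ / 2) (by positivity)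
    (uniqueNearest_of_lt_reach hr (by positivity) (by linarith)) hp hn
    (Submodule.smul_mem _ _ hwT) hq
  have h2 : inner ℝ w (q - p) = ‖w‖ ^ 2 := by
    have h3 : inner ℝ w (tproj M p (q - p)) = 0 :=
      (Submodule.mem_orthogonal' _ _).1 hwT _ (tproj_mem p _)
    rw [← real_inner_self_eq_norm_sq, ← sub_eq_zero, ← inner_sub_right]
    simp only [w] at h3 ⊢
    rw [sub_sub_cancel]; exact h3
  rw [real_inner_smul_left, h2] at h1
  have h4 : 2 * (τ / 2) * (‖w‖⁻¹ * ‖w‖ ^ 2) = τ * ‖w‖ := by field_simp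
  rw [h4] at h1
  rw [one_div, inv_mul_eq_div, le_div_iff₀ hτ]
  linarith

theorem QuadraticallyFlat.abs_inner_le {κ : ℝ} (h : QuadraticallyFlat M κ) {p q n : E D}
    (hp : p ∈ M) (hq : q ∈ M) (hn : n ∈ (tangentSpace M p)ᗮ) :
    |inner ℝ n (q - p)| ≤ κ * ‖n‖ * ‖q - p‖ ^ 2 := by
  have h1 : inner ℝ n (q - p) = inner ℝ n ((q - p) - tproj M p (q - p)) := by
    rw [inner_sub_right n (q - p), (Submodule.mem_orthogonal' _ _).1 hn _ (tproj_mem p _), sub_zero]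
  rw [h1]
  refine (abs_real_inner_le_norm _ _).trans ?_
  have := h p hp q hq
  calc _ ≤ ‖n‖ * (κ * ‖q - p‖ ^ 2) := by gcongr
    _ = _ := by ring

/-- The difference of two tangent projections is controlled by the two mutual deviations. -/
theorem norm_tproj_sub_le {p q : E D} {a : ℝ} (ha : 0 ≤ a)
    (h1 : ∀ w, ‖tproj M q w - tproj M p (tproj M q w)‖ ≤ a * ‖w‖)
    (h2 : ∀ w, ‖tproj M p w - tproj M q (tproj M p w)‖ ≤ a * ‖w‖) :
    ‖tproj M p - tproj M q‖ ≤ 2 * a := by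
  refine ContinuousLinearMap.opNorm_le_bound _ (by positivity) fun w => ?_
  -- With P, Q the projections at p and q, (P - Q)w = P(w - Qw) - (Qw - PQw). The first term z is
  -- bounded by duality: as w - Qw is normal at q, ‖z‖² = ⟨z - Qz, w - Qw⟩, and z is tangent at p.
  set z := tproj M p (w - tproj M q w)
  have hz : ‖z‖ ≤ a * ‖w‖ := by
    rcases eq_or_ne z 0 with h0 | h0
    · rw [h0, norm_zero]; positivity
    have hz0 : 0 < ‖z‖ := norm_pos_iff.2 h0
    have hpz : tproj M p z = z := tproj_tproj p _
    have h3 : ‖z‖ ^ 2 = inner ℝ (z - tproj M q z) (w - tproj M q w) := by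
      have e1 : inner ℝ z (w - tproj M q w) = ‖z‖ ^ 2 := by
        conv_lhs => rw [← hpz]
        rw [inner_tproj, real_inner_self_eq_norm_sq]
      have e2 : inner ℝ (tproj M q z) (w - tproj M q w) = 0 :=
        (Submodule.mem_orthogonal _ _).1 (sub_tproj_mem q w) _ (tproj_mem q z)
      rw [inner_sub_left, e1, e2, sub_zero]
    have h4 := h2 z
    rw [hpz] at h4
    have h5 : ‖z‖ ^ 2 ≤ a * ‖z‖ * ‖w‖ := by
      rw [h3]
      refine (real_inner_le_norm _ _).trans ?_
      gcongr
      exact norm_sub_tproj_le q w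
    have h6 : ‖z‖ * ‖z‖ ≤ (a * ‖w‖) * ‖z‖ := by nlinarith
    exact le_of_mul_le_mul_right h6 hz0
  have heq : (tproj M p - tproj M q) w = z - (tproj M q w - tproj M p (tproj M q w)) := by
    simp only [z, map_sub, sub_apply]; abel
  rw [heq]
  refine (norm_sub_le _ _).trans ?_
  linarith [h1 w]

/-- A tangent vector at q of length t = ‖p - q‖ is, up to an error of order t², a chord q' - q of M,
and flatness at p of q' - p and q - p makes that chord almost tangent at p. The local constant C has
no uniform bound, so it may influence only the radius and not the Lipschitz constant. -/
theorem QuadraticallyFlat.exists_local_lipschitz {κ : ℝ} (hκ : 0 ≤ κ) (hf : QuadraticallyFlat M κ)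
    (h : IsSmoothSubmanifold d M) {p₀ : E D} (hp₀ : p₀ ∈ M) :
    ∃ r > 0, ∀ p ∈ M, ∀ q ∈ M, ‖p - p₀‖ < r → ‖q - p₀‖ < r →
      ‖tproj M p - tproj M q‖ ≤ 56 * κ * ‖p - q‖ := by
  obtain ⟨r, hr, C, hC, hloc⟩ := h.exists_local_quadratic hp₀
  have key : ∀ p ∈ M, ∀ q ∈ M, ‖p - p₀‖ < min (r / 2) (1 / (4 * C)) →
      ‖q - p₀‖ < min (r / 2) (1 / (4 * C)) →
      ∀ w, ‖tproj M q w - tproj M p (tproj M q w)‖ ≤ 28 * κ * ‖p - q‖ * ‖w‖ := by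
    intro p hp q hq hpr hqr
    rcases eq_or_ne p q with rfl | hne
    · intro w; simp [tproj_tproj]
    set t := ‖p - q‖
    have ht0 : 0 < t := norm_pos_iff.2 (sub_ne_zero.2 hne)
    have ht : t < 2 * min (r / 2) (1 / (4 * C)) := by
      calc t = ‖(p - p₀) - (q - p₀)‖ := by simp only [t]; congr 1; abel
        _ ≤ _ := norm_sub_le _ _
        _ < _ := by linarith
    have htr : t < r := by linarith [min_le_left (r / 2) (1 / (4 * C))]
    have htC : C * t ≤ 1 / 2 := by
      have h1 : t < 1 / (2 * C) := by
        have := min_le_right (r / 2) (1 / (4 * C))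
        have h2 : 2 * (1 / (4 * C)) = 1 / (2 * C) := by field_simp; norm_num
        linarith
      rw [lt_div_iff₀ (by positivity)] at h1
      linarith
    let L : E D →L[ℝ] E D := (ContinuousLinearMap.id ℝ (E D) - tproj M p).comp (tproj M q)
    have hL : ∀ w, L w = tproj M q w - tproj M p (tproj M q w) := fun w => rfl
    have hvec : ∀ v ∈ tangentSpace M q, ‖v‖ = t →
        ‖v - tproj M p v‖ ≤ (14 * κ + ‖L‖ * C) * t ^ 2 := by
      intro v hv hvt
      obtain ⟨q', hq', he⟩ := (hloc q hq (by linarith [min_le_left (r / 2) (1 / (4 * C))])).2 v hv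
        (by rw [hvt]; exact htr)
      set e := q' - q - v
      rw [hvt] at he
      have he' : ‖e‖ ≤ t := by
        refine he.trans ?_
        nlinarith
      have hqq' : ‖q' - q‖ ≤ 2 * t := by
        calc ‖q' - q‖ = ‖e + v‖ := by simp only [e]; congr 1; abel
          _ ≤ _ := norm_add_le _ _
          _ ≤ 2 * t := by linarith
      have hpq' : ‖q' - p‖ ≤ 3 * t := by
        calc ‖q' - p‖ = ‖(q' - q) - (p - q)‖ := by congr 1; abel
          _ ≤ ‖q' - q‖ + ‖p - q‖ := norm_sub_le _ _
          _ ≤ 3 * t := by simp only [t] at hqq' ⊢; linarith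
      have hpq : ‖q - p‖ = t := norm_sub_rev _ _
      have e1 : e - tproj M q e = (q' - q) - tproj M q (q' - q) := by
        simp only [e]
        rw [map_sub (tproj M q) (q' - q) v, tproj_of_mem hv]; abel
      have b1 : ‖e - tproj M q e‖ ≤ 4 * κ * t ^ 2 := by
        rw [e1]
        refine (hf q hq q' hq').trans ?_
        calc κ * ‖q' - q‖ ^ 2 ≤ κ * (2 * t) ^ 2 := by gcongr
          _ = _ := by ring
      have b2 : ‖L e‖ ≤ ‖L‖ * C * t ^ 2 := by
        refine (L.le_opNorm e).trans ?_
        calc ‖L‖ * ‖e‖ ≤ ‖L‖ * (C * t ^ 2) := by gcongr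
          _ = _ := by ring
      have b3 : ‖(q' - p) - tproj M p (q' - p)‖ ≤ 9 * κ * t ^ 2 := by
        refine (hf p hp q' hq').trans ?_
        calc κ * ‖q' - p‖ ^ 2 ≤ κ * (3 * t) ^ 2 := by gcongr
          _ = _ := by ring
      have b4 : ‖(q - p) - tproj M p (q - p)‖ ≤ κ * t ^ 2 := by
        refine (hf p hp q hq).trans ?_
        rw [hpq]
      have b5 : ‖(e - tproj M q e) - tproj M p (e - tproj M q e)‖ ≤ 4 * κ * t ^ 2 :=
        (norm_sub_tproj_le _ _).trans b1
      -- The chord error e is split at q. Its tangential part is seen by L, with a bound ‖L‖ C t²;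
      -- its normal part is the flatness residual of q' - q, free of C. The other terms give 14 = 9
      -- + 1 + 4.
      have hdec : v - tproj M p v = ((q' - p) - tproj M p (q' - p)) -
          ((q - p) - tproj M p (q - p)) - L e -
            ((e - tproj M q e) - tproj M p (e - tproj M q e)) := by
        have hv' : v = (q' - p) - (q - p) - e := by simp only [e]; abel
        have hv'' : tproj M p v = tproj M p (q' - p) - tproj M p (q - p) - tproj M p e := by
          conv_lhs => rw [hv']
          rw [map_sub, map_sub]
        rw [hL, hv'', map_sub (tproj M p) e]
        conv_lhs => rw [hv']
        abel
      rw [hdec]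
      refine (norm_sub_le _ _).trans ?_
      refine (add_le_add_left (norm_sub_le _ _) _).trans ?_
      refine (add_le_add_left (add_le_add_left (norm_sub_le _ _) _) _).trans ?_
      linarith
    have hLw : ∀ w, ‖L w‖ ≤ (14 * κ + ‖L‖ * C) * t * ‖w‖ := by
      intro w
      have hnn : 0 ≤ (14 * κ + ‖L‖ * C) * t := by positivity
      rcases eq_or_ne (tproj M q w) 0 with h0 | h0
      · rw [hL, h0, map_zero, sub_zero, norm_zero]; positivity
      set u := tproj M q w
      have hu0 : 0 < ‖u‖ := norm_pos_iff.2 h0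
      have h1 := hvec ((t / ‖u‖) • u) (Submodule.smul_mem _ _ (tproj_mem q w)) (by
        rw [norm_smul, Real.norm_eq_abs, abs_of_pos (by positivity), div_mul_cancel₀ _ hu0.ne'])
      rw [map_smul, ← smul_sub, norm_smul, Real.norm_eq_abs, abs_of_pos (by positivity),
        div_mul_eq_mul_div, div_le_iff₀ hu0] at h1
      rw [hL]
      have h2 : ‖u - tproj M p u‖ ≤ (14 * κ + ‖L‖ * C) * t * ‖u‖ := by
        refine le_of_mul_le_mul_left ?_ ht0
        calc _ ≤ _ := h1
          _ = _ := by ring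
      refine h2.trans ?_
      gcongr
      exact norm_tproj_le q w
    have hLn : ‖L‖ ≤ (14 * κ + ‖L‖ * C) * t :=
      L.opNorm_le_bound (by positivity) hLw
    -- Since C t ≤ 1/2, the term with ‖L‖ on the right is absorbed at the price of doubling 14.
    have hLn2 : ‖L‖ ≤ 28 * κ * t := by nlinarith [norm_nonneg L]
    intro w
    rw [← hL]
    exact L.le_of_opNorm_le hLn2 w
  refine ⟨min (r / 2) (1 / (4 * C)), by positivity, fun p hp q hq hpr hqr => ?_⟩
  have h1 := key p hp q hq hpr hqr
  have h2 := key q hq p hp hqr hpr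
  rw [norm_sub_rev q p] at h2
  refine (norm_tproj_sub_le (by positivity) h1 h2).trans (le_of_eq (by ring))

/-- The residuals are normal at their feet, so flatness bounds each of their products with y₁ - y₂
by ‖y₁ - y₂‖²/4 in absolute value. Hence ⟨z₁ - z₂, y₁ - y₂⟩ is at least half of ‖y₁ - y₂‖². -/
theorem QuadraticallyFlat.nearest_lipschitz {κ s : ℝ} (hκ : 0 ≤ κ) (hf : QuadraticallyFlat M κ)
    (hs : κ * s ≤ 1 / 4) {z₁ z₂ y₁ y₂ : E D} (hy₁ : y₁ ∈ M) (hy₂ : y₂ ∈ M)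
    (h₁ : Metric.infDist z₁ M = ‖z₁ - y₁‖) (h₂ : Metric.infDist z₂ M = ‖z₂ - y₂‖)
    (hs₁ : ‖z₁ - y₁‖ ≤ s) (hs₂ : ‖z₂ - y₂‖ ≤ s) : ‖y₁ - y₂‖ ≤ 2 * ‖z₁ - z₂‖ := by
  rcases eq_or_ne y₁ y₂ with rfl | hne
  · simp
  have h0 : 0 < ‖y₁ - y₂‖ := norm_pos_iff.2 (sub_ne_zero.2 hne)
  have a1 := hf.abs_inner_le hy₁ hy₂ (residual_mem_orthogonal h₁)
  have a2 := hf.abs_inner_le hy₂ hy₁ (residual_mem_orthogonal h₂)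
  rw [norm_sub_rev y₂ y₁] at a1
  have b1 : κ * ‖z₁ - y₁‖ ≤ 1 / 4 := (mul_le_mul_of_nonneg_left hs₁ hκ).trans hs
  have b2 : κ * ‖z₂ - y₂‖ ≤ 1 / 4 := (mul_le_mul_of_nonneg_left hs₂ hκ).trans hs
  have c1 : inner ℝ (z₁ - y₁) (y₂ - y₁) ≤ 1 / 4 * ‖y₁ - y₂‖ ^ 2 :=
    (le_abs_self _).trans (a1.trans (by gcongr))
  have c2 : inner ℝ (z₂ - y₂) (y₁ - y₂) ≤ 1 / 4 * ‖y₁ - y₂‖ ^ 2 :=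
    (le_abs_self _).trans (a2.trans (by gcongr))
  have e1 : inner ℝ (z₁ - z₂) (y₁ - y₂) = ‖y₁ - y₂‖ ^ 2 - inner ℝ (z₁ - y₁) (y₂ - y₁) -
      inner ℝ (z₂ - y₂) (y₁ - y₂) := by
    rw [← neg_sub y₁ y₂, inner_neg_right, ← real_inner_self_eq_norm_sq, sub_neg_eq_add,
      ← inner_add_left, ← inner_sub_left]
    congr 1; abel
  have e2 := real_inner_le_norm (z₁ - z₂) (y₁ - y₂)
  have : ‖y₁ - y₂‖ * ‖y₁ - y₂‖ ≤ (2 * ‖z₁ - z₂‖) * ‖y₁ - y₂‖ := by nlinarith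
  exact le_of_mul_le_mul_right this h0

/-- The tangent spaces of a quadratically flat compact submanifold vary in a Lipschitz way. -/
theorem QuadraticallyFlat.tproj_lipschitz {κ : ℝ} (hκ : 0 ≤ κ) (hf : QuadraticallyFlat M κ)
    (h : IsSmoothSubmanifold d M) (hM : IsCompact M) {p q : E D} (hp : p ∈ M) (hq : q ∈ M) :
    ‖tproj M p - tproj M q‖ ≤ 112 * κ * ‖p - q‖ := by
  rcases le_or_gt (κ * ‖p - q‖) (1 / 4) with hs | hs
  · have hne : M.Nonempty := ⟨p, hp⟩
    -- The nearest points to the chord form a path in M from q to p of speed at most 2‖p - q‖. The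
    -- local constant 56κ along this path integrates to 112κ.
    let z : ℝ → E D := fun s => q + s • (p - q)
    choose c hcM hc using fun s => hM.exists_infDist_eq_dist hne (z s)
    simp only [dist_eq_norm] at hc
    have hnear : ∀ s ∈ Icc (0 : ℝ) 1, ‖z s - c s‖ ≤ ‖p - q‖ := by
      intro s hs
      rw [← hc]
      refine (Metric.infDist_le_dist_of_mem hq).trans ?_
      simp only [z]
      rw [dist_eq_norm, add_sub_cancel_left, norm_smul, Real.norm_eq_abs, abs_of_nonneg hs.1]
      exact mul_le_of_le_one_left (norm_nonneg _) hs.2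
    have hlip : ∀ s ∈ Icc (0 : ℝ) 1, ∀ s' ∈ Icc (0 : ℝ) 1,
        ‖c s - c s'‖ ≤ 2 * ‖p - q‖ * |s - s'| := by
      intro s hs1 s' hs2
      refine (hf.nearest_lipschitz hκ hs (hcM s) (hcM s') (hc s) (hc s') (hnear s hs1)
        (hnear s' hs2)).trans (le_of_eq ?_)
      have : z s - z s' = (s - s') • (p - q) := by simp only [z, sub_smul]; abel
      rw [this, norm_smul, Real.norm_eq_abs]; ring
    have hfix : ∀ s, z s ∈ M → c s = z s := by
      intro s hzs
      have := hc s
      rw [Metric.infDist_zero_of_mem hzs] at this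
      exact (sub_eq_zero.1 (norm_eq_zero.1 this.symm)).symm
    have h0 : c 0 = q := by
      have : z 0 = q := by simp [z]
      rw [hfix 0 (by rwa [this]), this]
    have h1 : c 1 = p := by
      have : z 1 = p := by simp [z]
      rw [hfix 1 (by rwa [this]), this]
    have hlocal : ∀ s ∈ Icc (0 : ℝ) 1, ∀ᶠ s' in 𝓝[Icc 0 1] s,
        ‖tproj M (c s') - tproj M (c s)‖ ≤ 112 * κ * ‖p - q‖ * |s' - s| := by
      intro s hs1
      obtain ⟨r, hr, hloc⟩ := hf.exists_local_lipschitz hκ h (hcM s)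
      have hev : ∀ᶠ s' in 𝓝 s, 2 * ‖p - q‖ * |s' - s| < r := by
        have hcont : Continuous fun s' : ℝ => 2 * ‖p - q‖ * |s' - s| := by fun_prop
        have := hcont.tendsto s
        simp only [sub_self, abs_zero, mul_zero] at this
        exact this.eventually (gt_mem_nhds hr)
      filter_upwards [self_mem_nhdsWithin, mem_nhdsWithin_of_mem_nhds hev] with s' hs2 hs3
      have h4 := hlip s' hs2 s hs1
      refine (hloc _ (hcM s') _ (hcM s) (h4.trans_lt hs3) (by simpa using hr)).trans ?_
      calc 56 * κ * ‖c s' - c s‖ ≤ 56 * κ * (2 * ‖p - q‖ * |s' - s|) := by gcongr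
        _ = _ := by ring
    have := norm_sub_le_of_local_bound (f := fun s => tproj M (c s)) (B := 112 * κ * ‖p - q‖)
      zero_le_one ?_ ?_
    · simpa [h0, h1] using this
    · intro s hs1
      have hcont : Continuous fun s' : ℝ => 112 * κ * ‖p - q‖ * |s' - s| := by fun_prop
      have ht := (hcont.tendsto s).mono_left (nhdsWithin_le_nhds (s := Icc 0 1))
      simp only [sub_self, abs_zero, mul_zero] at ht
      rw [ContinuousWithinAt, tendsto_iff_norm_sub_tendsto_zero]
      exact squeeze_zero' (Filter.Eventually.of_forall fun _ => norm_nonneg _) (hlocal s hs1) ht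
    · intro s hs1 B' hB'
      have hmem : Icc (0 : ℝ) 1 ∈ 𝓝[>] s :=
        Filter.mem_of_superset (Ioo_mem_nhdsGT hs1.2)
          fun x hx => ⟨hs1.1.trans hx.1.le, hx.2.le⟩
      have hle : 𝓝[>] s ≤ 𝓝[Icc 0 1] s := le_inf nhdsWithin_le_nhds (Filter.le_principal_iff.2 hmem)
      filter_upwards [hle (hlocal s ⟨hs1.1, hs1.2.le⟩), self_mem_nhdsWithin] with s' hs2 hs3
      have hs3 : s < s' := hs3
      refine hs2.trans ?_
      rw [abs_of_pos (by linarith)]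
      exact mul_le_mul_of_nonneg_right (le_of_lt hB') (by linarith)
  -- For distant points the trivial bound 2 is enough, as 112κ‖p - q‖ > 28.
  · have h1 : ‖tproj M p - tproj M q‖ ≤ 1 + 1 := by
      refine (norm_sub_le _ _).trans (add_le_add ?_ ?_) <;>
      exact ContinuousLinearMap.opNorm_le_bound _ zero_le_one fun w => by
        rw [one_mul]; exact norm_tproj_le _ w
    nlinarith

/-- Compact smooth submanifolds with second order geometry controlled by `K`. -/
structure IsRegular (d : ℕ) (K : ℝ) (M : Set (E D)) : Prop where
  le : d ≤ D
  pos : 0 < K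
  smooth : IsSmoothSubmanifold d M
  compact : IsCompact M
  flat : QuadraticallyFlat M K
  lip : ∀ p ∈ M, ∀ q ∈ M, ‖tproj M p - tproj M q‖ ≤ K * ‖p - q‖

/-- From here on M enters the quantitative bounds only through K = 112/τ, which makes them uniform
over the model. -/
theorem IsAdmissible.isRegular {x : E D} {α τ L : ℝ} (h : IsAdmissible x d α τ L M) (hd : d ≤ D)
    (hτ : 0 < τ) : IsRegular d (112 / τ) M := by
  have hf := h.smooth.quadraticallyFlat h.compact hτ h.reach_ge
  refine ⟨hd, by positivity, h.smooth, h.compact, ?_, ?_⟩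
  · intro p hp q hq
    refine (hf p hp q hq).trans ?_
    gcongr
    norm_num
  · intro p hp q hq
    refine (hf.tproj_lipschitz (by positivity) h.smooth h.compact hp hq).trans (le_of_eq ?_)
    ring

end ManifoldModel

end

/-! ### M as a graph over its tangent space at a point. -/

noncomputable section

namespace ManifoldModel

variable {D d : ℕ} {M : Set (E D)} {K : ℝ}

/-- The orthogonal projection onto the tangent space, with values in the tangent space. -/
def toTangent (M : Set (E D)) (p : E D) : E D →L[ℝ] tangentSpace M p :=
  (tangentSpace M p).orthogonalProjectionOnto

theorem coe_toTangent (p w : E D) : (toTangent M p w : E D) = tproj M p w := rfl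

theorem toTangent_coe (p : E D) (v : tangentSpace M p) : toTangent M p v = v :=
  Subtype.ext (tproj_of_mem v.2)

namespace IsRegular

theorem norm_sub_sub_tproj_le (hR : IsRegular d K M) {x p q : E D} (hx : x ∈ M) (hp : p ∈ M)
    (hq : q ∈ M) : ‖(q - p) - tproj M x (q - p)‖ ≤ K * (‖q - p‖ + ‖p - x‖) * ‖q - p‖ := by
  have h1 : (q - p) - tproj M x (q - p) =
      ((q - p) - tproj M p (q - p)) + (tproj M p - tproj M x) (q - p) := by
    rw [sub_apply]; abel
  rw [h1]
  refine (norm_add_le _ _).trans ?_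
  have h2 := (tproj M p - tproj M x).le_of_opNorm_le (hR.lip p hp x hx) (q - p)
  have h3 := hR.flat p hp q hq
  nlinarith

/-- Passing from T_x to T_p costs K‖p - x‖ ≤ Kη and flatness at p costs K‖q - p‖ ≤ 2Kη, whence the
factor 3. -/
theorem norm_sub_le_tproj (hR : IsRegular d K M) {x p q : E D} (hx : x ∈ M) (hp : p ∈ M)
    (hq : q ∈ M) {η : ℝ} (hpη : ‖p - x‖ ≤ η) (hqη : ‖q - x‖ ≤ η) :
    (1 - 3 * K * η) * ‖q - p‖ ≤ ‖tproj M x (q - p)‖ := by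
  have h1 := hR.norm_sub_sub_tproj_le hx hp hq
  have h2 : ‖q - p‖ ≤ 2 * η := by
    calc ‖q - p‖ = ‖(q - x) - (p - x)‖ := by congr 1; abel
      _ ≤ _ := norm_sub_le _ _
      _ ≤ _ := by linarith
  have h3 : K * (‖q - p‖ + ‖p - x‖) * ‖q - p‖ ≤ K * (3 * η) * ‖q - p‖ := by
    have := hR.pos
    gcongr
    linarith
  have h4 : ‖q - p‖ ≤ ‖(q - p) - tproj M x (q - p)‖ + ‖tproj M x (q - p)‖ :=
    norm_le_norm_sub_add _ _
  linarith

theorem eq_of_tproj_eq (hR : IsRegular d K M) {x p q : E D} (hx : x ∈ M) (hp : p ∈ M)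
    (hq : q ∈ M) {η : ℝ} (hη : 3 * K * η < 1) (hpη : ‖p - x‖ ≤ η) (hqη : ‖q - x‖ ≤ η)
    (h : tproj M x (p - x) = tproj M x (q - x)) : p = q := by
  have h1 := hR.norm_sub_le_tproj hx hp hq hpη hqη
  have h2 : tproj M x (q - p) = 0 := by
    have : q - p = (q - x) - (p - x) := by abel
    rw [this, map_sub, h, sub_self]
  rw [h2, norm_zero] at h1
  have h3 : ‖q - p‖ ≤ 0 := by
    by_contra hcon
    push Not at hcon
    nlinarith
  exact (sub_eq_zero.1 (norm_le_zero_iff.1 h3)).symm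

theorem half_norm_le_tproj (hR : IsRegular d K M) {x q v : E D} (hx : x ∈ M) (hq : q ∈ M)
    (hK : K * ‖q - x‖ ≤ 1 / 2) (hv : v ∈ tangentSpace M q) : 1 / 2 * ‖v‖ ≤ ‖tproj M x v‖ := by
  have h1 := (tproj M q - tproj M x).le_of_opNorm_le (hR.lip q hq x hx) v
  rw [sub_apply, tproj_of_mem hv] at h1
  have h2 : ‖v‖ ≤ ‖v - tproj M x v‖ + ‖tproj M x v‖ := norm_le_norm_sub_add _ _
  have h3 : K * ‖q - x‖ * ‖v‖ ≤ 1 / 2 * ‖v‖ := by gcongr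
  linarith

theorem exists_tangent_lift (hR : IsRegular d K M) {x q : E D} (hx : x ∈ M) (hq : q ∈ M)
    (hK : K * ‖q - x‖ ≤ 1 / 2) {u : E D} (hu : u ∈ tangentSpace M x) :
    ∃ v ∈ tangentSpace M q, tproj M x v = u := by
  let f : tangentSpace M q →ₗ[ℝ] tangentSpace M x :=
    (toTangent M x : E D →ₗ[ℝ] tangentSpace M x).comp (tangentSpace M q).subtype
  have hf : Function.Injective f := by
    rw [injective_iff_map_eq_zero]
    intro v hv
    have h1 := hR.half_norm_le_tproj hx hq hK v.2
    have h2 : tproj M x v = 0 := by rw [← coe_toTangent]; exact congrArg Subtype.val hv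
    rw [h2, norm_zero] at h1
    have : ‖(v : E D)‖ ≤ 0 := by linarith
    exact Subtype.ext (norm_le_zero_iff.1 this)
  have hdim : Module.finrank ℝ (tangentSpace M q) = Module.finrank ℝ (tangentSpace M x) := by
    rw [hR.smooth.finrank_tangentSpace hR.le hq, hR.smooth.finrank_tangentSpace hR.le hx]
  obtain ⟨v, hv⟩ := (LinearMap.injective_iff_surjective_of_finrank_eq_finrank hdim).1 hf ⟨u, hu⟩
  exact ⟨v, v.2, congrArg Subtype.val hv⟩

/-- Surjectivity by minimization of ‖P(q - x) - u‖, with P the projection at x, over M in the closed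
ball of radius ρ. On the sphere ‖P(q - x)‖ ≥ 3ρ/4, so the value exceeds 3ρ/8 and hence the value ‖u‖
at q = x; the minimum is interior. Its residual is orthogonal to the image of T_qM, which is all of
T_xM, so it vanishes. -/
theorem exists_tproj_eq (hR : IsRegular d K M) {x : E D} (hx : x ∈ M) {ρ : ℝ}
    (hρ : K * ρ ≤ 1 / 4) {u : E D} (hu : u ∈ tangentSpace M x) (huρ : ‖u‖ < 3 / 8 * ρ) :
    ∃ q ∈ M, ‖q - x‖ < ρ ∧ tproj M x (q - x) = u := by
  have hρ0 : 0 < ρ := by linarith [norm_nonneg u]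
  have hKpos := hR.pos
  obtain ⟨q, ⟨hqM, hqb⟩, hmin⟩ := (hR.compact.inter_right
    (Metric.isClosed_closedBall (x := x) (ε := ρ))).exists_isMinOn
    ⟨x, hx, Metric.mem_closedBall_self hρ0.le⟩
    (f := fun q => ‖tproj M x (q - x) - u‖) (by fun_prop)
  rw [mem_closedBall_iff_norm] at hqb
  have hqlt : ‖q - x‖ < ρ := by
    refine lt_of_le_of_ne hqb fun heq => ?_
    have h1 : ‖tproj M x (q - x) - u‖ ≤ ‖tproj M x (x - x) - u‖ :=
      hmin ⟨hx, Metric.mem_closedBall_self hρ0.le⟩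
    rw [sub_self, map_zero, zero_sub, norm_neg] at h1
    have h2 := hR.flat x hx q hqM
    rw [heq] at h2
    have h3 : ‖q - x‖ ≤ ‖(q - x) - tproj M x (q - x)‖ + ‖tproj M x (q - x)‖ :=
      norm_le_norm_sub_add _ _
    have h4 : ‖tproj M x (q - x)‖ ≤ ‖tproj M x (q - x) - u‖ + ‖u‖ := norm_le_norm_sub_add _ _
    nlinarith
  refine ⟨q, hqM, hqlt, ?_⟩
  set a := tproj M x (q - x) - u
  have horth : ∀ v ∈ tangentSpace M q, inner ℝ a (tproj M x v) = 0 := by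
    intro v hv
    induction hv using Submodule.span_induction with
    | mem v hv =>
      obtain ⟨γ, hγ, hM, h0, rfl⟩ := hv
      have hd : HasDerivAt γ (deriv γ 0) 0 := (hγ.differentiable (by simp) 0).hasDerivAt
      have h1 : HasDerivAt (fun t => tproj M x (γ t - x) - u) (tproj M x (deriv γ 0)) 0 :=
        ((tproj M x).hasFDerivAt.comp_hasDerivAt 0 (hd.sub_const x)).sub_const u
      have h2 := h1.norm_sq
      have hmin' : IsLocalMin (fun t => ‖tproj M x (γ t - x) - u‖ ^ 2) 0 := by
        have hev : ∀ᶠ t in 𝓝 (0 : ℝ), γ t ∈ Metric.closedBall x ρ := by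
          apply hd.continuousAt
          rw [h0]
          exact Filter.mem_of_superset
            (Metric.isOpen_ball.mem_nhds (mem_ball_iff_norm.2 hqlt)) Metric.ball_subset_closedBall
        filter_upwards [hM, hev] with t ht1 ht2
        have h3 : ‖tproj M x (q - x) - u‖ ≤ ‖tproj M x (γ t - x) - u‖ := hmin ⟨ht1, ht2⟩
        rw [h0]
        gcongr
      have h3 := hmin'.hasDerivAt_eq_zero h2
      rw [h0] at h3
      linarith
    | zero => simp
    | add a b _ _ ha hb => rw [map_add, inner_add_right, ha, hb, add_zero]
    | smul c a _ ha => rw [map_smul, real_inner_smul_right, ha, mul_zero]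
  have haT : a ∈ tangentSpace M x := Submodule.sub_mem _ (tproj_mem _ _) hu
  have hKq : K * ‖q - x‖ ≤ 1 / 2 := by nlinarith
  obtain ⟨v, hv, hva⟩ := hR.exists_tangent_lift hx hqM hKq haT
  have h5 := horth v hv
  rw [hva, inner_self_eq_zero] at h5
  exact sub_eq_zero.1 h5

/-- The projection has length at least s - K s² at distance s from x, and this function is
nondecreasing for K s ≤ 1/2; compare s = ‖q - x‖ with s = η. -/
theorem norm_sub_lt_of_tproj_lt (hR : IsRegular d K M) {x q : E D} (hx : x ∈ M) (hq : q ∈ M)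
    {η : ℝ} (hη : K * η ≤ 1 / 2) (hq2 : K * ‖q - x‖ ≤ 1 / 2)
    (h : ‖tproj M x (q - x)‖ < (1 - K * η) * η) : ‖q - x‖ < η := by
  by_contra hcon
  push Not at hcon
  have h2 := hR.flat x hx q hq
  have h3 : ‖q - x‖ ≤ ‖(q - x) - tproj M x (q - x)‖ + ‖tproj M x (q - x)‖ :=
    norm_le_norm_sub_add _ _
  have h4 : 0 ≤ (‖q - x‖ - η) * (1 - K * ‖q - x‖ - K * η) :=
    mul_nonneg (by linarith) (by linarith)
  nlinarith

/-- Near `x`, a regular submanifold is parametrized smoothly by its tangent space at `x`. -/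
theorem exists_graph (hR : IsRegular d K M) {x : E D} (hx : x ∈ M) {ρ : ℝ}
    (hρ : K * ρ ≤ 1 / 4) :
    ∃ φ : tangentSpace M x → E D, ContDiffOn ℝ ∞ φ (Metric.ball 0 (3 / 8 * ρ)) ∧
      ∀ u ∈ Metric.ball 0 (3 / 8 * ρ), φ u ∈ M ∧ ‖φ u - x‖ < ρ ∧ toTangent M x (φ u - x) = u := by
  have hKpos := hR.pos
  have hex : ∀ u : tangentSpace M x, ∃ q, u ∈ Metric.ball 0 (3 / 8 * ρ) →
      q ∈ M ∧ ‖q - x‖ < ρ ∧ toTangent M x (q - x) = u := by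
    intro u
    by_cases hu : u ∈ Metric.ball 0 (3 / 8 * ρ)
    · obtain ⟨q, h1, h2, h3⟩ := hR.exists_tproj_eq hx hρ u.2 (mem_ball_zero_iff.1 hu)
      exact ⟨q, fun _ => ⟨h1, h2, Subtype.ext h3⟩⟩
    · exact ⟨0, fun h => absurd h hu⟩
  choose φ hφ using hex
  refine ⟨φ, fun u₀ hu₀ => ContDiffAt.contDiffWithinAt ?_, hφ⟩
  obtain ⟨hM₀, hρ₀, hu₀'⟩ := hφ u₀ hu₀
  have hKq : K * ‖φ u₀ - x‖ ≤ 1 / 2 := by nlinarith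
  obtain ⟨Φ, hs, hΦ⟩ := hR.smooth.exists_chart hM₀
  let S := slice D d
  let y₀ : S := ⟨Φ (φ u₀), (hΦ.mem_iff _ hs).1 hM₀⟩
  have hy₀ : Φ.symm y₀ = φ u₀ := Φ.left_inv hs
  let A : E D →L[ℝ] E D := fderiv ℝ Φ.symm (Φ (φ u₀))
  have hsub : ContDiffAt ℝ ∞ (fun y : S => Φ.symm y) y₀ :=
    (hΦ.contDiffAt_symm (Φ.map_source hs)).comp y₀ S.subtypeL.contDiff.contDiffAt
  -- In a slice chart the projection to T_xM has invertible derivative at y₀, so it has a smooth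
  -- local inverse G. Injectivity of the projection on M near x identifies φ with Φ.symm ∘ G around
  -- u₀, although φ was selected pointwise.
  let F : S → tangentSpace M x := fun y => toTangent M x (Φ.symm y - x)
  have hF : ContDiffAt ℝ ∞ F y₀ :=
    (toTangent M x).contDiff.contDiffAt.comp y₀ (hsub.sub contDiffAt_const)
  let B : S →L[ℝ] tangentSpace M x := (toTangent M x).comp (A.comp S.subtypeL)
  have hB : HasFDerivAt F B y₀ := by
    have h1 : HasFDerivAt (fun y : S => Φ.symm y) (A.comp S.subtypeL) y₀ :=
      (hΦ.hasFDerivAt_symm (Φ.map_source hs)).comp y₀ S.subtypeL.hasFDerivAt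
    exact (toTangent M x).hasFDerivAt.comp y₀ (h1.sub_const x)
  have hBinj : Function.Injective B := by
    rw [injective_iff_map_eq_zero]
    intro a ha
    have hT : A a ∈ tangentSpace M (φ u₀) := by
      rw [hΦ.tangentSpace_eq hM₀ hs]
      exact ⟨a, a.2, rfl⟩
    have h1 := hR.half_norm_le_tproj hx hM₀ hKq hT
    have h2 : tproj M x (A a) = 0 := by rw [← coe_toTangent]; exact congrArg Subtype.val ha
    rw [h2, norm_zero] at h1
    have h3 : A a = 0 := norm_le_zero_iff.1 (by linarith)
    have h4 := hΦ.fderiv_fderiv_symm hs (a : E D)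
    rw [show fderiv ℝ Φ.symm (Φ (φ u₀)) (a : E D) = 0 from h3, map_zero] at h4
    exact Subtype.ext h4.symm
  have hdim : Module.finrank ℝ S = Module.finrank ℝ (tangentSpace M x) := by
    rw [hR.smooth.finrank_tangentSpace hR.le hx, finrank_slice hR.le]
  let e : S ≃L[ℝ] tangentSpace M x :=
    (LinearEquiv.ofInjectiveOfFinrankEq (B : S →ₗ[ℝ] tangentSpace M x) hBinj
      hdim).toContinuousLinearEquiv
  have he : HasFDerivAt F (e : S →L[ℝ] tangentSpace M x) y₀ := by
    have : (e : S →L[ℝ] tangentSpace M x) = B := by ext; rfl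
    rwa [this]
  have hFy : F y₀ = u₀ := by
    simp only [F]
    rw [hy₀, hu₀']
  let G := hF.localInverse he (by simp)
  have hG : ContDiffAt ℝ ∞ G u₀ := by
    have := hF.to_localInverse he (by simp)
    rwa [hFy] at this
  have hGu : G u₀ = y₀ := by
    have := hF.localInverse_apply_image he (by simp)
    rwa [hFy] at this
  have hright : ∀ᶠ u in 𝓝 u₀, F (G u) = u := by
    have := (hF.hasStrictFDerivAt' he (by simp)).eventually_right_inverse
    rwa [hFy] at this
  have hcont : Filter.Tendsto (fun u => (G u : E D)) (𝓝 u₀) (𝓝 (Φ (φ u₀))) := by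
    have h1 : ContinuousAt (fun u => (G u : E D)) u₀ :=
      continuous_subtype_val.continuousAt.comp hG.continuousAt
    have h2 : (G u₀ : E D) = Φ (φ u₀) := by rw [hGu]
    rw [← h2]; exact h1
  have hcd : ContDiffAt ℝ ∞ (fun u => Φ.symm (G u : E D)) u₀ := by
    have h1 : ContDiffAt ℝ ∞ (fun y : S => Φ.symm y) (G u₀) := by rw [hGu]; exact hsub
    exact h1.comp u₀ hG
  refine hcd.congr_of_eventuallyEq ?_
  have hclose : ∀ᶠ u in 𝓝 u₀, ‖Φ.symm (G u : E D) - x‖ < ρ := by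
    have h1 : Filter.Tendsto (fun u => ‖Φ.symm (G u : E D) - x‖) (𝓝 u₀)
        (𝓝 ‖Φ.symm (G u₀ : E D) - x‖) := (hcd.continuousAt.sub continuousAt_const).norm
    refine h1.eventually (gt_mem_nhds ?_)
    rw [hGu, hy₀]; exact hρ₀
  filter_upwards [hright, hclose, hcont (Φ.open_target.mem_nhds (Φ.map_source hs)),
    Metric.isOpen_ball.mem_nhds hu₀] with u h1 h2 h3 h4
  obtain ⟨k1, k2, k3⟩ := hφ u h4
  refine hR.eq_of_tproj_eq hx k1 (hΦ.symm_mem h3 (G u).2) (η := ρ) (by nlinarith) k2.le h2.le ?_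
  rw [← coe_toTangent, ← coe_toTangent, k3]
  exact congrArg Subtype.val h1.symm

end IsRegular

end ManifoldModel

end

/-! ### Geodesics: speed, acceleration and comparison. -/

noncomputable section

namespace ManifoldModel

variable {D d : ℕ} {M : Set (E D)} {K : ℝ}

/-- Geodesics of `M` on a set of times. -/
def IsGeodesicOn (M : Set (E D)) (γ : ℝ → E D) (s : Set ℝ) : Prop :=
  ∀ t ∈ s, ContDiffAt ℝ 2 γ t ∧ γ t ∈ M ∧ deriv (deriv γ) t ∈ (tangentSpace M (γ t))ᗮ

namespace IsGeodesicOn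

variable {γ : ℝ → E D} {s : Set ℝ} {t : ℝ}

theorem mono (h : IsGeodesicOn M γ s) {s' : Set ℝ} (hs : s' ⊆ s) : IsGeodesicOn M γ s' :=
  fun t ht => h t (hs ht)

theorem hasDerivAt (h : IsGeodesicOn M γ s) (ht : t ∈ s) : HasDerivAt γ (deriv γ t) t :=
  ((h t ht).1.differentiableAt (by simp)).hasDerivAt

theorem hasDerivAt_deriv (h : IsGeodesicOn M γ s) (ht : t ∈ s) :
    HasDerivAt (deriv γ) (deriv (deriv γ) t) t := by
  have h1 : ContDiffAt ℝ 1 (deriv γ) t := 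
    ((h t ht).1.fderiv_right (m := 1) (by norm_num)).clm_apply contDiffAt_const
  exact (h1.differentiableAt (by simp)).hasDerivAt

theorem congr {σ : ℝ → E D} (h : IsGeodesicOn M γ s)
    (hσ : ∀ t ∈ s, σ =ᶠ[𝓝 t] γ) : IsGeodesicOn M σ s := by
  intro t ht
  obtain ⟨h1, h2, h3⟩ := h t ht
  refine ⟨h1.congr_of_eventuallyEq (hσ t ht), ?_, ?_⟩
  · rw [(hσ t ht).eq_of_nhds]; exact h2
  · rw [(hσ t ht).eq_of_nhds, (hσ t ht).deriv.deriv_eq]; exact h3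

theorem comp_add_const (h : IsGeodesicOn M γ s) (c : ℝ) :
    IsGeodesicOn M (fun t => γ (t + c)) ((fun t => t + c) ⁻¹' s) := by
  intro t ht
  obtain ⟨h1, h2, h3⟩ := h _ ht
  refine ⟨?_, h2, ?_⟩
  · exact h1.comp (f := fun t : ℝ => t + c) t (by fun_prop)
  · have e1 : deriv (fun t => γ (t + c)) = fun t => deriv γ (t + c) := by
      ext1 t; exact deriv_comp_add_const ..
    rw [e1, deriv_comp_add_const]
    exact h3

theorem comp_neg (h : IsGeodesicOn M γ s) :
    IsGeodesicOn M (fun t => γ (-t)) ((fun t => -t) ⁻¹' s) := by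
  intro t ht
  obtain ⟨h1, h2, h3⟩ := h _ ht
  refine ⟨?_, h2, ?_⟩
  · exact h1.comp (f := fun t : ℝ => -t) t (by fun_prop)
  · have e1 : deriv (fun t => γ (-t)) = fun t => -deriv γ (-t) := by
      ext1 t; exact deriv_comp_neg ..
    rw [e1, deriv.fun_neg, deriv_comp_neg, neg_neg]
    exact h3

theorem velocity_mem (h : IsGeodesicOn M γ s) (hM : IsSmoothSubmanifold d M) (hs : IsOpen s)
    (ht : t ∈ s) : deriv γ t ∈ tangentSpace M (γ t) := by
  refine hM.velocity_mem (h.hasDerivAt ht) ?_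
  filter_upwards [hs.mem_nhds ht] with t' ht'
  exact (h t' ht').2.1

theorem speed_eq (h : IsGeodesicOn M γ s) (hM : IsSmoothSubmanifold d M) (hs : IsOpen s)
    (hc : IsPreconnected s) {t' : ℝ} (ht : t ∈ s) (ht' : t' ∈ s) :
    ‖deriv γ t‖ = ‖deriv γ t'‖ := by
  have hd : ∀ t ∈ s, HasDerivAt (fun t => ‖deriv γ t‖ ^ 2) 0 t := by
    intro t ht
    have h1 := (h.hasDerivAt_deriv ht).norm_sq
    rwa [(Submodule.mem_orthogonal _ _).1 (h t ht).2.2 _ (h.velocity_mem hM hs ht), mul_zero] at h1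
  have h2 := hs.is_const_of_deriv_eq_zero hc
    (fun t ht => (hd t ht).differentiableAt.differentiableWithinAt)
    (fun t ht => (hd t ht).deriv) ht ht'
  exact (pow_left_inj₀ (norm_nonneg _) (norm_nonneg _) two_ne_zero).1 h2

/-- The normal projection Q at time t is frozen. It kills the velocity at t and fixes the
acceleration, so the acceleration is the limit of difference quotients of Q γ', whose numerators are
(P(γ r) - P(γ t)) γ'(r). Only the Lipschitz bound on the projections P is needed. -/
theorem norm_acceleration_le (h : IsGeodesicOn M γ s) (hR : IsRegular d K M) (hs : IsOpen s)
    (ht : t ∈ s) : ‖deriv (deriv γ) t‖ ≤ K * ‖deriv γ t‖ * ‖deriv γ t‖ := by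
  have hKpos := hR.pos
  let Q : E D →L[ℝ] E D := ContinuousLinearMap.id ℝ (E D) - tproj M (γ t)
  have hQ : ∀ w, Q w = w - tproj M (γ t) w := fun _ => rfl
  have hQd : HasDerivAt (fun r => Q (deriv γ r)) (deriv (deriv γ) t) t := by
    have := Q.hasFDerivAt.comp_hasDerivAt t (h.hasDerivAt_deriv ht)
    rwa [hQ, tproj_of_mem_orthogonal (h t ht).2.2, sub_zero] at this
  have hQ0 : Q (deriv γ t) = 0 := by
    rw [hQ, tproj_of_mem (h.velocity_mem hR.smooth hs ht), sub_self]
  have l1 := (hasDerivAt_iff_tendsto_slope.1 hQd).norm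
  have l2 := ((hasDerivAt_iff_tendsto_slope.1 (h.hasDerivAt ht)).norm.const_mul K).mul
    ((h.hasDerivAt_deriv ht).continuousAt.tendsto.mono_left
      (nhdsWithin_le_nhds (s := {t}ᶜ))).norm
  refine le_of_tendsto_of_tendsto l1 l2 ?_
  filter_upwards [mem_nhdsWithin_of_mem_nhds (hs.mem_nhds ht)] with r hr
  rw [slope_def_module, slope_def_module, hQ0, sub_zero, norm_smul, norm_smul]
  have h1 : Q (deriv γ r) = (tproj M (γ r) - tproj M (γ t)) (deriv γ r) := by
    rw [hQ, sub_apply, tproj_of_mem (h.velocity_mem hR.smooth hs hr)]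
  have h2 := (tproj M (γ r) - tproj M (γ t)).le_of_opNorm_le
    (hR.lip _ (h r hr).2.1 _ (h t ht).2.1) (deriv γ r)
  rw [h1]
  calc _ ≤ ‖(r - t)⁻¹‖ * (K * ‖γ r - γ t‖ * ‖deriv γ r‖) := by gcongr
    _ = _ := by ring

/-- Slow geodesics that issue from the same point separate like straight lines. -/
theorem compare {γ₁ γ₂ : ℝ → E D} (h₁ : IsGeodesicOn M γ₁ s) (h₂ : IsGeodesicOn M γ₂ s)
    (hR : IsRegular d K M) (hs : IsOpen s) (hI : Icc 0 1 ⊆ s) (h0 : γ₁ 0 = γ₂ 0) {r : ℝ}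
    (hr : K * r ≤ 1 / 16) (hs₁ : ∀ t ∈ Icc (0 : ℝ) 1, ‖deriv γ₁ t‖ ≤ r)
    (hs₂ : ∀ t ∈ Icc (0 : ℝ) 1, ‖deriv γ₂ t‖ ≤ r) :
    ∀ t ∈ Icc (0 : ℝ) 1,
      ‖deriv γ₁ t - deriv γ₂ t - (deriv γ₁ 0 - deriv γ₂ 0)‖ ≤
        1 / 4 * ‖deriv γ₁ 0 - deriv γ₂ 0‖ ∧
      ‖γ₁ t - γ₂ t - t • (deriv γ₁ 0 - deriv γ₂ 0)‖ ≤ 1 / 4 * ‖deriv γ₁ 0 - deriv γ₂ 0‖ := by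
  have hKpos := hR.pos
  have h0I : (0 : ℝ) ∈ Icc (0 : ℝ) 1 := ⟨le_rfl, zero_le_one⟩
  have hr0 : 0 ≤ r := (norm_nonneg _).trans (hs₁ 0 h0I)
  set u' : ℝ → E D := fun t => deriv γ₁ t - deriv γ₂ t
  set δ : E D := deriv γ₁ 0 - deriv γ₂ 0
  have hu'c : ContinuousOn u' (Icc 0 1) := fun t ht =>
    ((h₁.hasDerivAt_deriv (hI ht)).continuousAt.sub
      (h₂.hasDerivAt_deriv (hI ht)).continuousAt).continuousWithinAt
  obtain ⟨t₀, ht₀, hmax⟩ := isCompact_Icc.exists_isMaxOn ⟨0, h0I⟩ hu'c.norm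
  set m := ‖u' t₀‖
  have hm : ∀ t ∈ Icc (0 : ℝ) 1, ‖u' t‖ ≤ m := fun t ht => hmax ht
  have hm0 : 0 ≤ m := norm_nonneg _
  have hu : ∀ t ∈ Icc (0 : ℝ) 1, HasDerivAt (fun t => γ₁ t - γ₂ t) (u' t) t := fun t ht =>
    (h₁.hasDerivAt (hI ht)).sub (h₂.hasDerivAt (hI ht))
  have hum : ∀ t ∈ Icc (0 : ℝ) 1, ‖γ₁ t - γ₂ t‖ ≤ m := by
    intro t ht
    have h1 := (convex_Icc (0 : ℝ) 1).norm_image_sub_le_of_norm_hasDerivWithin_le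
      (fun t ht => (hu t ht).hasDerivWithinAt) hm h0I ht
    rw [h0, sub_self, sub_zero, sub_zero, Real.norm_eq_abs, abs_of_nonneg ht.1] at h1
    exact h1.trans (mul_le_of_le_one_right hm0 ht.2)
  set P : ℝ → E D →L[ℝ] E D := fun t => tproj M (γ₁ t)
  -- W is the part of the velocity difference tangent at γ₁. The rest is small since γ₂' is tangent
  -- at the nearby point γ₂. The variation of W comes from that of P and from the tangential part of
  -- the acceleration difference, which is small because each acceleration is normal at its own
  -- point.
  set W : ℝ → E D := fun t => P t (u' t)
  have hP12 : ∀ t ∈ Icc (0 : ℝ) 1, ‖tproj M (γ₁ t) - tproj M (γ₂ t)‖ ≤ K * m := fun t ht =>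
    (hR.lip _ (h₁ t (hI ht)).2.1 _ (h₂ t (hI ht)).2.1).trans
      (mul_le_mul_of_nonneg_left (hum t ht) hKpos.le)
  have huW : ∀ t ∈ Icc (0 : ℝ) 1, ‖u' t - W t‖ ≤ K * m * r := by
    intro t ht
    have e : u' t - W t = (tproj M (γ₁ t) - tproj M (γ₂ t)) (deriv γ₂ t) := by
      simp only [u', W, P]
      rw [map_sub, sub_apply, tproj_of_mem (h₁.velocity_mem hR.smooth hs (hI ht)),
        tproj_of_mem (h₂.velocity_mem hR.smooth hs (hI ht))]
      abel
    rw [e]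
    refine ((tproj M (γ₁ t) - tproj M (γ₂ t)).le_of_opNorm_le (hP12 t ht) _).trans ?_
    gcongr
    exact hs₂ t ht
  have hPlip : ∀ t ∈ Icc (0 : ℝ) 1, ∀ t' ∈ Icc (0 : ℝ) 1, ‖P t' - P t‖ ≤ K * r * |t' - t| := by
    intro t ht t' ht'
    have h1 := (convex_Icc (0 : ℝ) 1).norm_image_sub_le_of_norm_hasDerivWithin_le
      (fun t ht => (h₁.hasDerivAt (hI ht)).hasDerivWithinAt) hs₁ ht ht'
    refine (hR.lip _ (h₁ t' (hI ht')).2.1 _ (h₁ t (hI ht)).2.1).trans ?_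
    rw [Real.norm_eq_abs] at h1
    calc _ ≤ K * (r * |t' - t|) := by gcongr
      _ = _ := by ring
  have hPc : ContinuousOn P (Icc 0 1) := by
    have : LipschitzOnWith (Real.toNNReal (K * r)) P (Icc 0 1) := by
      refine LipschitzOnWith.of_dist_le_mul fun t ht t' ht' => ?_
      rw [Real.coe_toNNReal _ (by positivity), dist_eq_norm, Real.dist_eq]
      exact hPlip t' ht' t ht
    exact this.continuousOn
  have hWc : ContinuousOn W (Icc 0 1) := hPc.clm_apply hu'c
  set B := K * r * m + (K * m) * (K * r * r)
  have hW : ∀ t ∈ Icc (0 : ℝ) 1, ‖W t - W 0‖ ≤ B := by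
    intro t ht
    have hb := norm_sub_le_of_local_bound (f := W) (B := B) ht.1
      (hWc.mono (Icc_subset_Icc_right ht.2)) ?_
    · rw [sub_zero] at hb
      refine hb.trans (mul_le_of_le_one_right ?_ ht.2)
      positivity
    intro t₁ ht₁ B' hB'
    have ht₁I : t₁ ∈ Icc (0 : ℝ) 1 := ⟨ht₁.1, ht₁.2.le.trans ht.2⟩
    set c := deriv (deriv γ₁) t₁ - deriv (deriv γ₂) t₁
    have hPu : HasDerivAt (fun t => P t₁ (u' t)) (P t₁ c) t₁ :=
      (P t₁).hasFDerivAt.comp_hasDerivAt t₁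
        ((h₁.hasDerivAt_deriv (hI ht₁I)).sub (h₂.hasDerivAt_deriv (hI ht₁I)))
    have hPc : ‖P t₁ c‖ ≤ (K * m) * (K * r * r) := by
      have e : P t₁ c = -((tproj M (γ₁ t₁) - tproj M (γ₂ t₁)) (deriv (deriv γ₂) t₁)) := by
        simp only [P, c]
        rw [map_sub, sub_apply, tproj_of_mem_orthogonal (h₁ t₁ (hI ht₁I)).2.2,
          tproj_of_mem_orthogonal (h₂ t₁ (hI ht₁I)).2.2]
        abel
      rw [e, norm_neg]
      refine ((tproj M (γ₁ t₁) - tproj M (γ₂ t₁)).le_of_opNorm_le (hP12 t₁ ht₁I) _).trans ?_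
      gcongr
      refine (h₂.norm_acceleration_le hR hs (hI ht₁I)).trans ?_
      have := hs₂ t₁ ht₁I
      gcongr
    have hslope := (hasDerivAt_iff_tendsto_slope.1 hPu).norm
    have hlt : ‖P t₁ c‖ < B' - K * r * m := by
      have : B < B' := hB'
      simp only [B] at this
      linarith
    have hev := (hslope.eventually (gt_mem_nhds hlt))
    have hev' : ∀ᶠ t' in 𝓝[>] t₁, ‖slope (fun t => P t₁ (u' t)) t₁ t'‖ < B' - K * r * m :=
      hev.filter_mono (nhdsWithin_mono _ fun y hy => ne_of_gt hy)
    filter_upwards [hev', Ioo_mem_nhdsGT ht₁.2] with t' h1 h2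
    have ht'I : t' ∈ Icc (0 : ℝ) 1 := ⟨ht₁.1.trans h2.1.le, h2.2.le.trans ht.2⟩
    have hpos : 0 < t' - t₁ := sub_pos.2 h2.1
    have e : W t' - W t₁ = (P t' - P t₁) (u' t') + (P t₁ (u' t') - P t₁ (u' t₁)) := by
      simp only [W, sub_apply]; abel
    rw [slope_def_module, norm_smul, norm_inv, Real.norm_eq_abs, abs_of_pos hpos,
      inv_mul_lt_iff₀ hpos] at h1
    have h3 := (P t' - P t₁).le_of_opNorm_le_of_le (hPlip t₁ ht₁I t' ht'I) (hm t' ht'I)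
    rw [abs_of_pos hpos] at h3
    rw [e]
    refine (norm_add_le _ _).trans ?_
    nlinarith
  have hW0 : W 0 = δ := by
    simp only [W, P, u', δ]
    apply tproj_of_mem
    refine Submodule.sub_mem _ (h₁.velocity_mem hR.smooth hs (hI h0I)) ?_
    rw [h0]
    exact h₂.velocity_mem hR.smooth hs (hI h0I)
  -- With K r ≤ 1/16 the sum 2Kr + (Kr)² is below 1/5. The maximum m then satisfies m ≤ 5/4 ‖δ‖, and
  -- 1/5 · 5/4 = 1/4.
  have hBm : B + K * m * r ≤ 1 / 5 * m := by
    have e1 : B + K * m * r = (2 * (K * r) + (K * r) * (K * r)) * m := by simp only [B]; ring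
    rw [e1]
    have : 0 ≤ K * r := by positivity
    gcongr
    nlinarith
  have huδ : ∀ t ∈ Icc (0 : ℝ) 1, ‖u' t - δ‖ ≤ 1 / 5 * m := by
    intro t ht
    calc ‖u' t - δ‖ = ‖(u' t - W t) + (W t - W 0)‖ := by rw [hW0]; congr 1; abel
      _ ≤ _ := norm_add_le _ _
      _ ≤ _ := by linarith [huW t ht, hW t ht]
  have hmδ : m ≤ 5 / 4 * ‖δ‖ := by
    have h1 : m ≤ ‖u' t₀ - δ‖ + ‖δ‖ := norm_le_norm_sub_add _ _
    linarith [huδ t₀ ht₀]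
  have hfin : ∀ t ∈ Icc (0 : ℝ) 1, ‖u' t - δ‖ ≤ 1 / 4 * ‖δ‖ := fun t ht =>
    (huδ t ht).trans (by linarith)
  intro t ht
  refine ⟨hfin t ht, ?_⟩
  have hd : ∀ t ∈ Icc (0 : ℝ) 1,
      HasDerivWithinAt (fun t => γ₁ t - γ₂ t - t • δ) (u' t - δ) (Icc 0 1) t := by
    intro t ht
    have h1 : HasDerivAt (fun t : ℝ => t • δ) ((1 : ℝ) • δ) t := (hasDerivAt_id t).smul_const δ
    rw [one_smul] at h1
    exact ((hu t ht).sub h1).hasDerivWithinAt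
  have h1 := (convex_Icc (0 : ℝ) 1).norm_image_sub_le_of_norm_hasDerivWithin_le hd hfin h0I ht
  rw [h0, sub_self, zero_smul, sub_zero, sub_zero, sub_zero, Real.norm_eq_abs,
    abs_of_nonneg ht.1] at h1
  exact h1.trans (mul_le_of_le_one_right (by positivity) ht.2)

/-- Uniqueness is the comparison estimate with equal initial velocities, where the right-hand sides
vanish. -/
theorem eqOn_forward {γ₁ γ₂ : ℝ → E D} {a b : ℝ} (h₁ : IsGeodesicOn M γ₁ (Ioo a b))
    (h₂ : IsGeodesicOn M γ₂ (Ioo a b)) (hR : IsRegular d K M) (ha : a < 0) (hb : 1 < b)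
    (h0 : γ₁ 0 = γ₂ 0) (h0' : deriv γ₁ 0 = deriv γ₂ 0) (hv : K * ‖deriv γ₁ 0‖ ≤ 1 / 16)
    {t : ℝ} (ht : t ∈ Icc (0 : ℝ) 1) : γ₁ t = γ₂ t ∧ deriv γ₁ t = deriv γ₂ t := by
  have hI : Icc (0 : ℝ) 1 ⊆ Ioo a b := fun t ht => ⟨ha.trans_le ht.1, ht.2.trans_lt hb⟩
  have h0I : (0 : ℝ) ∈ Ioo a b := ⟨ha, by linarith⟩
  obtain ⟨k1, k2⟩ := h₁.compare h₂ hR isOpen_Ioo hI h0 hv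
    (fun t ht => (h₁.speed_eq hR.smooth isOpen_Ioo isPreconnected_Ioo (hI ht) h0I).le)
    (fun t ht => by
      rw [h0']; exact (h₂.speed_eq hR.smooth isOpen_Ioo isPreconnected_Ioo (hI ht) h0I).le) t ht
  simp only [h0', sub_self, smul_zero, sub_zero, norm_zero, mul_zero] at k1 k2
  exact ⟨sub_eq_zero.1 (norm_le_zero_iff.1 k2), sub_eq_zero.1 (norm_le_zero_iff.1 k1)⟩

theorem eqOn_backward {γ₁ γ₂ : ℝ → E D} {a b : ℝ} (h₁ : IsGeodesicOn M γ₁ (Ioo a b))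
    (h₂ : IsGeodesicOn M γ₂ (Ioo a b)) (hR : IsRegular d K M) (ha : a < -1) (hb : 0 < b)
    (h0 : γ₁ 0 = γ₂ 0) (h0' : deriv γ₁ 0 = deriv γ₂ 0) (hv : K * ‖deriv γ₁ 0‖ ≤ 1 / 16)
    {t : ℝ} (ht : t ∈ Icc (-1 : ℝ) 0) : γ₁ t = γ₂ t ∧ deriv γ₁ t = deriv γ₂ t := by
  have e : (fun t : ℝ => -t) ⁻¹' Ioo a b = Ioo (-b) (-a) := by
    ext t; simp only [mem_preimage, mem_Ioo]; constructor <;> rintro ⟨h1, h2⟩ <;>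
      constructor <;> linarith
  have k1 := h₁.comp_neg
  have k2 := h₂.comp_neg
  rw [e] at k1 k2
  have d1 : ∀ (γ : ℝ → E D) (t : ℝ), deriv (fun t => γ (-t)) t = -deriv γ (-t) :=
    fun γ t => deriv_comp_neg ..
  have := k1.eqOn_forward k2 hR (by linarith) (by linarith) (by simpa using h0)
    (by rw [d1, d1]; simpa using h0') (by rw [d1]; simpa using hv) (t := -t)
    ⟨by linarith [ht.2], by linarith [ht.1]⟩
  rw [d1, d1] at this
  simpa using this

end IsGeodesicOn

theorem isGeodesic_iff_isGeodesicOn {γ : ℝ → E D} : IsGeodesic M γ ↔ IsGeodesicOn M γ univ := by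
  constructor
  · rintro ⟨h1, h2, h3⟩ t _
    exact ⟨h1.contDiffAt, h2 t, h3 t⟩
  · intro h
    exact ⟨contDiff_iff_contDiffAt.2 fun t => (h t trivial).1, fun t => (h t trivial).2.1,
      fun t => (h t trivial).2.2⟩

end ManifoldModel

end

/-! ### The geodesic equation in a parametrization. -/

noncomputable section

namespace ManifoldModel

theorem hasDerivAt_clm_comp_apply {V H : Type*} [NormedAddCommGroup V]
    [NormedSpace ℝ V] [NormedAddCommGroup H] [NormedSpace ℝ H] {A : V → V →L[ℝ] H}
    {A' : V →L[ℝ] V →L[ℝ] H} {u w : ℝ → V} {u' w' : V} {t : ℝ} (hA : HasFDerivAt A A' (u t))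
    (hu : HasDerivAt u u' t) (hw : HasDerivAt w w' t) :
    HasDerivAt (fun t => A (u t) (w t)) (A' u' (w t) + A (u t) w') t := by
  have h0 : HasDerivAt (fun t => A (u t)) (A' u') t := hA.comp_hasDerivAt t hu
  exact h0.clm_apply hw

/-- Conservation of speed. The factor c allows for the vector field being multiplied by a cutoff:
this merely rescales time, so the speed is conserved there too. -/
theorem hasDerivAt_norm_sq_clm_apply_eq_zero {V H : Type*} [NormedAddCommGroup V]
    [NormedSpace ℝ V] [NormedAddCommGroup H] [InnerProductSpace ℝ H] {A : V → V →L[ℝ] H} {A' : V →L[ℝ] V →L[ℝ] H}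
    {u w : ℝ → V} {t c : ℝ} {b : V} (hA : HasFDerivAt A A' (u t))
    (hu : HasDerivAt u (c • w t) t) (hw : HasDerivAt w (c • b) t)
    (h : inner ℝ (A' (w t) (w t) + A (u t) b) (A (u t) (w t)) = 0) :
    HasDerivAt (fun t => ‖A (u t) (w t)‖ ^ 2) 0 t := by
  have h1 := (hasDerivAt_clm_comp_apply hA hu hw).norm_sq
  have h2 : A' (c • w t) (w t) + A (u t) (c • b) = c • (A' (w t) (w t) + A (u t) b) := by
    simp [smul_add]
  rw [real_inner_comm] at h
  rwa [h2, real_inner_smul_right, h, mul_zero, mul_zero] at h1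

section Spray

variable {V H : Type*} [NormedAddCommGroup V] [InnerProductSpace ℝ V] [FiniteDimensional ℝ V]
  [NormedAddCommGroup H] [InnerProductSpace ℝ H]

/-- The real inner product as a continuous bilinear map. -/
def innerBilin (H : Type*) [NormedAddCommGroup H] [InnerProductSpace ℝ H] : H →L[ℝ] H →L[ℝ] ℝ :=
  innerSL ℝ

/-- The geodesic spray of an immersed parametrized submanifold: an acceleration in the parameter
space that makes the acceleration of the image normal. -/
theorem exists_spray {φ : V → H} (hφ : ContDiff ℝ ∞ φ)
    (hinj : ∀ u w, ‖w‖ ≤ ‖fderiv ℝ φ u w‖) :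
    ∃ a : V × V → V, ContDiff ℝ ∞ a ∧ ∀ u w z,
      inner ℝ (fderiv ℝ (fderiv ℝ φ) u w w + fderiv ℝ φ u (a (u, w))) (fderiv ℝ φ u z) = 0 := by
  have hA : ContDiff ℝ ∞ (fderiv ℝ φ) := hφ.fderiv_right (by norm_cast)
  have hA2 : ContDiff ℝ ∞ (fderiv ℝ (fderiv ℝ φ)) := hA.fderiv_right (by norm_cast)
  -- g is the pulled-back metric. The spray solves g(a, ·) = -⟨D²φ(w, w), Dφ ·⟩, and it is smooth
  -- because inversion of operators is.
  let g : V → V →L[ℝ] V →L[ℝ] ℝ := fun u =>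
    ((ContinuousLinearMap.compL ℝ V H ℝ).flip (fderiv ℝ φ u)).comp
      ((innerBilin H).comp (fderiv ℝ φ u))
  have hg : ContDiff ℝ ∞ g := by
    refine ContDiff.clm_comp ?_ (contDiff_const.clm_comp hA)
    exact (ContinuousLinearMap.contDiff _).comp hA
  have hgapp : ∀ u w z, g u w z = inner ℝ (fderiv ℝ φ u w) (fderiv ℝ φ u z) :=
    fun _ _ _ => rfl
  have hginj : ∀ u, Function.Injective (g u) := by
    intro u
    rw [injective_iff_map_eq_zero]
    intro w hw
    have h1 : g u w w = 0 := by rw [hw]; rfl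
    rw [hgapp, real_inner_self_eq_norm_sq] at h1
    have h2 : ‖fderiv ℝ φ u w‖ = 0 := by simpa using h1
    exact norm_le_zero_iff.1 (h2 ▸ hinj u w)
  have hdim : Module.finrank ℝ V = Module.finrank ℝ (V →L[ℝ] ℝ) := by
    rw [← (LinearMap.toContinuousLinearMap (𝕜 := ℝ) (E := V) (F' := ℝ)).finrank_eq]
    exact Subspace.dual_finrank_eq.symm
  let e : V → V ≃L[ℝ] (V →L[ℝ] ℝ) := fun u =>
    (LinearEquiv.ofInjectiveOfFinrankEq (g u : V →ₗ[ℝ] V →L[ℝ] ℝ) (hginj u)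
      hdim).toContinuousLinearEquiv
  have he : ∀ u, (e u : V →L[ℝ] V →L[ℝ] ℝ) = g u := by intro u; ext; rfl
  have hinv : ContDiff ℝ ∞ (fun u => ContinuousLinearMap.inverse (g u)) := by
    rw [contDiff_iff_contDiffAt]
    intro u
    have h1 : ContDiffAt ℝ ∞ ContinuousLinearMap.inverse (g u) := by
      rw [← he]; exact contDiffAt_map_inverse (e u)
    exact h1.comp u hg.contDiffAt
  let ℓ : V × V → V →L[ℝ] ℝ := fun z =>
    (innerBilin H (fderiv ℝ (fderiv ℝ φ) z.1 z.2 z.2)).comp (fderiv ℝ φ z.1)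
  have hℓ : ContDiff ℝ ∞ ℓ := by
    refine ContDiff.clm_comp ?_ (hA.comp contDiff_fst)
    refine (innerBilin H).contDiff.comp ?_
    exact ((hA2.comp contDiff_fst).clm_apply contDiff_snd).clm_apply contDiff_snd
  refine ⟨fun z => -(ContinuousLinearMap.inverse (g z.1) (ℓ z)),
    ((hinv.comp contDiff_fst).clm_apply hℓ).neg, ?_⟩
  intro u w z
  have h1 : g u (ContinuousLinearMap.inverse (g u) (ℓ (u, w))) = ℓ (u, w) := by
    rw [← he, ContinuousLinearMap.inverse_equiv]
    exact (e u).apply_symm_apply _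
  have h2 := DFunLike.congr_fun h1 z
  rw [hgapp] at h2
  have h3 : ℓ (u, w) z = inner ℝ (fderiv ℝ (fderiv ℝ φ) u w w) (fderiv ℝ φ u z) := rfl
  rw [inner_add_left, map_neg, inner_neg_left, h2, h3, add_neg_cancel]

/-- Solutions of the geodesic equation in the parameter space, and smooth dependence of their
endpoints on the initial velocity. -/
theorem exists_spray_solution {φ : V → H} (hφ : ContDiff ℝ ∞ φ)
    (hinj : ∀ u w, ‖w‖ ≤ ‖fderiv ℝ φ u w‖) {a : V × V → V} (ha : ContDiff ℝ ∞ a)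
    (hspray : ∀ u w z,
      inner ℝ (fderiv ℝ (fderiv ℝ φ) u w w + fderiv ℝ φ u (a (u, w))) (fderiv ℝ φ u z) = 0)
    {r : ℝ} (hr : 0 < r) :
    ∃ S : V → V, ContDiff ℝ ∞ S ∧ ∀ v, ‖fderiv ℝ φ 0 v‖ ≤ r → ∃ u w : ℝ → V,
      u 0 = 0 ∧ w 0 = v ∧ u 1 = S v ∧ ∀ t ∈ Ioo (-2 : ℝ) 2,
        HasDerivAt u (w t) t ∧ HasDerivAt w (a (u t, w t)) t ∧ ‖u t‖ ≤ 2 * r := by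
  have hA : ContDiff ℝ ∞ (fderiv ℝ φ) := hφ.fderiv_right (by norm_cast)
  -- The cutoff makes the field bounded and Lipschitz, so the flow exists and is smooth in the
  -- initial data. Conserved speed keeps ‖w‖ ≤ r, hence ‖u‖ ≤ 2r for |t| < 2; the solution stays
  -- where χ = 1 and solves the original equation.
  let χ : ContDiffBump (0 : V × V) := ⟨2 * r, 2 * r + 1, by positivity, by linarith⟩
  let X : V × V → V × V := fun z => (z.2, a z)
  let Y : V × V → V × V := fun z => χ z • X z
  have hX : ContDiff ℝ ∞ X := contDiff_snd.prodMk ha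
  have hY : ContDiff ℝ ∞ Y := χ.contDiff.smul hX
  have hYs : HasCompactSupport Y := χ.hasCompactSupport.smul_right
  obtain ⟨l, hl⟩ := hY.lipschitzWith_of_hasCompactSupport hYs (by simp)
  obtain ⟨b, hb⟩ := hYs.exists_bound_of_continuous hY.continuous
  obtain ⟨T, hT, hTz⟩ := exists_contDiff_timeOneMap hY hl
  refine ⟨fun v => (T (0, v)).1, contDiff_fst.comp (hT.comp (by fun_prop)), ?_⟩
  intro v hv
  obtain ⟨z, hz0, hz⟩ := exists_solution_of_bounded_lipschitz (b := b.toNNReal) hl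
    (fun x => (hb x).trans (Real.le_coe_toNNReal b)) (T := 2) zero_le_two (0, v)
  have hu : ∀ t ∈ Ioo (-2 : ℝ) 2, HasDerivAt (fun t => (z t).1) (χ (z t) • (z t).2) t :=
    fun t ht => (hasFDerivAt_fst (p := z t)).comp_hasDerivAt t (hz t ht)
  have hw : ∀ t ∈ Ioo (-2 : ℝ) 2, HasDerivAt (fun t => (z t).2) (χ (z t) • a (z t)) t :=
    fun t ht => (hasFDerivAt_snd (p := z t)).comp_hasDerivAt t (hz t ht)
  have hAd : ∀ u, HasFDerivAt (fderiv ℝ φ) (fderiv ℝ (fderiv ℝ φ) u) u := fun u =>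
    (hA.differentiable (by simp) u).hasFDerivAt
  have hc : ∀ t ∈ Ioo (-2 : ℝ) 2,
      HasDerivAt (fun t => ‖fderiv ℝ φ (z t).1 (z t).2‖ ^ 2) 0 t := by
    intro t ht
    exact hasDerivAt_norm_sq_clm_apply_eq_zero (u := fun t => (z t).1) (w := fun t => (z t).2)
      (hAd (z t).1) (hu t ht) (hw t ht) (hspray (z t).1 (z t).2 (z t).2)
  have h0 : (0 : ℝ) ∈ Ioo (-2 : ℝ) 2 := by norm_num
  have hspeed : ∀ t ∈ Ioo (-2 : ℝ) 2, ‖(z t).2‖ ≤ r := by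
    intro t ht
    have h2 := isOpen_Ioo.is_const_of_deriv_eq_zero isPreconnected_Ioo
      (fun t ht => (hc t ht).differentiableAt.differentiableWithinAt)
      (fun t ht => (hc t ht).deriv) ht h0
    have h3 := (pow_left_inj₀ (norm_nonneg _) (norm_nonneg _) two_ne_zero).1 h2
    rw [hz0] at h3
    exact (hinj _ _).trans (h3.le.trans hv)
  have hupos : ∀ t ∈ Ioo (-2 : ℝ) 2, ‖(z t).1‖ ≤ 2 * r := by
    intro t ht
    have h1 := (convex_Ioo (-2 : ℝ) 2).norm_image_sub_le_of_norm_hasDerivWithin_le (C := r)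
      (fun t ht => (hu t ht).hasDerivWithinAt) (fun t ht => ?_) h0 ht
    · rw [hz0, sub_zero, sub_zero, Real.norm_eq_abs] at h1
      refine h1.trans ?_
      rw [mul_comm]
      gcongr
      exact (abs_lt.2 ht).le
    · rw [norm_smul, Real.norm_eq_abs, abs_of_nonneg χ.nonneg]
      exact (mul_le_of_le_one_left (norm_nonneg _) χ.le_one).trans (hspeed t ht)
  have hχ : ∀ t ∈ Ioo (-2 : ℝ) 2, χ (z t) = 1 := by
    intro t ht
    apply χ.one_of_mem_closedBall
    rw [mem_closedBall_zero_iff, Prod.norm_def]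
    exact max_le (hupos t ht) ((hspeed t ht).trans (by simp only [χ]; linarith))
  refine ⟨fun t => (z t).1, fun t => (z t).2, congrArg Prod.fst hz0, congrArg Prod.snd hz0, ?_, ?_⟩
  · have := hTz z fun t ht => hz t ⟨by linarith [ht.1], by linarith [ht.2]⟩
    rw [hz0] at this
    exact congrArg Prod.fst this
  · intro t ht
    have h1 := hu t ht
    have h2 := hw t ht
    rw [hχ t ht, one_smul] at h1 h2
    exact ⟨h1, h2, hupos t ht⟩

end Spray

end ManifoldModel

end

/-! ### Local existence of geodesics and smooth dependence on the velocity. -/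

noncomputable section

namespace ManifoldModel

variable {D d : ℕ} {M : Set (E D)} {K : ℝ}

theorem contDiffOn_two_of_hasDerivAt {V : Type*} [NormedAddCommGroup V] [NormedSpace ℝ V]
    {u w a : ℝ → V} {s : Set ℝ} (hs : IsOpen s) (hu : ∀ t ∈ s, HasDerivAt u (w t) t)
    (hw : ∀ t ∈ s, HasDerivAt w (a t) t) (ha : ContinuousOn a s) : ContDiffOn ℝ 2 u s := by
  have hw1 : ContDiffOn ℝ (0 + 1) w s := by
    rw [contDiffOn_succ_iff_deriv_of_isOpen hs]
    refine ⟨fun t ht => (hw t ht).differentiableAt.differentiableWithinAt, by simp, ?_⟩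
    exact contDiffOn_zero.2 (ha.congr fun t ht => (hw t ht).deriv)
  have hu2 : ContDiffOn ℝ (1 + 1) u s := by
    rw [contDiffOn_succ_iff_deriv_of_isOpen hs]
    refine ⟨fun t ht => (hu t ht).differentiableAt.differentiableWithinAt, by simp, ?_⟩
    rw [zero_add] at hw1
    exact hw1.congr fun t ht => (hu t ht).deriv
  rwa [one_add_one_eq_two] at hu2

namespace IsRegular

/-- The graph parametrization near `x`, extended to an immersion of the whole tangent space. -/
theorem exists_extended_graph (hR : IsRegular d K M) {x : E D} (hx : x ∈ M) :
    ∃ φ : tangentSpace M x → E D, ContDiff ℝ ∞ φ ∧ φ 0 = x ∧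
      (∀ u w, toTangent M x (fderiv ℝ φ u w) = w) ∧
      ∀ u ∈ Metric.ball 0 (3 / (64 * K)), φ u ∈ M := by
  have hK := hR.pos
  obtain ⟨φ, hφ, hφM⟩ := hR.exists_graph hx (ρ := 1 / (4 * K)) (by field_simp; norm_num)
  have hR1 : 3 / 8 * (1 / (4 * K)) = 3 / (32 * K) := by field_simp; norm_num
  rw [hR1] at hφ hφM
  let χ : ContDiffBump (0 : tangentSpace M x) :=
    ⟨3 / (64 * K), 3 / (48 * K), by positivity, by gcongr; norm_num⟩
  have hout : 3 / (48 * K) < 3 / (32 * K) := by gcongr; norm_num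
  -- An interpolation between the graph and the affine tangent plane. Both project to u, so ψ does
  -- as well; projection is thus a left inverse of its derivative, which makes ψ an immersion that
  -- does not shrink vectors.
  let ψ : tangentSpace M x → E D := fun u => x + u + χ u • (φ u - x - u)
  have hψ : ContDiff ℝ ∞ ψ := by
    rw [contDiff_iff_contDiffAt]
    intro u
    have hlin : ContDiffAt ℝ ∞ (fun u : tangentSpace M x => x + (u : E D)) u :=
      contDiffAt_const.add (tangentSpace M x).subtypeL.contDiff.contDiffAt
    by_cases hu : u ∈ Metric.ball 0 (3 / (32 * K))
    · refine hlin.add (χ.contDiff.contDiffAt.smul ?_)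
      exact ((hφ.contDiffAt (Metric.isOpen_ball.mem_nhds hu)).sub contDiffAt_const).sub
        (tangentSpace M x).subtypeL.contDiff.contDiffAt
    · refine hlin.congr_of_eventuallyEq ?_
      have hopen : IsOpen {u : tangentSpace M x | 3 / (48 * K) < dist u 0} :=
        isOpen_lt continuous_const (by fun_prop)
      have hu' : u ∈ {u : tangentSpace M x | 3 / (48 * K) < dist u 0} := by
        rw [Metric.mem_ball, not_lt] at hu
        exact hout.trans_le hu
      filter_upwards [hopen.mem_nhds hu'] with u' hu'
      simp only [ψ]
      rw [χ.zero_of_le_dist (le_of_lt hu'), zero_smul, add_zero]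
  have hproj : ∀ u, toTangent M x (ψ u - x) = u := by
    intro u
    have e : ψ u - x = u + χ u • (φ u - x - u) := by simp only [ψ]; abel
    rw [e, map_add, toTangent_coe, map_smul]
    by_cases hu : u ∈ Metric.ball 0 (3 / (32 * K))
    · rw [map_sub _ (φ u - x), (hφM u hu).2.2, toTangent_coe, sub_self, smul_zero, add_zero]
    · rw [Metric.mem_ball, not_lt] at hu
      rw [χ.zero_of_le_dist (hout.le.trans hu), zero_smul, add_zero]
  have hin : ∀ u ∈ Metric.closedBall 0 (3 / (64 * K)), ψ u = φ u := by
    intro u hu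
    simp only [ψ]
    rw [χ.one_of_mem_closedBall hu, one_smul]; abel
  have hlt : 3 / (64 * K) < 3 / (32 * K) := by gcongr; norm_num
  refine ⟨ψ, hψ, ?_, ?_, ?_⟩
  · have h0 : (0 : tangentSpace M x) ∈ Metric.ball 0 (3 / (32 * K)) :=
      Metric.mem_ball_self (by positivity)
    obtain ⟨k1, k2, k3⟩ := hφM 0 h0
    rw [hin 0 (Metric.mem_closedBall_self (by positivity))]
    refine hR.eq_of_tproj_eq hx k1 hx (η := 1 / (4 * K)) ?_ k2.le ?_ ?_
    · field_simp; norm_num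
    · simp only [sub_self, norm_zero]; positivity
    · rw [← coe_toTangent, k3]; simp
  · intro u w
    have h1 : HasFDerivAt (fun u => toTangent M x (ψ u - x))
        ((toTangent M x).comp (fderiv ℝ ψ u)) u :=
      (toTangent M x).hasFDerivAt.comp u
        ((hψ.differentiable (by simp) u).hasFDerivAt.sub_const x)
    have h2 : HasFDerivAt (fun u => toTangent M x (ψ u - x))
        (ContinuousLinearMap.id ℝ (tangentSpace M x)) u := by
      have : (fun u => toTangent M x (ψ u - x)) = id := funext hproj
      rw [this]; exact hasFDerivAt_id u
    exact DFunLike.congr_fun (h1.unique h2) w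
  · intro u hu
    rw [hin u (Metric.ball_subset_closedBall hu)]
    exact (hφM u (Metric.ball_subset_ball hlt.le hu)).1

/-- Existence of slow geodesics on the time interval `(-2, 2)`, with smooth dependence of the
position at time one on the initial velocity. -/
theorem exists_local_geodesics (hR : IsRegular d K M) {x : E D} (hx : x ∈ M) :
    ∃ S : tangentSpace M x → E D, ContDiff ℝ ∞ S ∧ ∀ v : tangentSpace M x, ‖v‖ ≤ 1 / (64 * K) →
      ∃ σ : ℝ → E D, IsGeodesicOn M σ (Ioo (-2) 2) ∧ σ 0 = x ∧ deriv σ 0 = v ∧ σ 1 = S v := by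
  have hK := hR.pos
  obtain ⟨φ, hφ, hφ0, hproj, hφM⟩ := hR.exists_extended_graph hx
  have hA : ContDiff ℝ ∞ (fderiv ℝ φ) := hφ.fderiv_right (by norm_cast)
  have hφd : ∀ u, HasFDerivAt φ (fderiv ℝ φ u) u := fun u =>
    (hφ.differentiable (by simp) u).hasFDerivAt
  have hAd : ∀ u, HasFDerivAt (fderiv ℝ φ) (fderiv ℝ (fderiv ℝ φ) u) u := fun u =>
    (hA.differentiable (by simp) u).hasFDerivAt
  have hinj : ∀ u w, ‖w‖ ≤ ‖fderiv ℝ φ u w‖ := by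
    intro u w
    conv_lhs => rw [← hproj u w]
    exact norm_tproj_le x _
  have hrange : ∀ u ∈ Metric.ball 0 (3 / (64 * K)),
      LinearMap.range (fderiv ℝ φ u : tangentSpace M x →ₗ[ℝ] E D) = tangentSpace M (φ u) := by
    intro u hu
    apply Submodule.eq_of_le_of_finrank_eq
    · rintro _ ⟨z, rfl⟩
      have hline : HasDerivAt (fun t : ℝ => u + t • z) z 0 := by
        simpa using ((hasDerivAt_id (0 : ℝ)).smul_const z).const_add u
      have h1 : HasDerivAt (fun t : ℝ => φ (u + t • z)) (fderiv ℝ φ u z) 0 :=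
        HasFDerivAt.comp_hasDerivAt (f := fun t : ℝ => u + t • z) 0
          (by simpa using hφd u) hline
      have h2 := hR.smooth.velocity_mem h1 ?_
      · simpa using h2
      · have hc : Continuous fun t : ℝ => u + t • z := by fun_prop
        have hm : u + (0 : ℝ) • z ∈ Metric.ball 0 (3 / (64 * K)) := by
          rw [zero_smul, add_zero]; exact hu
        have hev : ∀ᶠ t : ℝ in 𝓝 0, u + t • z ∈ Metric.ball 0 (3 / (64 * K)) :=
          hc.continuousAt.eventually_mem (Metric.isOpen_ball.mem_nhds hm)
        filter_upwards [hev] with t ht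
        exact hφM _ ht
    · rw [hR.smooth.finrank_tangentSpace hR.le (hφM u hu),
        LinearMap.finrank_range_of_inj, hR.smooth.finrank_tangentSpace hR.le hx]
      exact Function.LeftInverse.injective (g := toTangent M x) (hproj u)
  have hA0 : ∀ v, fderiv ℝ φ 0 v = v := by
    intro v
    have h0 : (0 : tangentSpace M x) ∈ Metric.ball 0 (3 / (64 * K)) :=
      Metric.mem_ball_self (by positivity)
    have h1 : fderiv ℝ φ 0 v ∈ tangentSpace M x := by
      have : fderiv ℝ φ 0 v ∈ tangentSpace M (φ 0) := by
        rw [← hrange 0 h0]; exact ⟨v, rfl⟩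
      rwa [hφ0] at this
    rw [← tproj_of_mem h1, ← coe_toTangent, hproj]
  obtain ⟨a, ha, hspray⟩ := exists_spray hφ hinj
  -- Solutions stay within 2r = 2/(64K), inside the ball of radius 3/(64K) on which φ takes values
  -- in M.
  obtain ⟨S, hS, hsol⟩ := exists_spray_solution hφ hinj ha hspray (r := 1 / (64 * K))
    (by positivity)
  refine ⟨fun v => φ (S v), hφ.comp hS, ?_⟩
  intro v hv
  obtain ⟨u, w, hu0, hw0, hu1, hut⟩ := hsol v (by rw [hA0]; exact hv)
  have hub : ∀ t ∈ Ioo (-2 : ℝ) 2, u t ∈ Metric.ball 0 (3 / (64 * K)) := by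
    intro t ht
    rw [mem_ball_zero_iff]
    refine (hut t ht).2.2.trans_lt ?_
    rw [mul_one_div]
    gcongr
    norm_num
  have hd1 : ∀ t ∈ Ioo (-2 : ℝ) 2,
      HasDerivAt (fun t => φ (u t)) (fderiv ℝ φ (u t) (w t)) t := fun t ht =>
    (hφd (u t)).comp_hasDerivAt t (hut t ht).1
  have hd2 : ∀ t ∈ Ioo (-2 : ℝ) 2, HasDerivAt (fun t => fderiv ℝ φ (u t) (w t))
      (fderiv ℝ (fderiv ℝ φ) (u t) (w t) (w t) + fderiv ℝ φ (u t) (a (u t, w t))) t := by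
    intro t ht
    exact hasDerivAt_clm_comp_apply (hAd (u t)) (hut t ht).1 (hut t ht).2.1
  have hu2 : ContDiffOn ℝ 2 u (Ioo (-2) 2) := by
    refine contDiffOn_two_of_hasDerivAt isOpen_Ioo (fun t ht => (hut t ht).1)
      (fun t ht => (hut t ht).2.1) ?_
    intro t ht
    have h1 : ContinuousAt (fun t => (u t, w t)) t :=
      (hut t ht).1.continuousAt.prodMk (hut t ht).2.1.continuousAt
    exact (ha.continuous.continuousAt.comp h1).continuousWithinAt
  have h0I : (0 : ℝ) ∈ Ioo (-2 : ℝ) 2 := by norm_num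
  refine ⟨fun t => φ (u t), ?_, by simp only [hu0, hφ0], ?_, by simp only [hu1]⟩
  · intro t ht
    refine ⟨?_, hφM _ (hub t ht), ?_⟩
    · exact (hφ.of_le (by norm_cast)).contDiffAt.comp t
        (hu2.contDiffAt (isOpen_Ioo.mem_nhds ht))
    · have e : deriv (fun t => φ (u t)) =ᶠ[𝓝 t] fun t => fderiv ℝ φ (u t) (w t) := by
        filter_upwards [isOpen_Ioo.mem_nhds ht] with t' ht'
        exact (hd1 t' ht').deriv
      rw [e.deriv_eq, (hd2 t ht).deriv, ← hrange _ (hub t ht), Submodule.mem_orthogonal']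
      rintro _ ⟨z, rfl⟩
      exact hspray _ _ _
  · rw [(hd1 0 h0I).deriv, hu0, hw0, hA0]

end IsRegular

end ManifoldModel

end

/-! ### The exponential map and a uniform lower bound for the injectivity radius. -/

noncomputable section

namespace ManifoldModel

variable {D d : ℕ} {M : Set (E D)} {K : ℝ}

/-- Tangent vectors of `M` of length at most `r`, with their base points. -/
def TangentDisk (M : Set (E D)) (r : ℝ) : Type :=
  {z : E D × E D // z.1 ∈ M ∧ z.2 ∈ tangentSpace M z.1 ∧ ‖z.2‖ ≤ r}

namespace IsRegular

/-- Slow geodesics exist for all times. -/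
theorem exists_geodesic (hR : IsRegular d K M) {x v : E D} (hx : x ∈ M)
    (hv : v ∈ tangentSpace M x) (hvr : ‖v‖ ≤ 1 / (64 * K)) :
    ∃ γ : ℝ → E D, IsGeodesic M γ ∧ γ 0 = x ∧ deriv γ 0 = v := by
  have hK := hR.pos
  have hex : ∀ z : TangentDisk M (1 / (64 * K)), ∃ σ : ℝ → E D,
      IsGeodesicOn M σ (Ioo (-2) 2) ∧ σ 0 = z.1.1 ∧ deriv σ 0 = z.1.2 := by
    rintro ⟨⟨p, w⟩, hp, hw, hwr⟩
    obtain ⟨S, _, hS⟩ := hR.exists_local_geodesics hp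
    obtain ⟨σ, h1, h2, h3, _⟩ := hS ⟨w, hw⟩ hwr
    exact ⟨σ, h1, h2, h3⟩
  choose σ hσ hσ0 hσ0' using hex
  have h0I : (0 : ℝ) ∈ Ioo (-2 : ℝ) 2 := by norm_num
  have hsp : ∀ z, ∀ t ∈ Ioo (-2 : ℝ) 2, ‖deriv (σ z) t‖ ≤ 1 / (64 * K) := by
    intro z t ht
    rw [(hσ z).speed_eq hR.smooth isOpen_Ioo isPreconnected_Ioo ht h0I, hσ0']
    exact z.2.2.2
  have hKr : ∀ {w : E D}, ‖w‖ ≤ 1 / (64 * K) → K * ‖w‖ ≤ 1 / 16 := by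
    intro w hw
    calc K * ‖w‖ ≤ K * (1 / (64 * K)) := by gcongr
      _ = 1 / 64 := by field_simp
      _ ≤ 1 / 16 := by norm_num
  let st : TangentDisk M (1 / (64 * K)) → (t : ℝ) → t ∈ Ioo (-2 : ℝ) 2 →
      TangentDisk M (1 / (64 * K)) := fun z t ht =>
    ⟨(σ z t, deriv (σ z) t), (hσ z t ht).2.1,
      (hσ z).velocity_mem hR.smooth isOpen_Ioo ht, hsp z t ht⟩
  have hI1 : (1 : ℝ) ∈ Ioo (-2 : ℝ) 2 := by norm_num
  have hIm : (-1 : ℝ) ∈ Ioo (-2 : ℝ) 2 := by norm_num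
  have hshift : ∀ z (c : ℝ), IsGeodesicOn M (fun t => σ z (t + c)) (Ioo (-2 - c) (2 - c)) := by
    intro z c
    refine ((hσ z).comp_add_const c).mono fun t ht => ?_
    exact ⟨by linarith [ht.1], by linarith [ht.2]⟩
  have hdshift : ∀ z (c t : ℝ), deriv (fun t => σ z (t + c)) t = deriv (σ z) (t + c) :=
    fun z c t => deriv_comp_add_const ..
  have hnext : ∀ z, ∀ t ∈ Icc (-1 : ℝ) 0, σ (st z 1 hI1) t = σ z (t + 1) ∧
      deriv (σ (st z 1 hI1)) t = deriv (σ z) (t + 1) := by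
    intro z t ht
    have h1 := (hσ (st z 1 hI1)).mono (s' := Ioo (-2) 1) (Ioo_subset_Ioo_right (by norm_num))
    have h2 := (hshift z 1).mono (s' := Ioo (-2) 1) (Ioo_subset_Ioo (by norm_num) (by norm_num))
    have := h1.eqOn_backward h2 hR (by norm_num) (by norm_num) (by rw [hσ0]; simp [st])
      (by rw [hσ0', hdshift]; simp [st]) (by rw [hσ0']; exact hKr (st z 1 hI1).2.2.2) ht
    rwa [hdshift] at this
  have hprev : ∀ z, ∀ t ∈ Icc (0 : ℝ) 1, σ (st z (-1) hIm) t = σ z (t + -1) ∧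
      deriv (σ (st z (-1) hIm)) t = deriv (σ z) (t + -1) := by
    intro z t ht
    have h1 := (hσ (st z (-1) hIm)).mono (s' := Ioo (-1) 2) (Ioo_subset_Ioo_left (by norm_num))
    have h2 := (hshift z (-1)).mono (s' := Ioo (-1) 2) (Ioo_subset_Ioo (by norm_num) (by norm_num))
    have := h1.eqOn_forward h2 hR (by norm_num) (by norm_num) (by rw [hσ0]; simp [st])
      (by rw [hσ0', hdshift]; simp [st]) (by rw [hσ0']; exact hKr (st z (-1) hIm).2.2.2) ht
    rwa [hdshift] at this
  -- Following a geodesic for unit time permutes the tangent vectors of bounded length, as speed is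
  -- conserved and time can be reversed. The integer powers of e give the states at integer times of
  -- a geodesic on all of ℝ.
  let e : Equiv.Perm (TangentDisk M (1 / (64 * K))) :=
    { toFun := fun z => st z 1 hI1
      invFun := fun z => st z (-1) hIm
      left_inv := fun z => by
        obtain ⟨h1, h2⟩ := hnext z (-1) (by norm_num)
        apply Subtype.ext
        refine Prod.ext ?_ ?_
        · refine h1.trans ?_
          rw [neg_add_cancel, hσ0]
        · refine h2.trans ?_
          rw [neg_add_cancel, hσ0']
      right_inv := fun z => by
        obtain ⟨h1, h2⟩ := hprev z 1 (by norm_num)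
        apply Subtype.ext
        refine Prod.ext ?_ ?_
        · refine h1.trans ?_
          rw [add_neg_cancel, hσ0]
        · refine h2.trans ?_
          rw [add_neg_cancel, hσ0'] }
  let z₀ : TangentDisk M (1 / (64 * K)) := ⟨(x, v), hx, hv, hvr⟩
  let Z : ℤ → TangentDisk M (1 / (64 * K)) := fun k => (e ^ k) z₀
  have hZ : ∀ k, Z (k + 1) = st (Z k) 1 hI1 := by
    intro k
    simp only [Z]
    rw [add_comm, zpow_one_add]
    rfl
  let γ : ℝ → E D := fun t => σ (Z ⌊t⌋) (t + -⌊t⌋)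
  -- Floors switch pieces at integers. By uniqueness the piece issuing from time k also describes γ
  -- on the preceding unit interval, so γ coincides with a single geodesic around each integer.
  have hγ : ∀ k : ℤ, ∀ t ∈ Ioo ((k : ℝ) - 1) (k + 1), γ t = σ (Z k) (t + -k) := by
    intro k t ht
    rcases lt_or_ge t k with hlt | hge
    · have hf : ⌊t⌋ = k - 1 := by
        rw [Int.floor_eq_iff]; push_cast; exact ⟨ht.1.le, by linarith⟩
      have h1 := (hnext (Z (k - 1)) (t + -k) ⟨by linarith [ht.1], by linarith⟩).1
      rw [← hZ, sub_add_cancel] at h1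
      simp only [γ]
      rw [hf, h1]
      congr 1
      push_cast; ring
    · have hf : ⌊t⌋ = k := by
        rw [Int.floor_eq_iff]; exact ⟨hge, ht.2⟩
      simp only [γ]
      rw [hf]
  have hev : ∀ t : ℝ, γ =ᶠ[𝓝 t] fun s => σ (Z ⌊t⌋) (s + -⌊t⌋) := by
    intro t
    have hmem : t ∈ Ioo ((⌊t⌋ : ℝ) - 1) (⌊t⌋ + 1) :=
      ⟨by linarith [Int.floor_le t], Int.lt_floor_add_one t⟩
    filter_upwards [isOpen_Ioo.mem_nhds hmem] with s hs
    exact hγ _ s hs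
  refine ⟨γ, isGeodesic_iff_isGeodesicOn.2 ?_, ?_, ?_⟩
  · intro t _
    have h1 := (hshift (Z ⌊t⌋) (-⌊t⌋)).mono (s' := {t}) (by
      rw [singleton_subset_iff]
      constructor
      · linarith [Int.floor_le t]
      · linarith [Int.lt_floor_add_one t])
    exact h1.congr (fun s hs => by rw [mem_singleton_iff.1 hs]; exact hev t) t rfl
  · have h1 := (hev 0).eq_of_nhds
    rw [h1]
    simp only [Int.floor_zero, Int.cast_zero, neg_zero, add_zero]
    exact hσ0 z₀
  · rw [(hev 0).deriv_eq, hdshift]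
    simp only [Int.floor_zero, Int.cast_zero, neg_zero, add_zero]
    exact hσ0' z₀

theorem exists_geodesic_expMap (hR : IsRegular d K M) {x : E D} (hx : x ∈ M)
    (v : tangentSpace M x) (hvr : ‖v‖ ≤ 1 / (64 * K)) :
    ∃ γ : ℝ → E D, IsGeodesic M γ ∧ γ 0 = x ∧ deriv γ 0 = v ∧ γ 1 = expMap M x v := by
  obtain ⟨γ, h1, h2, h3⟩ := hR.exists_geodesic hx v.2 hvr
  exact Classical.epsilon_spec (p := fun q => ∃ γ : ℝ → E D,
    IsGeodesic M γ ∧ γ 0 = x ∧ deriv γ 0 = (v : E D) ∧ γ 1 = q) ⟨γ 1, γ, h1, h2, h3, rfl⟩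

theorem mul_norm_le (hR : IsRegular d K M) {w : E D} (hw : ‖w‖ ≤ 1 / (64 * K)) :
    K * ‖w‖ ≤ 1 / 16 := by
  have hK := hR.pos
  calc K * ‖w‖ ≤ K * (1 / (64 * K)) := by gcongr
    _ = 1 / 64 := by field_simp
    _ ≤ 1 / 16 := by norm_num

theorem expMap_eq_of_isGeodesicOn (hR : IsRegular d K M) {x : E D} (hx : x ∈ M)
    {v : tangentSpace M x} (hvr : ‖v‖ ≤ 1 / (64 * K)) {σ : ℝ → E D}
    (hσ : IsGeodesicOn M σ (Ioo (-2) 2)) (h0 : σ 0 = x) (h0' : deriv σ 0 = v) :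
    expMap M x v = σ 1 := by
  obtain ⟨γ, h1, h2, h3, h4⟩ := hR.exists_geodesic_expMap hx v hvr
  rw [← h4]
  refine (((isGeodesic_iff_isGeodesicOn.1 h1).mono (subset_univ _)).eqOn_forward hσ hR (by norm_num)
    (by norm_num) (h2.trans h0.symm) (h3.trans h0'.symm) ?_ ⟨zero_le_one, le_rfl⟩).1
  rw [h3]
  exact hR.mul_norm_le hvr

theorem expMap_mem (hR : IsRegular d K M) {x : E D} (hx : x ∈ M)
    {v : tangentSpace M x} (hvr : ‖v‖ ≤ 1 / (64 * K)) : expMap M x v ∈ M := by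
  obtain ⟨γ, h1, _, _, h4⟩ := hR.exists_geodesic_expMap hx v hvr
  rw [← h4]
  exact h1.2.1 1

theorem expMap_zero (hR : IsRegular d K M) {x : E D} (hx : x ∈ M) :
    expMap M x 0 = x := by
  have hK := hR.pos
  refine hR.expMap_eq_of_isGeodesicOn hx (σ := fun _ => x) (by rw [norm_zero]; positivity)
    ?_ rfl (by simp)
  intro t _
  refine ⟨contDiffAt_const, hx, ?_⟩
  simp

/-- The exponential map is smooth on a ball of a radius that depends only on `K`. -/
theorem contDiffOn_expMap (hR : IsRegular d K M) {x : E D} (hx : x ∈ M) :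
    ContDiffOn ℝ ∞ (expMap M x) (Metric.ball 0 (1 / (64 * K))) := by
  obtain ⟨S, hS, hσ⟩ := hR.exists_local_geodesics hx
  refine hS.contDiffOn.congr fun v hv => ?_
  have hv' : ‖v‖ ≤ 1 / (64 * K) := (mem_ball_zero_iff.1 hv).le
  obtain ⟨σ, h1, h2, h3, h4⟩ := hσ v hv'
  rw [hR.expMap_eq_of_isGeodesicOn hx hv' h1 h2 h3, h4]

/-- The comparison estimate at time 1. Closeness of exp_x to the inclusion of T_xM yields its
injectivity, its immersivity and the covering of a neighbourhood of x. -/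
theorem expMap_sub_le (hR : IsRegular d K M) {x : E D} (hx : x ∈ M)
    {v w : tangentSpace M x} (hv : ‖v‖ ≤ 1 / (64 * K)) (hw : ‖w‖ ≤ 1 / (64 * K)) :
    ‖expMap M x v - expMap M x w - (v - w)‖ ≤ 1 / 4 * ‖v - w‖ := by
  have hK := hR.pos
  obtain ⟨γ, h1, h2, h3, h4⟩ := hR.exists_geodesic_expMap hx v hv
  obtain ⟨σ, k1, k2, k3, k4⟩ := hR.exists_geodesic_expMap hx w hw
  rw [isGeodesic_iff_isGeodesicOn] at h1 k1
  have := (h1.compare k1 hR isOpen_univ (subset_univ _) (h2.trans k2.symm) (r := 1 / (64 * K))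
    ?_ ?_ ?_ 1 ⟨zero_le_one, le_rfl⟩).2
  · rwa [h3, k3, h4, k4, one_smul] at this
  · field_simp; norm_num
  · intro t _
    rw [h1.speed_eq hR.smooth isOpen_univ isPreconnected_univ (mem_univ t) (mem_univ 0), h3]
    exact hv
  · intro t _
    rw [k1.speed_eq hR.smooth isOpen_univ isPreconnected_univ (mem_univ t) (mem_univ 0), k3]
    exact hw

theorem isExpParametrization (hR : IsRegular d K M) {x : E D} (hx : x ∈ M) :
    IsExpParametrization M x (1 / (64 * K)) := by
  have hK := hR.pos
  refine ⟨hR.contDiffOn_expMap hx, ?_, ?_⟩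
  · intro v hv w hw heq
    have h1 := hR.expMap_sub_le hx (mem_ball_zero_iff.1 hv).le (mem_ball_zero_iff.1 hw).le
    rw [heq, sub_self, zero_sub, norm_neg] at h1
    have h2 : ‖v - w‖ ≤ 1 / 4 * ‖v - w‖ := h1
    have h3 : ‖v - w‖ ≤ 0 := by linarith
    exact sub_eq_zero.1 (norm_le_zero_iff.1 h3)
  · intro v hv
    have hd : HasFDerivAt (expMap M x) (fderiv ℝ (expMap M x) v) v :=
      (((hR.contDiffOn_expMap hx).contDiffAt (Metric.isOpen_ball.mem_nhds hv)).differentiableAt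
        (by simp)).hasFDerivAt
    have hd2 : HasFDerivAt (fun v => expMap M x v - v)
        (fderiv ℝ (expMap M x) v - (tangentSpace M x).subtypeL) v :=
      hd.sub (tangentSpace M x).subtypeL.hasFDerivAt
    have hq : ((1 / 4 : ℝ≥0) : ℝ) = 1 / 4 := by norm_num
    have hlip : LipschitzOnWith (1 / 4) (fun v => expMap M x v - v)
        (Metric.ball 0 (1 / (64 * K))) := by
      refine LipschitzOnWith.of_dist_le_mul fun a ha b hb => ?_
      rw [dist_eq_norm, dist_eq_norm, hq, sub_sub_sub_comm]
      exact hR.expMap_sub_le hx (mem_ball_zero_iff.1 ha).le (mem_ball_zero_iff.1 hb).le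
    have hn := hd2.le_of_lipschitzOn (Metric.isOpen_ball.mem_nhds hv) hlip
    rw [injective_iff_map_eq_zero]
    intro w hw
    have h1 := (fderiv ℝ (expMap M x) v - (tangentSpace M x).subtypeL).le_of_opNorm_le hn w
    rw [sub_apply, hw, zero_sub, norm_neg, hq] at h1
    have h2 : ‖w‖ ≤ 1 / 4 * ‖w‖ := h1
    exact norm_le_zero_iff.1 (by linarith)

/-- This gives the Hölder conditions a domain of definite size: they are imposed on balls whose
radius is an abstract supremum. -/
theorem ball_subset_injBall (hR : IsRegular d K M) {x : E D} (hx : x ∈ M) :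
    Metric.ball 0 (1 / (64 * K)) ⊆ injBall M x := by
  have hK := hR.pos
  intro v hv
  have h0 : 0 ≤ 1 / (64 * K) := by positivity
  let r : ℝ≥0 := ⟨1 / (64 * K), h0⟩
  have h1 : (r : ℝ≥0∞) ≤ injRadius M x :=
    le_iSup₂ (f := fun (ε : ℝ≥0) (_ : IsExpParametrization M x ε) => (ε : ℝ≥0∞))
      r (hR.isExpParametrization hx)
  refine lt_of_lt_of_le ?_ h1
  rw [mem_ball_zero_iff] at hv
  rw [enorm_eq_nnnorm, ENNReal.coe_lt_coe]
  exact hv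

/-- Points of `M` near `x` are reached by short geodesics. -/
theorem exists_expMap_eq (hR : IsRegular d K M) {x z : E D} (hx : x ∈ M) (hz : z ∈ M) {η : ℝ}
    (hη : η ≤ 1 / (256 * K)) (hzη : ‖z - x‖ ≤ η) :
    ∃ v : tangentSpace M x, ‖v‖ ≤ 2 * η ∧ expMap M x v = z := by
  have hK := hR.pos
  have hη0 : 0 ≤ η := (norm_nonneg _).trans hzη
  have h2η : 2 * η ≤ 1 / (64 * K) := by
    have : 4 * (1 / (256 * K)) = 1 / (64 * K) := by field_simp; norm_num
    linarith
  -- F is a 1/4-Lipschitz perturbation of the identity, so the image of the ball of radius 2η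
  -- contains the ball of radius 3/4 · 2η ≥ η. A preimage v of the projection of z gives exp_x v =
  -- z, because projection is injective on M within 3η of x.
  let F : tangentSpace M x → tangentSpace M x := fun v => toTangent M x (expMap M x v - x)
  have hF0 : F 0 = 0 := by simp [F, hR.expMap_zero hx]
  have hq : ((1 / 4 : ℝ≥0) : ℝ) = 1 / 4 := by norm_num
  have happ : ApproximatesLinearOn F
      ((ContinuousLinearEquiv.refl ℝ (tangentSpace M x) : _ ≃L[ℝ] _) :
        tangentSpace M x →L[ℝ] tangentSpace M x) (Metric.closedBall 0 (2 * η)) (1 / 4) := by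
    intro a ha b hb
    have h1 := hR.expMap_sub_le hx ((mem_closedBall_zero_iff.1 ha).trans h2η)
      ((mem_closedBall_zero_iff.1 hb).trans h2η)
    have h2 : F a - F b - (a - b) = toTangent M x (expMap M x a - expMap M x b - (a - b)) := by
      simp only [F, map_sub, toTangent_coe]; abel
    rw [hq]
    change ‖F a - F b - (a - b)‖ ≤ _
    rw [h2]
    exact (norm_tproj_le x _).trans h1
  have hsurj : ∃ v ∈ Metric.closedBall (0 : tangentSpace M x) (2 * η),
      F v = toTangent M x (z - x) := by
    let R : ((ContinuousLinearEquiv.refl ℝ (tangentSpace M x) : _ ≃L[ℝ] _) :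
        tangentSpace M x →L[ℝ] tangentSpace M x).NonlinearRightInverse :=
      ⟨id, 1, fun y => by simp, fun y => rfl⟩
    have := happ.surjOn_closedBall_of_nonlinearRightInverse R (ε := 2 * η) (b := 0)
      (by linarith) subset_rfl
    refine this ?_
    rw [hF0, mem_closedBall_zero_iff, hq]
    refine (norm_tproj_le x _).trans (hzη.trans ?_)
    simp only [R, NNReal.coe_one, inv_one]
    linarith
  obtain ⟨v, hv, hFv⟩ := hsurj
  rw [mem_closedBall_zero_iff] at hv
  refine ⟨v, hv, ?_⟩
  have hdist : ‖expMap M x v - x‖ ≤ 3 * η := by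
    have h1 := hR.expMap_sub_le hx (hv.trans h2η) (w := 0) (by rw [norm_zero]; positivity)
    rw [hR.expMap_zero hx, sub_zero] at h1
    have h2 : ‖expMap M x v - x‖ ≤ ‖expMap M x v - x - v‖ + ‖(v : E D)‖ :=
      norm_le_norm_sub_add _ _
    have h3 : ‖(v : E D)‖ = ‖v‖ := rfl
    simp only [ZeroMemClass.coe_zero, sub_zero] at h1
    linarith
  refine hR.eq_of_tproj_eq hx (hR.expMap_mem hx (hv.trans h2η)) hz (η := 3 * η) ?_ hdist
    (by linarith) (congrArg Subtype.val hFv)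
  have : K * η ≤ 1 / 256 := by
    calc K * η ≤ K * (1 / (256 * K)) := by gcongr
      _ = 1 / 256 := by field_simp
  linarith

end IsRegular

end ManifoldModel

end

/-! ### Uniform moduli of continuity from Hölder bounds. -/

noncomputable section

namespace ManifoldModel

/-- The coefficients of a polynomial are controlled by its values on an interval. -/
theorem exists_polynomial_coeff_bound (k : ℕ) {r : ℝ} (hr : 0 < r) :
    ∃ A : ℝ, 0 ≤ A ∧ ∀ (c : ℕ → ℝ) (B : ℝ),
      (∀ t ∈ Icc 0 r, |∑ j ∈ Finset.range (k + 1), c j * t ^ j| ≤ B) →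
      ∀ j ∈ Finset.range (k + 1), |c j| ≤ A * B := by
  -- At k + 1 distinct nodes the Vandermonde matrix is invertible; the entries of its inverse bound
  -- the coefficients by the values.
  let t : Fin (k + 1) → ℝ := fun i => r * ((i : ℕ) / (k + 1 : ℝ))
  have hk : (0 : ℝ) < k + 1 := by positivity
  have ht : ∀ i, t i ∈ Icc 0 r := by
    intro i
    refine ⟨by positivity, mul_le_of_le_one_right hr.le ?_⟩
    rw [div_le_one hk]
    exact_mod_cast i.2.le
  have htinj : Function.Injective t := by
    intro i j hij
    have h1 := mul_left_cancel₀ hr.ne' hij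
    rw [div_left_inj' hk.ne'] at h1
    exact Fin.ext (by exact_mod_cast h1)
  let W := Matrix.vandermonde t
  have hW : IsUnit W.det := isUnit_iff_ne_zero.2 (Matrix.det_vandermonde_ne_zero_iff.2 htinj)
  refine ⟨∑ j, ∑ i, |W⁻¹ j i|, by positivity, ?_⟩
  intro c B hB j hj
  have hB0 : 0 ≤ B := (abs_nonneg _).trans (hB 0 ⟨le_rfl, hr.le⟩)
  let cv : Fin (k + 1) → ℝ := fun j => c j
  let y : Fin (k + 1) → ℝ := W.mulVec cv
  have hy : ∀ i, |y i| ≤ B := by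
    intro i
    have h1 := hB (t i) (ht i)
    rw [Finset.sum_range] at h1
    convert h1 using 2
    simp only [y, W, Matrix.mulVec, dotProduct, Matrix.vandermonde_apply, cv]
    exact Finset.sum_congr rfl fun j _ => mul_comm _ _
  have hc : W⁻¹.mulVec y = cv := by
    simp only [y]
    rw [Matrix.mulVec_mulVec, Matrix.nonsing_inv_mul _ hW, Matrix.one_mulVec]
  have hj' : j < k + 1 := Finset.mem_range.1 hj
  have hcj : c j = ∑ i, W⁻¹ ⟨j, hj'⟩ i * y i := by
    have := congrFun hc ⟨j, hj'⟩
    simp only [Matrix.mulVec, dotProduct, cv] at this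
    exact this.symm
  rw [hcj]
  calc |∑ i, W⁻¹ ⟨j, hj'⟩ i * y i| ≤ ∑ i, |W⁻¹ ⟨j, hj'⟩ i * y i| := Finset.abs_sum_le_sum_abs _ _
    _ ≤ ∑ i, |W⁻¹ ⟨j, hj'⟩ i| * B := by
        refine Finset.sum_le_sum fun i _ => ?_
        rw [abs_mul]
        gcongr
        exact hy i
    _ = (∑ i, |W⁻¹ ⟨j, hj'⟩ i|) * B := by rw [Finset.sum_mul]
    _ ≤ _ := by
        refine mul_le_mul_of_nonneg_right ?_ hB0
        exact Finset.single_le_sum (f := fun j => ∑ i, |W⁻¹ j i|)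
          (fun j _ => by positivity) (Finset.mem_univ (⟨j, hj'⟩ : Fin (k + 1)))

/-- Taylor's formula for a function whose last derivative has bounded oscillation. -/
theorem abs_sub_taylor_le {r C : ℝ} (hC : 0 ≤ C) (k : ℕ) : ∀ φ : ℕ → ℝ → ℝ,
    (∀ j < k, ∀ t ∈ Ico 0 r, HasDerivAt (φ j) (φ (j + 1) t) t) →
    (∀ t ∈ Ico 0 r, |φ k t - φ k 0| ≤ C) → ∀ t ∈ Ico 0 r,
      |φ 0 t - ∑ j ∈ Finset.range (k + 1), φ j 0 / j.factorial * t ^ j| ≤ C * t ^ k := by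
  induction k with
  | zero =>
    intro φ _ h t ht
    simpa using h t ht
  | succ k ih =>
    intro φ hd h t ht
    have h1 := ih (fun j => φ (j + 1)) (fun j hj => hd (j + 1) (by omega)) h
    have hder : ∀ s ∈ Icc 0 t, HasDerivWithinAt
        (fun s => φ 0 s - ∑ j ∈ Finset.range (k + 1 + 1), φ j 0 / j.factorial * s ^ j)
        (φ 1 s - ∑ j ∈ Finset.range (k + 1), φ (j + 1) 0 / j.factorial * s ^ j) (Icc 0 t) s := by
      intro s hs
      have hsI : s ∈ Ico 0 r := ⟨hs.1, hs.2.trans_lt ht.2⟩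
      refine ((hd 0 (by omega) s hsI).sub ?_).hasDerivWithinAt
      have h2 : HasDerivAt (fun s => ∑ j ∈ Finset.range (k + 1 + 1), φ j 0 / j.factorial * s ^ j)
          (∑ j ∈ Finset.range (k + 1 + 1), φ j 0 / j.factorial * (j * s ^ (j - 1))) s :=
        HasDerivAt.fun_sum fun j _ => (hasDerivAt_pow j s).const_mul _
      have h3 : ∑ j ∈ Finset.range (k + 1 + 1), φ j 0 / j.factorial * (j * s ^ (j - 1)) =
          ∑ j ∈ Finset.range (k + 1), φ (j + 1) 0 / j.factorial * s ^ j := by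
        rw [Finset.sum_range_succ' _ (k + 1)]
        simp only [CharP.cast_eq_zero, zero_mul, mul_zero, add_zero, Nat.add_sub_cancel]
        refine Finset.sum_congr rfl fun j _ => ?_
        rw [Nat.factorial_succ]
        have : (j.factorial : ℝ) ≠ 0 := by positivity
        push_cast
        field_simp
      rwa [h3] at h2
    have hbound : ∀ s ∈ Icc 0 t,
        ‖φ 1 s - ∑ j ∈ Finset.range (k + 1), φ (j + 1) 0 / j.factorial * s ^ j‖ ≤ C * t ^ k := by
      intro s hs
      have h0 := hs.1
      refine (h1 s ⟨hs.1, hs.2.trans_lt ht.2⟩).trans ?_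
      gcongr
      exact hs.2
    have h3 := (convex_Icc 0 t).norm_image_sub_le_of_norm_hasDerivWithin_le hder hbound
      (left_mem_Icc.2 ht.1) (right_mem_Icc.2 ht.1)
    have h4 : φ 0 0 - ∑ j ∈ Finset.range (k + 1 + 1), φ j 0 / j.factorial * (0 : ℝ) ^ j = 0 := by
      rw [Finset.sum_range_succ' _ (k + 1)]
      simp
    rw [h4, sub_zero, sub_zero, Real.norm_eq_abs, Real.norm_eq_abs, abs_of_nonneg ht.1] at h3
    rwa [pow_succ, ← mul_assoc]

/-- A bounded function on an interval whose `k`-th derivative has bounded oscillation is Lipschitz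
at the left endpoint, with uniform constants. -/
theorem exists_lipschitz_of_bounded_oscillation {k : ℕ} {r C F : ℝ} (hr : 0 < r)
    (hC : 0 ≤ C) (hF : 0 ≤ F) (hk : k ≠ 0) :
    ∃ A : ℝ, 0 ≤ A ∧ ∀ φ : ℕ → ℝ → ℝ,
      (∀ j < k, ∀ t ∈ Ico 0 r, HasDerivAt (φ j) (φ (j + 1) t) t) →
      (∀ t ∈ Ico 0 r, |φ k t - φ k 0| ≤ C) → (∀ t ∈ Ico 0 r, |φ 0 t| ≤ F) →
      ∀ t ∈ Ico 0 r, t ≤ 1 → |φ 0 t - φ 0 0| ≤ A * t := by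
  obtain ⟨A, hA, hcoef⟩ := exists_polynomial_coeff_bound k (half_pos hr)
  refine ⟨k * (A * (F + C * r ^ k)) + C, by positivity, ?_⟩
  intro φ hd h hF t ht ht1
  have htay := abs_sub_taylor_le hC k φ hd h
  set c : ℕ → ℝ := fun j => φ j 0 / j.factorial
  -- Only the oscillation of the k-th derivative is bounded by hypothesis. The derivatives at 0 are
  -- recovered from the bound on the function: its Taylor polynomial is at most F + C r ^ k on [0,
  -- r/2], hence so, up to A, are its coefficients.
  have hc := hcoef c (F + C * r ^ k) (fun s hs => by
    have hsI : s ∈ Ico 0 r := ⟨hs.1, by linarith [hs.2]⟩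
    have h1 := htay s hsI
    have h2 := hF s hsI
    have h3 : C * s ^ k ≤ C * r ^ k := by
      have := hs.1
      have := hsI.2.le
      gcongr
    rw [abs_le] at h1 h2 ⊢
    constructor <;> linarith [h1.1, h1.2, h2.1, h2.2])
  have h1 := htay t ht
  have hsplit : ∑ j ∈ Finset.range (k + 1), c j * t ^ j =
      φ 0 0 + ∑ j ∈ Finset.range k, c (j + 1) * t ^ (j + 1) := by
    rw [Finset.sum_range_succ']
    simp [c, add_comm]
  have hsum : |∑ j ∈ Finset.range k, c (j + 1) * t ^ (j + 1)| ≤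
      k * (A * (F + C * r ^ k)) * t := by
    calc _ ≤ ∑ j ∈ Finset.range k, |c (j + 1) * t ^ (j + 1)| := Finset.abs_sum_le_sum_abs _ _
      _ ≤ ∑ j ∈ Finset.range k, (A * (F + C * r ^ k)) * t := by
          refine Finset.sum_le_sum fun j hj => ?_
          have ht0 := ht.1
          have hcj := hc (j + 1) (by simp only [Finset.mem_range] at hj ⊢; omega)
          rw [abs_mul, abs_of_nonneg (pow_nonneg ht.1 _)]
          have hp : t ^ (j + 1) ≤ t := pow_le_of_le_one ht.1 ht1 (by omega)
          exact mul_le_mul hcj hp (by positivity) ((abs_nonneg _).trans hcj)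
      _ = _ := by rw [Finset.sum_const, Finset.card_range, nsmul_eq_mul]; ring
  have hlast : C * t ^ k ≤ C * t := by
    gcongr
    exact pow_le_of_le_one ht.1 ht1 hk
  change |φ 0 t - ∑ j ∈ Finset.range (k + 1), c j * t ^ j| ≤ _ at h1
  rw [hsplit] at h1
  rw [abs_le] at h1 hsum ⊢
  constructor <;> linarith [h1.1, h1.2, hsum.1, hsum.2]

theorem holderOrder_lt {β : ℝ} (hβ : 0 < β) : (holderOrder β : ℝ) < β := by
  unfold holderOrder
  rcases le_total β 1 with h | h
  · rw [Nat.ceil_eq_zero.2 (by linarith)]; simpa using hβ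
  · have := Nat.ceil_lt_add_one (a := β - 1) (by linarith)
    linarith

/-- A uniform modulus of continuity at the centre for bounded functions of bounded Hölder
coefficient on a ball. -/
theorem exists_holder_modulus {β R F r : ℝ} (hβ : 0 < β) (hR : 0 ≤ R) (hF : 0 ≤ F) (hr : 0 < r)
    {ε : ℝ} (hε : 0 < ε) :
    ∃ δ > 0, ∀ (V : Type) [NormedAddCommGroup V] [NormedSpace ℝ V] (g : V → ℝ),
      ContDiffOn ℝ (holderOrder β) g (Metric.ball 0 r) →
      (∀ v ∈ Metric.ball 0 r, |g v| ≤ F) →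
      (∀ v ∈ Metric.ball 0 r, ‖iteratedFDeriv ℝ (holderOrder β) g v -
        iteratedFDeriv ℝ (holderOrder β) g 0‖ ≤ R * ‖v‖ ^ (β - holderOrder β)) →
      ∀ v, ‖v‖ < δ → |g v - g 0| ≤ ε := by
  have hexp : 0 < β - holderOrder β := sub_pos.2 (holderOrder_lt hβ)
  set k := holderOrder β
  rcases eq_or_ne k 0 with hk | hk
  · have hlim : Filter.Tendsto (fun t : ℝ => R * t ^ (β - k)) (𝓝 0) (𝓝 0) := by
      have h1 := (Real.continuousAt_rpow_const 0 (β - k) (Or.inr hexp.le)).tendsto.const_mul R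
      rwa [Real.zero_rpow hexp.ne', mul_zero] at h1
    obtain ⟨δ, hδ, hball⟩ := Metric.eventually_nhds_iff.1 (hlim.eventually (gt_mem_nhds hε))
    refine ⟨min δ r, lt_min hδ hr, ?_⟩
    intro V _ _ g _ _ hg v hv
    have hvr : v ∈ Metric.ball (0 : V) r := mem_ball_zero_iff.2 (hv.trans_le (min_le_right _ _))
    have h1 := hg v hvr
    have h2 : R * ‖v‖ ^ (β - k) < ε := hball (by
      rw [dist_zero_right, norm_norm]; exact hv.trans_le (min_le_left _ _))
    have h3 : |g v - g 0| = ‖iteratedFDeriv ℝ k g v - iteratedFDeriv ℝ k g 0‖ := by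
      rw [hk, iteratedFDeriv_zero_eq_comp, Function.comp_apply, Function.comp_apply, ← map_sub,
        LinearIsometryEquiv.norm_map, Real.norm_eq_abs]
    rw [h3]
    linarith
  · obtain ⟨A, hA, hlip⟩ := exists_lipschitz_of_bounded_oscillation (k := k) (F := F) hr
      (C := R * r ^ (β - k)) (by positivity) hF hk
    refine ⟨min (min 1 r) (ε / (A + 1)), by positivity, ?_⟩
    intro V _ _ g hg hgF hgR v hv
    have hv1 : ‖v‖ < 1 := hv.trans_le ((min_le_left _ _).trans (min_le_left _ _))
    have hvr : ‖v‖ < r := hv.trans_le ((min_le_left _ _).trans (min_le_right _ _))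
    have hve : ‖v‖ < ε / (A + 1) := hv.trans_le (min_le_right _ _)
    rcases eq_or_ne v 0 with h0 | h0
    · rw [h0, sub_self, abs_zero]; exact hε.le
    have hv0 : 0 < ‖v‖ := norm_pos_iff.2 h0
    set e : V := ‖v‖⁻¹ • v
    have he : ‖e‖ = 1 := by rw [norm_smul, norm_inv, norm_norm, inv_mul_cancel₀ hv0.ne']
    have hve' : ‖v‖ • e = v := by rw [smul_smul, mul_inv_cancel₀ hv0.ne', one_smul]
    have hmem : ∀ t ∈ Ico 0 r, t • e ∈ Metric.ball (0 : V) r := by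
      intro t ht
      rw [mem_ball_zero_iff, norm_smul, he, mul_one, Real.norm_eq_abs, abs_of_nonneg ht.1]
      exact ht.2
    -- The successive derivatives of g along the ray through v. Restriction to a ray makes the
    -- constants independent of the space V, so δ can be chosen before V.
    let φ : ℕ → ℝ → ℝ := fun j t => iteratedFDeriv ℝ j g (t • e) (fun _ => e)
    have hφ0 : ∀ t, φ 0 t = g (t • e) := fun t => by simp [φ]
    have key := hlip φ ?_ ?_ ?_ ‖v‖ ⟨hv0.le, hvr⟩ hv1.le
    · rw [hφ0, hφ0, hve', zero_smul] at key
      refine key.trans ?_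
      rw [lt_div_iff₀ (by positivity)] at hve
      nlinarith
    · intro j hj t ht
      have hcd : ContDiffAt ℝ k g (t • e) := hg.contDiffAt (Metric.isOpen_ball.mem_nhds (hmem t ht))
      have h1 : HasFDerivAt (iteratedFDeriv ℝ j g) (fderiv ℝ (iteratedFDeriv ℝ j g) (t • e))
          (t • e) :=
        (hcd.differentiableAt_iteratedFDeriv (by exact_mod_cast hj)).hasFDerivAt
      have h2 : HasDerivAt (fun t : ℝ => t • e) e t := by
        simpa using (hasDerivAt_id t).smul_const e
      have h3 : HasDerivAt (fun t : ℝ => iteratedFDeriv ℝ j g (t • e))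
          (fderiv ℝ (iteratedFDeriv ℝ j g) (t • e) e) t := h1.comp_hasDerivAt t h2
      have h4 := (ContinuousMultilinearMap.apply ℝ (fun _ : Fin j => V) ℝ
        (fun _ => e)).hasFDerivAt.comp_hasDerivAt t h3
      have h5 : φ (j + 1) t = fderiv ℝ (iteratedFDeriv ℝ j g) (t • e) e (fun _ => e) := by
        simp only [φ]
        rw [iteratedFDeriv_succ_apply_left]
        rfl
      rw [h5]
      exact h4
    · intro t ht
      have h1 := hgR (t • e) (hmem t ht)
      have h2 : φ k t - φ k 0 =
          (iteratedFDeriv ℝ k g (t • e) - iteratedFDeriv ℝ k g 0) (fun _ => e) := by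
        simp [φ]
      rw [h2, ← Real.norm_eq_abs]
      refine (ContinuousMultilinearMap.le_opNorm _ _).trans ?_
      simp only [he, Finset.prod_const_one, mul_one]
      refine h1.trans ?_
      have h3 := mem_ball_zero_iff.1 (hmem t ht)
      gcongr
    · intro t ht
      rw [hφ0]
      exact hgF _ (hmem t ht)

end ManifoldModel

end

/-! ### The modulus of continuity of densities on M. -/

noncomputable section

namespace ManifoldModel

variable {D d : ℕ} {K : ℝ} {M : Set (E D)}

theorem norm_iteratedFDeriv_sub_le_of_enorm_div_le {V : Type*} [NormedAddCommGroup V]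
    [NormedSpace ℝ V] {g : V → ℝ} {k : ℕ} {R e : ℝ} (hR : 0 ≤ R) {v w : V}
    (h : ‖iteratedFDeriv ℝ k g v - iteratedFDeriv ℝ k g w‖ₑ / ‖v - w‖ₑ ^ e ≤ ENNReal.ofReal R) :
    ‖iteratedFDeriv ℝ k g v - iteratedFDeriv ℝ k g w‖ ≤ R * ‖v - w‖ ^ e := by
  rcases eq_or_ne v w with rfl | hvw
  · rw [sub_self, norm_zero]; positivity
  have hpos : 0 < ‖v - w‖ := norm_pos_iff.2 (sub_ne_zero.2 hvw)
  rwa [← ofReal_norm, ← ofReal_norm, ENNReal.ofReal_rpow_of_pos hpos,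
    ← ENNReal.ofReal_div_of_pos (by positivity), ENNReal.ofReal_le_ofReal_iff hR,
    div_le_iff₀ (by positivity)] at h

theorem norm_iteratedFDeriv_sub_le_of_holderCoeff_le {γ R : ℝ} (hR : 0 ≤ R) {f : E D → ℝ}
    (h : holderCoeff M γ f ≤ ENNReal.ofReal R) {p : E D} (hp : p ∈ M)
    {v w : tangentSpace M p} (hv : v ∈ injBall M p) (hw : w ∈ injBall M p) :
    ‖iteratedFDeriv ℝ (holderOrder γ) (f ∘ expMap M p) v -
      iteratedFDeriv ℝ (holderOrder γ) (f ∘ expMap M p) w‖ ≤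
        R * ‖v - w‖ ^ (γ - holderOrder γ) := by
  refine norm_iteratedFDeriv_sub_le_of_enorm_div_le hR (le_trans ?_ h)
  unfold holderCoeff
  refine le_iSup₂_of_le p hp ?_
  refine le_iSup₂_of_le v hv ?_
  exact le_iSup₂_of_le w hw le_rfl

/-- Bounded functions of bounded Hölder coefficient on regular submanifolds have a uniform modulus
of continuity. -/
theorem exists_density_modulus {β R F : ℝ} (hβ : 0 < β) (hR : 0 ≤ R) (hF : 0 ≤ F) (hK : 0 < K)
    {ε : ℝ} (hε : 0 < ε) :
    ∃ δ > 0, ∀ {D d : ℕ} {M : Set (E D)} (_ : IsRegular d K M) {x : E D} (_ : x ∈ M)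
      {f : E D → ℝ}, MemHolder M β f → holderCoeff M β f ≤ ENNReal.ofReal R →
      (∀ z ∈ M, |f z| ≤ F) → ∀ z ∈ M, ‖z - x‖ < δ → |f z - f x| ≤ ε := by
  have hr : 0 < 1 / (64 * K) := by positivity
  obtain ⟨δ, hδ, hmod⟩ := exists_holder_modulus hβ hR hF hr hε
  -- The vector v with exp_x v = z has length at most 2‖z - x‖, which accounts for δ/2.
  refine ⟨min (δ / 2) (1 / (256 * K)), by positivity, ?_⟩
  intro D d M hM x hx f hf hfR hfF z hz hzx
  have hzδ : ‖z - x‖ < δ / 2 := hzx.trans_le (min_le_left _ _)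
  obtain ⟨v, hv, rfl⟩ := hM.exists_expMap_eq hx hz (hzx.le.trans (min_le_right _ _)) le_rfl
  have hsub := hM.ball_subset_injBall hx
  have h1 := hmod (tangentSpace M x) (f ∘ expMap M x) ((hf x hx).1.mono hsub)
    (fun w hw => hfF _ (hM.expMap_mem hx (mem_ball_zero_iff.1 hw).le))
    (fun w hw => by
      have h2 := norm_iteratedFDeriv_sub_le_of_holderCoeff_le hR hfR hx (hsub hw)
        (hsub (Metric.mem_ball_self hr))
      rwa [sub_zero] at h2) v (by linarith)
  rwa [Function.comp_apply, Function.comp_apply, hM.expMap_zero hx] at h1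

end ManifoldModel

end

/-! ### Volume of small balls in M. -/

noncomputable section

namespace ManifoldModel

variable {D d : ℕ} {K : ℝ} {M : Set (E D)}

theorem euclideanHausdorffMeasure_image_le {X Y : Type*} [EMetricSpace X] [MeasurableSpace X]
    [BorelSpace X] [EMetricSpace Y] [MeasurableSpace Y] [BorelSpace Y] {C : ℝ≥0} {f : X → Y}
    {s : Set X} (h : LipschitzOnWith C f s) (d : ℕ) :
    Measure.euclideanHausdorffMeasure d (f '' s) ≤
      (C : ℝ≥0∞) ^ d * Measure.euclideanHausdorffMeasure d s := by
  rw [Measure.euclideanHausdorffMeasure_def, Measure.euclideanHausdorffMeasure_def,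
    Measure.smul_apply, Measure.smul_apply, ENNReal.smul_def, ENNReal.smul_def, smul_eq_mul,
    smul_eq_mul, mul_left_comm]
  have h1 := h.hausdorffMeasure_image_le (d := (d : ℝ)) (by positivity)
  rw [ENNReal.rpow_natCast] at h1
  gcongr

/-- The volume of the unit ball of `ℝ^d`. -/
def unitBallVolume (d : ℕ) : ℝ := √Real.pi ^ d / Real.Gamma (d / 2 + 1)

theorem unitBallVolume_pos (d : ℕ) : 0 < unitBallVolume d := by
  have : 0 < Real.Gamma ((d : ℝ) / 2 + 1) := Real.Gamma_pos_of_pos (by positivity)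
  have := Real.pi_pos
  unfold unitBallVolume
  positivity

theorem euclideanHausdorffMeasure_ball {V : Type*} [NormedAddCommGroup V] [InnerProductSpace ℝ V]
    [FiniteDimensional ℝ V] [MeasurableSpace V] [BorelSpace V] (hV : Module.finrank ℝ V = d)
    (hd : 1 ≤ d) {r : ℝ} (hr : 0 ≤ r) :
    Measure.euclideanHausdorffMeasure d (Metric.ball (0 : V) r) =
      ENNReal.ofReal (r ^ d * unitBallVolume d) := by
  subst hV
  have : Nontrivial V := Module.nontrivial_of_finrank_pos (R := ℝ) hd
  rw [InnerProductSpace.euclideanHausdorffMeasure_eq_volume, InnerProductSpace.volume_ball,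
    ENNReal.ofReal_mul (by positivity), ENNReal.ofReal_pow hr]
  rfl

namespace IsRegular

/-- Projection to T_xM does not increase Hausdorff measure, and the image of M ∩ B(x, η) covers the
ball of radius (1 - Kη)η. -/
theorem le_volume_inter_ball (hR : IsRegular d K M) (hd : 1 ≤ d) {x : E D} (hx : x ∈ M) {η : ℝ}
    (hη : 0 < η) (hKη : K * η ≤ 1 / 16) :
    ENNReal.ofReal (((1 - K * η) * η) ^ d * unitBallVolume d) ≤
      Measure.euclideanHausdorffMeasure d (M ∩ Metric.ball x η) := by
  have hK := hR.pos
  have h0 : 0 ≤ (1 - K * η) * η := mul_nonneg (by linarith) hη.le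
  rw [← euclideanHausdorffMeasure_ball (V := tangentSpace M x)
    (hR.smooth.finrank_tangentSpace hR.le hx) hd h0]
  have hlip : LipschitzOnWith 1 (fun q => toTangent M x (q - x)) (M ∩ Metric.ball x η) := by
    refine LipschitzOnWith.of_dist_le_mul fun p _ q _ => ?_
    rw [dist_eq_norm, dist_eq_norm, ← map_sub, sub_sub_sub_cancel_right, NNReal.coe_one, one_mul]
    exact norm_tproj_le _ _
  have h1 := euclideanHausdorffMeasure_image_le hlip d
  rw [ENNReal.coe_one, one_pow, one_mul] at h1
  refine (measure_mono ?_).trans h1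
  intro u hu
  have hu' : ‖(u : E D)‖ < (1 - K * η) * η := mem_ball_zero_iff.1 hu
  have h2 : (1 - K * η) * η ≤ η := mul_le_of_le_one_left hη.le (by nlinarith)
  obtain ⟨q, hq, hqx, hqu⟩ := hR.exists_tproj_eq hx (ρ := 4 * η) (by linarith) u.2 (by linarith)
  refine ⟨q, ⟨hq, ?_⟩, Subtype.ext hqu⟩
  rw [Metric.mem_ball, dist_eq_norm]
  refine hR.norm_sub_lt_of_tproj_lt hx hq (by linarith) ?_ (by rwa [hqu])
  calc K * ‖q - x‖ ≤ K * (4 * η) := by gcongr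
    _ ≤ 1 / 2 := by linarith

/-- The inverse of the projection is Lipschitz with constant 1/(1 - 3Kη) on the image of M ∩ B(x,
η), which lies in the ball of radius η of T_xM. -/
theorem volume_inter_ball_le (hR : IsRegular d K M) (hd : 1 ≤ d) {x : E D} (hx : x ∈ M) {η : ℝ}
    (hη : 0 < η) (hKη : K * η ≤ 1 / 16) :
    Measure.euclideanHausdorffMeasure d (M ∩ Metric.ball x η) ≤
      ENNReal.ofReal (((1 - 3 * K * η)⁻¹ * η) ^ d * unitBallVolume d) := by
  have hK := hR.pos
  have hpos : 0 < 1 - 3 * K * η := by linarith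
  let S : Set (tangentSpace M x) := (fun q => toTangent M x (q - x)) '' (M ∩ Metric.ball x η)
  have hinv : ∀ u : tangentSpace M x, ∃ q : E D, u ∈ S → q ∈ M ∩ Metric.ball x η ∧
      toTangent M x (q - x) = u := by
    intro u
    by_cases hu : u ∈ S
    · obtain ⟨q, hq, hqu⟩ := hu
      exact ⟨q, fun _ => ⟨hq, hqu⟩⟩
    · exact ⟨0, fun h => absurd h hu⟩
  choose ψ hψ using hinv
  have hbound : ∀ p ∈ M ∩ Metric.ball x η, ∀ q ∈ M ∩ Metric.ball x η,
      ‖p - q‖ ≤ (1 - 3 * K * η)⁻¹ * ‖toTangent M x (p - x) - toTangent M x (q - x)‖ := by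
    intro p hp q hq
    have h1 := hR.norm_sub_le_tproj hx hq.1 hp.1 (mem_ball_iff_norm.1 hq.2).le
      (mem_ball_iff_norm.1 hp.2).le
    rw [← map_sub, sub_sub_sub_cancel_right, inv_mul_eq_div, le_div_iff₀ hpos, mul_comm]
    exact h1
  have hlip : LipschitzOnWith (Real.toNNReal (1 - 3 * K * η)⁻¹) ψ S := by
    refine LipschitzOnWith.of_dist_le_mul fun u hu w hw => ?_
    obtain ⟨hu1, hu2⟩ := hψ u hu
    obtain ⟨hw1, hw2⟩ := hψ w hw
    have h1 := hbound _ hu1 _ hw1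
    rw [hu2, hw2] at h1
    rwa [dist_eq_norm, dist_eq_norm, Real.coe_toNNReal _ (by positivity)]
  have himg : M ∩ Metric.ball x η ⊆ ψ '' S := by
    intro q hq
    have hqS : toTangent M x (q - x) ∈ S := ⟨q, hq, rfl⟩
    refine ⟨_, hqS, ?_⟩
    obtain ⟨h1, h2⟩ := hψ _ hqS
    have h3 := hbound _ h1 _ hq
    rw [h2, sub_self, norm_zero, mul_zero] at h3
    exact sub_eq_zero.1 (norm_le_zero_iff.1 h3)
  have hS : S ⊆ Metric.ball 0 η := by
    rintro _ ⟨q, hq, rfl⟩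
    rw [mem_ball_zero_iff]
    exact (norm_tproj_le (M := M) x (q - x)).trans_lt (mem_ball_iff_norm.1 hq.2)
  calc Measure.euclideanHausdorffMeasure d (M ∩ Metric.ball x η)
      ≤ Measure.euclideanHausdorffMeasure d (ψ '' S) := measure_mono himg
    _ ≤ _ := euclideanHausdorffMeasure_image_le hlip d
    _ ≤ (ENNReal.ofReal (1 - 3 * K * η)⁻¹) ^ d * ENNReal.ofReal (η ^ d * unitBallVolume d) := by
        rw [← euclideanHausdorffMeasure_ball (V := tangentSpace M x)
          (hR.smooth.finrank_tangentSpace hR.le hx) hd hη.le]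
        exact mul_le_mul_right (measure_mono hS) _
    _ = _ := by
        rw [← ENNReal.ofReal_pow (by positivity), ← ENNReal.ofReal_mul (by positivity), mul_pow,
          mul_assoc ((1 - 3 * K * η)⁻¹ ^ d)]

end IsRegular

end ManifoldModel

end

/-! ### Uniform scaling of the mass of small balls. -/

noncomputable section

namespace ManifoldModel

variable {D d : ℕ} {K : ℝ} {M : Set (E D)}

/-- Two-sided bounds for the mass that a measure with almost constant density gives to a ball. -/
theorem IsRegular.withDensity_ball_bounds (hR : IsRegular d K M) (hd : 1 ≤ d) {x : E D}
    (hx : x ∈ M) {η t : ℝ} (hη : 0 < η) (ht : 0 < t) (ht1 : t ≤ 1 / 16) (hKη : K * η ≤ t)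
    {f : E D → ℝ} {P : Measure (E D)}
    (hP : P = (volumeMeasure d M).withDensity (fun z => ENNReal.ofReal (f z)))
    (hf0 : 0 < f x) (hf : ∀ z ∈ M, ‖z - x‖ < η → |f z - f x| ≤ t * f x) :
    (1 - t) * (1 - t) ^ d * (f x * unitBallVolume d * η ^ d) ≤ P.real (Metric.ball x η) ∧
      P.real (Metric.ball x η) ≤
        (1 + t) * (1 - 3 * t)⁻¹ ^ d * (f x * unitBallVolume d * η ^ d) := by
  have hK := hR.pos
  have hω := unitBallVolume_pos d
  have hKη' : K * η ≤ 1 / 16 := hKη.trans ht1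
  have hmass : P (Metric.ball x η) = ∫⁻ z in M ∩ Metric.ball x η, ENNReal.ofReal (f z)
      ∂Measure.euclideanHausdorffMeasure d := by
    rw [hP, withDensity_apply _ measurableSet_ball, volumeMeasure,
      Measure.restrict_restrict measurableSet_ball, inter_comm]
  have hmeas : MeasurableSet (M ∩ Metric.ball x η) :=
    hR.compact.measurableSet.inter measurableSet_ball
  have hfz : ∀ z ∈ M ∩ Metric.ball x η, (1 - t) * f x ≤ f z ∧ f z ≤ (1 + t) * f x := by
    intro z hz
    have h1 := abs_le.1 (hf z hz.1 (mem_ball_iff_norm.1 hz.2))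
    constructor <;> linarith [h1.1, h1.2]
  have hup : P (Metric.ball x η) ≤
      ENNReal.ofReal ((1 + t) * (1 - 3 * t)⁻¹ ^ d * (f x * unitBallVolume d * η ^ d)) := by
    rw [hmass]
    calc _ ≤ ∫⁻ z in M ∩ Metric.ball x η, ENNReal.ofReal ((1 + t) * f x)
            ∂Measure.euclideanHausdorffMeasure d :=
          setLIntegral_mono measurable_const fun z hz => ENNReal.ofReal_le_ofReal (hfz z hz).2
      _ = ENNReal.ofReal ((1 + t) * f x) *
            Measure.euclideanHausdorffMeasure d (M ∩ Metric.ball x η) := setLIntegral_const _ _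
      _ ≤ ENNReal.ofReal ((1 + t) * f x) *
            ENNReal.ofReal (((1 - 3 * K * η)⁻¹ * η) ^ d * unitBallVolume d) :=
          mul_le_mul_right (hR.volume_inter_ball_le hd hx hη hKη') _
      _ ≤ _ := by
          rw [← ENNReal.ofReal_mul (by positivity)]
          refine ENNReal.ofReal_le_ofReal ?_
          have h3 : 0 < 1 - 3 * t := by linarith
          have h1 : (1 - 3 * K * η)⁻¹ ≤ (1 - 3 * t)⁻¹ := inv_anti₀ h3 (by linarith)
          have h0 : 0 ≤ (1 - 3 * K * η)⁻¹ := inv_nonneg.2 (by linarith)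
          have h2 := pow_le_pow_left₀ h0 h1 d
          calc (1 + t) * f x * (((1 - 3 * K * η)⁻¹ * η) ^ d * unitBallVolume d)
              = (1 + t) * (1 - 3 * K * η)⁻¹ ^ d * (f x * unitBallVolume d * η ^ d) := by
                rw [mul_pow]; ring
            _ ≤ _ := by gcongr
  have hlow : ENNReal.ofReal ((1 - t) * (1 - t) ^ d * (f x * unitBallVolume d * η ^ d)) ≤
      P (Metric.ball x η) := by
    rw [hmass]
    have h1t : 0 ≤ 1 - t := by linarith
    calc ENNReal.ofReal ((1 - t) * (1 - t) ^ d * (f x * unitBallVolume d * η ^ d))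
        ≤ ENNReal.ofReal ((1 - t) * f x) *
            ENNReal.ofReal (((1 - K * η) * η) ^ d * unitBallVolume d) := by
          rw [← ENNReal.ofReal_mul (by positivity)]
          refine ENNReal.ofReal_le_ofReal ?_
          have h2 := pow_le_pow_left₀ h1t (show 1 - t ≤ 1 - K * η by linarith) d
          calc _ ≤ (1 - t) * (1 - K * η) ^ d * (f x * unitBallVolume d * η ^ d) := by gcongr
            _ = _ := by rw [mul_pow]; ring
      _ ≤ ENNReal.ofReal ((1 - t) * f x) *
            Measure.euclideanHausdorffMeasure d (M ∩ Metric.ball x η) :=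
          mul_le_mul_right (hR.le_volume_inter_ball hd hx hη hKη') _
      _ = ∫⁻ z in M ∩ Metric.ball x η, ENNReal.ofReal ((1 - t) * f x)
            ∂Measure.euclideanHausdorffMeasure d := (setLIntegral_const _ _).symm
      _ ≤ _ := setLIntegral_mono' hmeas fun z hz => ENNReal.ofReal_le_ofReal (hfz z hz).1
  have htop : P (Metric.ball x η) ≠ ⊤ := (hup.trans_lt ENNReal.ofReal_lt_top).ne
  have h3 : 0 < 1 - 3 * t := by linarith
  exact ⟨(ENNReal.ofReal_le_iff_le_toReal htop).1 hlow,
    ENNReal.toReal_le_of_le_ofReal (by positivity) hup⟩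

/-- Uniformly over the model, the mass of a small ball of radius `η` around the base point is
asymptotically proportional to `η ^ d`. -/
theorem exists_mass_scaling {D d : ℕ} (hd : 1 ≤ d) (hdD : d ≤ D) {α β τ L fmin fmax R : ℝ}
    (hβ : 0 < β) (hτ : 0 < τ) (hR : 0 < R) (hfmin : 0 < fmin) (hf : fmin < fmax) {ε : ℝ}
    (hε : 0 < ε) :
    ∃ η₀ > 0, ∀ x : E D, ∀ P ∈ model x d α β τ L fmin fmax R,
      ∃ c ≥ fmin * unitBallVolume d, ∀ η, 0 < η → η < η₀ →
        |(P : Measure (E D)).real (Metric.ball x η) - c * η ^ d| ≤ ε * (c * η ^ d) := by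
  have hω := unitBallVolume_pos d
  obtain ⟨t, ht, ht1, hlow, hup⟩ : ∃ t : ℝ, 0 < t ∧ t ≤ 1 / 16 ∧
      1 - ε ≤ (1 - t) * (1 - t) ^ d ∧ (1 + t) * (1 - 3 * t)⁻¹ ^ d ≤ 1 + ε := by
    have hc1 : ContinuousAt (fun t : ℝ => (1 - t) * (1 - t) ^ d) 0 := by fun_prop
    have hc2 : ContinuousAt (fun t : ℝ => (1 + t) * (1 - 3 * t)⁻¹ ^ d) 0 := by
      refine ContinuousAt.mul (by fun_prop) (ContinuousAt.pow (ContinuousAt.inv₀ (by fun_prop) ?_) d)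
      norm_num
    have e1 : ∀ᶠ t in 𝓝[>] (0 : ℝ), 1 - ε < (1 - t) * (1 - t) ^ d :=
      (hc1.mono_left nhdsWithin_le_nhds).eventually (lt_mem_nhds (by norm_num; exact hε))
    have e2 : ∀ᶠ t in 𝓝[>] (0 : ℝ), (1 + t) * (1 - 3 * t)⁻¹ ^ d < 1 + ε :=
      (hc2.mono_left nhdsWithin_le_nhds).eventually (gt_mem_nhds (by norm_num; exact hε))
    have e3 : ∀ᶠ t in 𝓝[>] (0 : ℝ), t < 1 / 16 :=
      nhdsWithin_le_nhds (gt_mem_nhds (by norm_num))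
    obtain ⟨t, h1, h2, h3, h4⟩ := (e1.and (e2.and (e3.and self_mem_nhdsWithin))).exists
    exact ⟨t, h4, h3.le, h1.le, h2.le⟩
  have hK : 0 < 112 / τ := by positivity
  -- An absolute oscillation of t · fmin is a relative oscillation of at most t, since f(x) ≥ fmin.
  obtain ⟨δ, hδ, hmod⟩ := exists_density_modulus hβ hR.le (hfmin.trans hf).le hK
    (mul_pos ht hfmin)
  refine ⟨min δ (t / (112 / τ)), by positivity, ?_⟩
  rintro x P ⟨M, hM, -, f, -, hP, hfH, hfb, hfR⟩
  have hreg := hM.isRegular hdD hτ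
  have hfx := hfb x hM.mem
  refine ⟨f x * unitBallVolume d, by gcongr; exact hfx.1, ?_⟩
  intro η hη hηlt
  have hη1 : η < δ := hηlt.trans_le (min_le_left _ _)
  have hη2 : 112 / τ * η ≤ t := by
    have := hηlt.le.trans (min_le_right _ _)
    rwa [le_div_iff₀ hK, mul_comm] at this
  have hf0 : 0 < f x := hfmin.trans_le hfx.1
  obtain ⟨h1, h2⟩ := hreg.withDensity_ball_bounds hd hM.mem hη ht ht1 hη2 hP hf0 (by
    intro z hz hzx
    refine (hmod hreg hM.mem hfH hfR (fun z hz => ?_) z hz (hzx.trans hη1)).trans ?_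
    · rw [abs_of_nonneg (hfmin.le.trans (hfb z hz).1)]
      exact (hfb z hz).2
    · gcongr
      exact hfx.1)
  have hA : 0 ≤ f x * unitBallVolume d * η ^ d := by positivity
  have h3 := mul_le_mul_of_nonneg_right hlow hA
  have h4 := mul_le_mul_of_nonneg_right hup hA
  rw [abs_le]
  constructor <;> linarith

end ManifoldModel

end

/-! ### Concentration of the empirical masses and the error of the estimator. -/

noncomputable section

namespace ManifoldModel

variable {D d : ℕ}

theorem empiricalMass_eq {n : ℕ} (x : E D) (η : ℝ) (X : Fin n → E D) :
    empiricalMass x η X = (n : ℝ)⁻¹ * ∑ i, (Metric.ball x η).indicator (fun _ => (1 : ℝ)) (X i) := by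
  unfold empiricalMass empiricalMeasure
  rw [Measure.real, Measure.smul_apply, smul_eq_mul, ENNReal.toReal_mul, ENNReal.toReal_inv,
    ENNReal.toReal_natCast, Measure.finsetSum_apply, ENNReal.toReal_sum (fun i _ => measure_ne_top _ _)]
  congr 1
  refine Finset.sum_congr rfl fun i _ => ?_
  rw [Measure.dirac_apply' _ measurableSet_ball]
  by_cases h : X i ∈ Metric.ball x η <;> simp [h]

/-- Hoeffding's inequality for a bounded function of the points of an independent sample. -/
theorem measure_pi_sum_ge_le {Ω : Type*} [MeasurableSpace Ω] (P : Measure Ω)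
    [IsProbabilityMeasure P] {n : ℕ} (hn : 1 ≤ n) {g : Ω → ℝ} (hg : Measurable g) {a : ℝ}
    (hga : ∀ y, g y ∈ Icc a (a + 1)) {t : ℝ} (ht : 0 ≤ t) :
    (Measure.pi fun _ : Fin n => P).real {X | t ≤ (n : ℝ)⁻¹ * ∑ i, g (X i) - ∫ y, g y ∂P} ≤
      Real.exp (-2 * (n * t ^ 2)) := by
  have hn0 : (0 : ℝ) < n := by exact_mod_cast hn
  set μ := Measure.pi fun _ : Fin n => P
  set m := ∫ y, g y ∂P
  let Y : Fin n → (Fin n → Ω) → ℝ := fun i X => g (X i) - m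
  have hind : ProbabilityTheory.iIndepFun Y μ :=
    ProbabilityTheory.iIndepFun_pi (X := fun _ : Fin n => fun y => g y - m)
      fun _ => (hg.sub_const m).aemeasurable
  have hsub : ∀ i ∈ (Finset.univ : Finset (Fin n)),
      ProbabilityTheory.HasSubgaussianMGF (Y i) ((‖a + 1 - a‖₊ / 2) ^ 2) μ := by
    intro i _
    have h1 := ProbabilityTheory.hasSubgaussianMGF_of_mem_Icc (μ := μ)
      (X := fun X : Fin n → Ω => g (X i)) (a := a) (b := a + 1)
      (hg.comp (measurable_pi_apply i)).aemeasurable (ae_of_all _ fun X => hga (X i))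
    have h2 : ∫ X : Fin n → Ω, g (X i) ∂μ = m := by
      have hmp := measurePreserving_eval (fun _ : Fin n => P) i
      have h3 := integral_map (μ := μ) hmp.measurable.aemeasurable
        (f := g) hg.aestronglyMeasurable
      rw [hmp.map_eq] at h3
      exact h3.symm
    rw [h2] at h1
    exact h1
  have h :=
    ProbabilityTheory.HasSubgaussianMGF.measure_sum_ge_le_of_iIndepFun hind hsub (ε := n * t)
    (by positivity)
  have hset : {X : Fin n → Ω | t ≤ (n : ℝ)⁻¹ * ∑ i, g (X i) - m} =
      {X | n * t ≤ ∑ i, Y i X} := by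
    ext X
    simp only [mem_ofPred_eq, Y, Finset.sum_sub_distrib, Finset.sum_const, Finset.card_univ,
      Fintype.card_fin, nsmul_eq_mul]
    rw [← mul_le_mul_iff_right₀ hn0, mul_sub, mul_inv_cancel_left₀ hn0.ne']
  rw [hset]
  refine h.trans (le_of_eq ?_)
  congr 1
  simp only [add_sub_cancel_left, nnnorm_one, Finset.sum_const, Finset.card_univ,
    Fintype.card_fin, nsmul_eq_mul]
  push_cast
  field_simp

theorem measure_pi_empiricalMass_le (P : Measure (E D)) [IsProbabilityMeasure P] {n : ℕ}
    (hn : 1 ≤ n) (x : E D) (η : ℝ) {t : ℝ} (ht : 0 ≤ t) :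
    (Measure.pi fun _ : Fin n => P)
      {X | t ≤ |empiricalMass x η X - P.real (Metric.ball x η)|} ≤
        ENNReal.ofReal (2 * Real.exp (-2 * (n * t ^ 2))) := by
  set μ := Measure.pi fun _ : Fin n => P
  let g : E D → ℝ := (Metric.ball x η).indicator fun _ => 1
  have hg : Measurable g := measurable_const.indicator measurableSet_ball
  have hmean : ∫ y, g y ∂P = P.real (Metric.ball x η) := integral_indicator_one measurableSet_ball
  have hg01 : ∀ y, 0 ≤ g y ∧ g y ≤ 1 := by
    intro y
    by_cases h : y ∈ Metric.ball x η <;> simp [g, h]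
  have h1 := measure_pi_sum_ge_le P hn hg (a := 0) (fun y => by
    rw [zero_add]; exact hg01 y) ht
  have h2 := measure_pi_sum_ge_le P hn hg.neg (a := -1) (fun y => by
    have := hg01 y
    constructor <;> simp only [Pi.neg_apply] <;> linarith) ht
  have hsub : {X : Fin n → E D | t ≤ |empiricalMass x η X - P.real (Metric.ball x η)|} ⊆
      {X | t ≤ (n : ℝ)⁻¹ * ∑ i, g (X i) - ∫ y, g y ∂P} ∪
        {X | t ≤ (n : ℝ)⁻¹ * ∑ i, (-g) (X i) - ∫ y, (-g) y ∂P} := by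
    intro X hX
    rw [mem_ofPred_eq, empiricalMass_eq, ← hmean] at hX
    rcases le_abs.1 hX with h | h
    · exact Or.inl h
    · refine Or.inr ?_
      simp only [mem_ofPred_eq, Pi.neg_apply, Finset.sum_neg_distrib, integral_neg]
      refine h.trans (le_of_eq ?_)
      simp only [g]
      ring
  calc _ ≤ _ := measure_mono hsub
    _ ≤ _ := measure_union_le _ _
    _ ≤ ENNReal.ofReal (Real.exp (-2 * (n * t ^ 2))) +
        ENNReal.ofReal (Real.exp (-2 * (n * t ^ 2))) := by
      refine add_le_add ?_ ?_
      · rw [← ofReal_measureReal]; exact ENNReal.ofReal_le_ofReal h1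
      · rw [← ofReal_measureReal]; exact ENNReal.ofReal_le_ofReal h2
    _ = _ := by
      rw [← ENNReal.ofReal_add (by positivity) (by positivity)]
      congr 1
      ring

/-- If the empirical masses of two concentric balls scale almost like `η ^ d`, the estimator
returns `d`. -/
theorem dimEstimator_eq {n : ℕ} {x : E D} {η A : ℝ} {X : Fin n → E D} (hA : 0 < A)
    (h1 : |empiricalMass x η X - A| ≤ A / 8)
    (h2 : |empiricalMass x (2 * η) X - 2 ^ d * A| ≤ 2 ^ d * A / 8) :
    dimEstimator x η X = d := by
  set p := empiricalMass x η X
  set q := empiricalMass x (2 * η) X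
  rw [abs_le] at h1 h2
  have h2d : (0 : ℝ) < 2 ^ d := by positivity
  have hA2 : 0 < 2 ^ d * A := by positivity
  have hp : 0 < p := by linarith [h1.1]
  have hq : 0 < q := by linarith [h2.1]
  -- Relative errors of 1/8 leave s between 7/9 and 9/7. Both squares lie between 1/2 and 2, so log₂
  -- s is at least -1/2 and below 1/2, as rounding requires.
  set s := q / (2 ^ d * p)
  have hs : 0 < s := by positivity
  have hs1 : 7 / 9 ≤ s := by
    rw [le_div_iff₀ (by positivity)]
    nlinarith [h1.2, h2.1]
  have hs2 : s ≤ 9 / 7 := by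
    rw [div_le_iff₀ (by positivity)]
    nlinarith [h1.1, h2.2]
  have hlog : Real.logb 2 q - Real.logb 2 p = d + Real.logb 2 s := by
    rw [Real.logb_div hq.ne' (by positivity), Real.logb_mul h2d.ne' hp.ne', Real.logb_pow,
      Real.logb_self_eq_one (by norm_num)]
    ring
  have hsq : Real.logb 2 (s ^ 2) = 2 * Real.logb 2 s := by
    rw [Real.logb_pow]; norm_num
  have hup : Real.logb 2 (s ^ 2) < 1 := by
    rw [Real.logb_lt_iff_lt_rpow (by norm_num) (by positivity), Real.rpow_one]
    nlinarith
  have hlow : -1 ≤ Real.logb 2 (s ^ 2) := by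
    rw [Real.le_logb_iff_rpow_le (by norm_num) (by positivity), Real.rpow_neg_one]
    nlinarith
  unfold dimEstimator scalingExponent
  rw [if_neg hp.ne']
  change ⌊Real.logb 2 q - Real.logb 2 p + 1 / 2⌋ = (d : ℤ)
  rw [hlog, Int.floor_eq_iff]
  push_cast
  constructor <;> linarith

/-- This is the Hoeffding exponent at deviation η ^ (d + 1). -/
theorem rpow_deviation_eq {n : ℕ} (hn : 1 ≤ n) (D d : ℕ) :
    (n : ℝ) * (((n : ℝ) ^ (-(1 / (2 * (D : ℝ) + 2)))) ^ (d + 1)) ^ 2 =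
      (n : ℝ) ^ (1 - ((d : ℝ) + 1) / ((D : ℝ) + 1)) := by
  have hn0 : (0 : ℝ) < n := by exact_mod_cast hn
  rw [← pow_mul, ← Real.rpow_natCast, ← Real.rpow_mul hn0.le]
  nth_rewrite 1 [← Real.rpow_one (n : ℝ)]
  rw [← Real.rpow_add hn0]
  congr 1
  push_cast
  have : (D : ℝ) + 1 ≠ 0 := by positivity
  field_simp
  ring

/-- The error probability of the estimator for one measure and one small radius. -/
theorem measure_pi_dimEstimator_ne_le (P : Measure (E D)) [IsProbabilityMeasure P] {n : ℕ}
    (hn : 1 ≤ n) {x : E D} {η c : ℝ} (hη : 0 < η) (hηc : η ≤ c / 16)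
    (h1 : |P.real (Metric.ball x η) - c * η ^ d| ≤ 1 / 16 * (c * η ^ d))
    (h2 : |P.real (Metric.ball x (2 * η)) - c * (2 * η) ^ d| ≤ 1 / 16 * (c * (2 * η) ^ d)) :
    (Measure.pi fun _ : Fin n => P) {X | dimEstimator x η X ≠ (d : ℤ)} ≤
      ENNReal.ofReal (4 * Real.exp (-2 * (n * (η ^ (d + 1)) ^ 2))) := by
  have hc : 0 < c := by linarith
  have hA : 0 < c * η ^ d := by positivity
  -- The stochastic deviation takes up 1/16 of the mass and the bias another 1/16, together the 1/8
  -- that the estimator tolerates. The same absolute deviation is used for the larger ball, whose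
  -- mass scale is larger.
  have htA : η ^ (d + 1) ≤ c * η ^ d / 16 := by
    rw [pow_succ]
    nlinarith [pow_pos hη d]
  have hsub : {X : Fin n → E D | dimEstimator x η X ≠ (d : ℤ)} ⊆
      {X | η ^ (d + 1) ≤ |empiricalMass x η X - P.real (Metric.ball x η)|} ∪
        {X | η ^ (d + 1) ≤ |empiricalMass x (2 * η) X - P.real (Metric.ball x (2 * η))|} := by
    intro X hX
    by_contra hcon
    simp only [mem_union, mem_ofPred_eq, not_or, not_le] at hcon
    obtain ⟨g1, g2⟩ := hcon
    have e2 : c * (2 * η) ^ d = 2 ^ d * (c * η ^ d) := by rw [mul_pow]; ring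
    have h2d : (1 : ℝ) ≤ 2 ^ d := one_le_pow₀ (by norm_num)
    have hA2 : c * η ^ d ≤ 2 ^ d * (c * η ^ d) := le_mul_of_one_le_left hA.le h2d
    rw [e2] at h2
    rw [abs_le] at h1 h2
    rw [abs_lt] at g1 g2
    refine hX (dimEstimator_eq hA (abs_le.2 ?_) (abs_le.2 ?_)) <;>
      constructor <;> linarith [h1.1, h1.2, h2.1, h2.2, g1.1, g1.2, g2.1, g2.2]
  have ht : 0 ≤ η ^ (d + 1) := by positivity
  calc _ ≤ _ := measure_mono hsub
    _ ≤ _ := measure_union_le _ _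
    _ ≤ _ := add_le_add (measure_pi_empiricalMass_le P hn x η ht)
      (measure_pi_empiricalMass_le P hn x (2 * η) ht)
    _ = _ := by
      rw [← ENNReal.ofReal_add (by positivity) (by positivity)]
      congr 1
      ring

end ManifoldModel

end

theorem proposition3p8 (D d : ℕ) (hd : 1 ≤ d) (hdD : d < D)
    (α β τ L fmin fmax R : ℝ) (hα : 0 ≤ α) (hβ : 0 < β) (hτ : 0 < τ) (hL : 0 < L) (hR : 0 < R)
    (hfmin : 0 < fmin) (hf : fmin < fmax) :
    ∃ N : ℕ, ∀ n : ℕ, N ≤ n → ∀ x : ManifoldModel.E D,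
      (⨆ P ∈ ManifoldModel.model x d α β τ L fmin fmax R,
        (MeasureTheory.Measure.pi fun _ : Fin n =>
            (P : MeasureTheory.Measure (ManifoldModel.E D)))
          {X | ManifoldModel.dimEstimator x ((n : ℝ) ^ (-(1 / (2 * (D : ℝ) + 2)))) X ≠ (d : ℤ)}) ≤
      ENNReal.ofReal
        (4 * Real.exp (-2 * (n : ℝ) ^ (1 - ((d : ℝ) + 1) / ((D : ℝ) + 1)))) := by
  obtain ⟨η₀, hη₀, hmass⟩ := ManifoldModel.exists_mass_scaling (D := D) (α := α) (L := L) hd hdD.le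
    hβ hτ hR hfmin hf (ε := 1 / 16) (by norm_num)
  have hv := ManifoldModel.unitBallVolume_pos d
  have hlim : Filter.Tendsto (fun n : ℕ => (n : ℝ) ^ (-(1 / (2 * (D : ℝ) + 2))))
      Filter.atTop (𝓝 0) :=
    (tendsto_rpow_neg_atTop (by positivity)).comp tendsto_natCast_atTop_atTop
  -- The first bound brings 2η below η₀; the second ensures η ≤ c/16 for every c that occurs,
  -- whatever x and P.
  have hpos : 0 < min (η₀ / 2) (fmin * ManifoldModel.unitBallVolume d / 16) := by positivity
  obtain ⟨N, hN⟩ := Filter.eventually_atTop.1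
    ((hlim.eventually (gt_mem_nhds hpos)).and (Filter.eventually_ge_atTop 1))
  refine ⟨N, fun n hn x => iSup₂_le fun P hP => ?_⟩
  obtain ⟨hηlt, hn1⟩ := hN n hn
  have hn0 : (0 : ℝ) < n := by exact_mod_cast hn1
  obtain ⟨c, hc, hscale⟩ := hmass x P hP
  rw [← ManifoldModel.rpow_deviation_eq hn1 D d]
  set η := (n : ℝ) ^ (-(1 / (2 * (D : ℝ) + 2)))
  have hη : 0 < η := Real.rpow_pos_of_pos hn0 _
  have hη1 : η < η₀ / 2 := hηlt.trans_le (min_le_left _ _)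
  have hη2 : η ≤ fmin * ManifoldModel.unitBallVolume d / 16 := hηlt.le.trans (min_le_right _ _)
  exact ManifoldModel.measure_pi_dimEstimator_ne_le (P : Measure (ManifoldModel.E D)) hn1 hη
    (by linarith) (hscale η hη (by linarith)) (hscale (2 * η) (by positivity) (by linarith))
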